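/- **Model.** There are two types of sellers $\theta_1<\theta_2$, with probabilities $f_1,f_2>0$, $f_1+f_2=1$. A seller of type $\theta$ who chooses quality $q\in(0,1)$ pays a cost $C(q,\theta)$, and the outcome $x\in[0,1]$ is then drawn from a density $g(x|q)$. The function $C(\cdot,\theta)$ is twice differentiable on $[0,1]$ with $C_q\ge 0$, $C_{qq}\ge 0$, $C(0,\theta)=C_q(0,\theta)=0$, and $C$, $C_q$ are weakly decreasing in $\theta\in\{\theta_1,\theta_2\}$. *Assumption A.* For every $q\in(0,1)$, $g(\cdot|q)$ is a probability density on $[0,1]$ with $\int_0^1 x\,g(x|q)\,dx=q$; $g$ is continuously differentiable on $[0,1]\times(0,1)$; $g(x|q)>0$ for $x\in(0,1)$; and $g_q(x|q)/g(x|q)$ is strictly increasing in $x\in(0,1)$. *Assumption B.* For all $q<q'$ in $(0,1)$, let $\hat x(z)\in(0,1)$ be the solution of $z=g(\hat x(z)|q')/g(\hat x(z)|q)$, for $z$ in the range of this ratio on $(0,1)$, and put $$\phi(z)=\frac{g_q(\hat x(z)|q)}{g(\hat x(z)|q)},\qquad \psi(z)=z\,\frac{g_q(\hat x(z)|q')}{g(\hat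 x(z)|q')} .$$ Then $\phi,\psi$ are twice differentiable, $\phi''\le 0$, $\psi''\ge0$, and $\phi''/\psi''$ is well defined ($\psi''\neq 0$) and weakly increasing. **Ratings.** A rating system sends a signal $s$ with law $\pi(ds|x)$ when the outcome is $x$; prices are $p(s)=\mathbb E[x|s]$, and the signaled quality is $\bar x(x)=\int p(s)\,\pi(ds|x)$. For qualities $(q_1,q_2)$ put $h(x)=f_1g(x|q_1)+f_2g(x|q_2)$. The optimal rating design problem, with Pareto weights $\lambda(\theta_1)=1$, $\lambda(\theta_2)=0$, is to choose $q_1,q_2\in(0,1)$ and a weakly increasing $\bar x:[0,1]\to\mathbb R$ to maximize $$\sum_i \lambda(\theta_i) f_i\Big[\int_0^1\bar x(x)g(x|q_i)\,dx-C(q_i,\theta_i)\Big]$$ subject to the local incentive constraints $C_q(q_i,\theta_i)=\int_0^1\bar x(x)g_q(x|q_i)\,dx$, $i=1,2$, and majorization: $\int_0^x(\bar x(t)-t)h(t)\,dt\ge0$ for all $x\in[0,1]$, with equality at $x=1$. For $0\le x_1\le x_2\le 1$, the *$(x_1,x_2)$-threshold rating* fully reveals every outcome outside $(x_1,x_2)$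 and sends one common signal for all outcomes in $(x_1,x_2)$. The corresponding threshold signaled quality is $\bar x(x)=x$ outside $(x_1,x_2)$ and $\bar x(x)=\int_{x_1}^{x_2}t\,h(t)\,dt\big/\int_{x_1}^{x_2}h(t)\,dt$ on $(x_1,x_2)$. **Proposition.** Under these assumptions, let $(q_1,q_2,\bar x)$ be a solution of the optimal rating design problem with $q_2\ge q_1$. Then there are thresholds $0\le x_1\le x_2\le 1$ such that: 1. the threshold signaled quality is the signaled quality of the $(x_1,x_2)$-threshold rating and, with the same $q_1,q_2$, it solves the optimal rating design problem: an optimal rating fully reveals the outcomes below $x_1$ and above $x_2$ and pools those in $(x_1,x_2)$; 2. if $q_1<q_2$ and $C_{qq}(q_i,\theta_i)>0$ for $i=1,2$, then $x_1<x_2$; 3. if $q_1<q_2$ and $\phi''/\psi''$ is strictly increasing for the pair $(q_1,q_2)$, then the given $\bar x$ has this form: $\bar x(x)$ equals the threshold signaled quality at every $x\in(0,1)\setminus\{x_1,x_2\}$. -/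

import Mathlib

open MeasureTheory ProbabilityTheory Set

noncomputable section

namespace RatingDesign

/-! Notation: `g x q` is the density `g(x|q)` of the outcome `x ∈ [0,1]` given the quality `q`,
`C q θ` is the cost of quality `q` for type `θ`, and `xbar x` is the signaled quality (the expected
price) of a seller whose realized outcome is `x`. -/

/-- The partial derivative `g_q(x|q)`. -/
def gq (g : ℝ → ℝ → ℝ) (x q : ℝ) : ℝ := deriv (fun q' => g x q') q

/-- The marginal cost `C_q(q,θ)` (one-sided at the ends of `[0,1]`). -/
def Cq (C : ℝ → ℝ → ℝ) (q θ : ℝ) : ℝ := derivWithin (fun q' => C q' θ) (Icc 0 1) q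

/-- The second derivative `C_{qq}(q,θ)`. -/
def Cqq (C : ℝ → ℝ → ℝ) (q θ : ℝ) : ℝ := derivWithin (fun q' => Cq C q' θ) (Icc 0 1) q

/-- Assumptions on the cost function: `C_q ≥ 0`, `C_{qq} ≥ 0`, `C(0,θ) = C_q(0,θ) = 0`, and, on the
set `Θ` of types, `C` and `C_q` are decreasing in `θ` (that is, `C_θ ≤ 0` and `C_{qθ} ≤ 0`). -/
structure CostAssumption (C : ℝ → ℝ → ℝ) (Θ : Set ℝ) : Prop where
  diff : ∀ θ ∈ Θ, DifferentiableOn ℝ (fun q => C q θ) (Icc 0 1)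
  diff_Cq : ∀ θ ∈ Θ, DifferentiableOn ℝ (fun q => Cq C q θ) (Icc 0 1)
  Cq_nonneg : ∀ θ ∈ Θ, ∀ q ∈ Icc (0 : ℝ) 1, 0 ≤ Cq C q θ
  Cqq_nonneg : ∀ θ ∈ Θ, ∀ q ∈ Icc (0 : ℝ) 1, 0 ≤ Cqq C q θ
  antitone_type : ∀ q ∈ Icc (0 : ℝ) 1, AntitoneOn (fun θ => C q θ) Θ
  submodular : ∀ q ∈ Icc (0 : ℝ) 1, AntitoneOn (fun θ => Cq C q θ) Θ
  zero : ∀ θ ∈ Θ, C 0 θ = 0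
  Cq_zero : ∀ θ ∈ Θ, Cq C 0 θ = 0

/-- Assumptions on the outcome distributions: `g(·|q)` is a probability density on `[0,1]` with
mean `q`, continuously differentiable in `(x,q)`, with full support, and with the (strict) monotone
likelihood ratio property. -/
structure OutcomeAssumption (g : ℝ → ℝ → ℝ) : Prop where
  mass : ∀ q ∈ Ioo (0 : ℝ) 1, ∫ x in (0 : ℝ)..1, g x q = 1
  mean : ∀ q ∈ Ioo (0 : ℝ) 1, ∫ x in (0 : ℝ)..1, x * g x q = q
  contDiff : ContDiffOn ℝ 1 (fun p : ℝ × ℝ => g p.1 p.2) (Icc (0 : ℝ) 1 ×ˢ Ioo (0 : ℝ) 1)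
  pos : ∀ q ∈ Ioo (0 : ℝ) 1, ∀ x ∈ Ioo (0 : ℝ) 1, 0 < g x q
  mlrp : ∀ q ∈ Ioo (0 : ℝ) 1, StrictMonoOn (fun x => gq g x q / g x q) (Ioo 0 1)

/-- The likelihood ratio `z(x) = g(x|q₂) / g(x|q₁)`. -/
def likelihoodRatio (g : ℝ → ℝ → ℝ) (q₁ q₂ x : ℝ) : ℝ := g x q₂ / g x q₁

/-- The set of values of the likelihood ratio on `(0,1)`. -/
def ratioRange (g : ℝ → ℝ → ℝ) (q₁ q₂ : ℝ) : Set ℝ := likelihoodRatio g q₁ q₂ '' Ioo 0 1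

/-- The solution `x̂(z) ∈ (0,1)` of `z = g(x̂|q₂) / g(x̂|q₁)`, for `z` in `ratioRange g q₁ q₂`. -/
def xhat (g : ℝ → ℝ → ℝ) (q₁ q₂ : ℝ) : ℝ → ℝ :=
  Function.invFunOn (likelihoodRatio g q₁ q₂) (Ioo 0 1)

/-- `φ(z) = g_q(x̂(z)|q₁) / g(x̂(z)|q₁)`. -/
def phi (g : ℝ → ℝ → ℝ) (q₁ q₂ z : ℝ) : ℝ :=
  gq g (xhat g q₁ q₂ z) q₁ / g (xhat g q₁ q₂ z) q₁

/-- `ψ(z) = z g_q(x̂(z)|q₂) / g(x̂(z)|q₂)`. -/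
def psi (g : ℝ → ℝ → ℝ) (q₁ q₂ z : ℝ) : ℝ :=
  z * (gq g (xhat g q₁ q₂ z) q₂ / g (xhat g q₁ q₂ z) q₂)

/-- The ratio `φ''(z) / ψ''(z)`. -/
def curvatureRatio (g : ℝ → ℝ → ℝ) (q₁ q₂ z : ℝ) : ℝ :=
  deriv (deriv (phi g q₁ q₂)) z / deriv (deriv (psi g q₁ q₂)) z

/-- The curvature assumption: for all `q₁ < q₂`, the functions `φ`, `ψ` are twice differentiable,
`φ'' ≤ 0`, `ψ'' ≥ 0`, and the ratio `φ''/ψ''` is well defined and (weakly) increasing. -/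
structure CurvatureAssumption (g : ℝ → ℝ → ℝ) : Prop where
  diff_phi : ∀ q₁ ∈ Ioo (0 : ℝ) 1, ∀ q₂ ∈ Ioo (0 : ℝ) 1, q₁ < q₂ →
    DifferentiableOn ℝ (phi g q₁ q₂) (ratioRange g q₁ q₂) ∧
    DifferentiableOn ℝ (deriv (phi g q₁ q₂)) (ratioRange g q₁ q₂)
  diff_psi : ∀ q₁ ∈ Ioo (0 : ℝ) 1, ∀ q₂ ∈ Ioo (0 : ℝ) 1, q₁ < q₂ →
    DifferentiableOn ℝ (psi g q₁ q₂) (ratioRange g q₁ q₂) ∧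
    DifferentiableOn ℝ (deriv (psi g q₁ q₂)) (ratioRange g q₁ q₂)
  phi_concave : ∀ q₁ ∈ Ioo (0 : ℝ) 1, ∀ q₂ ∈ Ioo (0 : ℝ) 1, q₁ < q₂ →
    ∀ z ∈ ratioRange g q₁ q₂, deriv (deriv (phi g q₁ q₂)) z ≤ 0
  psi_convex : ∀ q₁ ∈ Ioo (0 : ℝ) 1, ∀ q₂ ∈ Ioo (0 : ℝ) 1, q₁ < q₂ →
    ∀ z ∈ ratioRange g q₁ q₂, 0 ≤ deriv (deriv (psi g q₁ q₂)) z
  psi_ne : ∀ q₁ ∈ Ioo (0 : ℝ) 1, ∀ q₂ ∈ Ioo (0 : ℝ) 1, q₁ < q₂ →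
    ∀ z ∈ ratioRange g q₁ q₂, deriv (deriv (psi g q₁ q₂)) z ≠ 0
  ratio_mono : ∀ q₁ ∈ Ioo (0 : ℝ) 1, ∀ q₂ ∈ Ioo (0 : ℝ) 1, q₁ < q₂ →
    MonotoneOn (curvatureRatio g q₁ q₂) (ratioRange g q₁ q₂)

section Problem

variable {ι : Type*} [Fintype ι]

/-- The density `h(x) = ∑ᵢ fᵢ g(x|qᵢ)` of outcomes when a type `i`, of probability `fᵢ`, chooses
`qᵢ`. -/
def outcomeDensity (g : ℝ → ℝ → ℝ) (f q : ι → ℝ) (x : ℝ) : ℝ := ∑ i, f i * g x (q i)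

/-- The distribution `H` of outcomes. -/
def outcomeLaw (g : ℝ → ℝ → ℝ) (f q : ι → ℝ) : Measure ℝ :=
  (volume.restrict (Icc 0 1)).withDensity (fun x => ENNReal.ofReal (outcomeDensity g f q x))

/-- `xbar ≼_H x`: the signaled quality `xbar` is majorized by the outcome, for outcomes of
density `h` on `[0,1]`. -/
def IsMajorized (h xbar : ℝ → ℝ) : Prop :=
  (∀ x ∈ Icc (0 : ℝ) 1, 0 ≤ ∫ t in (0 : ℝ)..x, (xbar t - t) * h t) ∧
    ∫ t in (0 : ℝ)..1, (xbar t - t) * h t = 0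

/-- Feasibility of the qualities `q` and the signaled quality function `xbar`: the local incentive
constraints, monotonicity and majorization. -/
structure IsFeasible (g C : ℝ → ℝ → ℝ) (θ f q : ι → ℝ) (xbar : ℝ → ℝ) : Prop where
  quality : ∀ i, q i ∈ Ioo (0 : ℝ) 1
  incentive : ∀ i, Cq C (q i) (θ i) = ∫ x in (0 : ℝ)..1, xbar x * gq g x (q i)
  mono : MonotoneOn xbar (Icc 0 1)
  majorized : IsMajorized (outcomeDensity g f q) xbar

/-- The payoff `∫ xbar(x) g(x|q) dx - C(q,θ)` of a seller of type `θ` that chooses `q`. -/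
def sellerPayoff (g C : ℝ → ℝ → ℝ) (xbar : ℝ → ℝ) (q θ : ℝ) : ℝ :=
  (∫ x in (0 : ℝ)..1, xbar x * g x q) - C q θ

/-- The weighted average of the sellers' payoffs, with Pareto weights `lam`. -/
def welfare (g C : ℝ → ℝ → ℝ) (θ f lam q : ι → ℝ) (xbar : ℝ → ℝ) : ℝ :=
  ∑ i, lam i * sellerPayoff g C xbar (q i) (θ i) * f i

/-- `(q, xbar)` solves the optimal rating design problem for the Pareto weights `lam`. -/
def IsOptimal (g C : ℝ → ℝ → ℝ) (θ f lam q : ι → ℝ) (xbar : ℝ → ℝ) : Prop :=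
  IsFeasible g C θ f q xbar ∧
    ∀ (q' : ι → ℝ) (xbar' : ℝ → ℝ), IsFeasible g C θ f q' xbar' →
      welfare g C θ f lam q' xbar' ≤ welfare g C θ f lam q xbar

end Problem

/-- `xbar` is the signaled quality function of the rating system `(S, π)` when outcomes have law
`H`: prices are `p(s) = E[x|s]` and `xbar(x) = ∫ p(s) π(ds|x)`. -/
def IsSignaledQuality {S : Type*} [MeasurableSpace S] (H : Measure ℝ) (π : Kernel ℝ S)
    (xbar : ℝ → ℝ) : Prop :=
  ∃ p : S → ℝ, Measurable p ∧
    (fun w : ℝ × S => p w.2) =ᵐ[H ⊗ₘ π]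
      (H ⊗ₘ π)[fun w : ℝ × S => w.1 | MeasurableSpace.comap Prod.snd inferInstance] ∧
    ∀ᵐ x ∂H, xbar x = ∫ s, p s ∂(π x)

open Classical in
/-- The signal sent by the threshold rating: all `x ∈ (x₁,x₂)` send one common signal, sent by no
other outcome; every other outcome is revealed. -/
def thresholdSignal (x₁ x₂ x : ℝ) : ℝ := if x ∈ Ioo x₁ x₂ then (x₁ + x₂) / 2 else x

theorem measurable_thresholdSignal (x₁ x₂ : ℝ) : Measurable (thresholdSignal x₁ x₂) := by
  classical
  exact Measurable.ite measurableSet_Ioo measurable_const measurable_id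

/-- The rating system that fully reveals outcomes outside `(x₁,x₂)` and pools those inside. -/
def thresholdRating (x₁ x₂ : ℝ) : Kernel ℝ ℝ :=
  Kernel.deterministic (thresholdSignal x₁ x₂) (measurable_thresholdSignal x₁ x₂)

open Classical in
/-- The signaled quality `x` outside `(x₁,x₂)` and `E_h[x | x₁ < x < x₂]` inside. -/
def thresholdQuality (h : ℝ → ℝ) (x₁ x₂ x : ℝ) : ℝ :=
  if x ∈ Ioo x₁ x₂ then (∫ t in x₁..x₂, t * h t) / (∫ t in x₁..x₂, h t) else x

end RatingDesign

end

/-! Let q₁ < q₂ and write gᵢ = g(·|qᵢ), Kᵢ = g_q(·|qᵢ), z = g₂/g₁. Then K₁ = φ(z) g₁, K₂ = ψ(z) g₁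
and h = (f₁ + f₂ z) g₁. With the qualities held fixed, the problem is linear: the signaled quality y
maximizes ∫ y g₁ among increasing functions majorized by the outcome, with ∫ y K₁ and ∫ y K₂
prescribed. Majorization fixes ∫ y h, so prescribing w = ∫ y g₁ also prescribes ∫ y g₂.

Duality. Let P = α h, and let T be the threshold quality of (x₁,x₂). Suppose α is increasing and
nonpositive left of x₁, increasing and nonnegative right of x₂, while on (x₁,x₂) P is first
nonnegative, then nonpositive, with integral zero. Then T maximizes ∫ y P
(`Certificate.integral_le`): the gap splits into two integrals of an increasing function against a
function with nonnegative primitive vanishing at 1, and each is nonpositive by `integral_mul_le`.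
The quantitative form of that lemma gives uniqueness when the signs and monotonicities are strict.
Here P = K₁ + γ K₂ + A g₁ + B g₂ = N(z) g₁ with N = φ + γψ + A + Bz. The multipliers make N vanish
at both ends of the pool and P integrate to zero on it. Then N has a third zero, hence an
inflection; as φ''/ψ'' is increasing, N is concave before it and convex after it, which gives all
the required signs (`exists_certificate_middle`). Pools touching 0 or 1 need only the convexity of ψ
and the concavity of φ.

Choice of thresholds. Full pooling and full revelation are the unique maximizer and minimizer of ∫ y
g₁, so assume that w lies strictly between their values. Among the threshold qualities with value w,
those with pool (0,z) maximize ∫ y K₂ and those with pool (x,1) minimize it. A connectedness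
argument (`exists_level_point`) yields a threshold quality T with value w and the prescribed ∫ y K₂.
By duality ∫ T K₁ is at least the prescribed value. If it were larger, T, the threshold quality L
with pool (0,z) and value w, and full pooling, whose incentives are (0,0), would have a convex
combination with exactly the prescribed incentives. Full pooling has positive weight in it and value
above w, contradicting optimality, unless y is already L (`exists_threshold`).

If q₁ = q₂, then ∫ y g₁ is fixed by majorization and a single incentive remains, met by a pool (0,z)
by the intermediate value theorem. The pool is nondegenerate when q₁ < q₂ because full revelation
can be improved (`not_isOptimal_full`): a little garbling gives the low type a first-order transfer
from the high type, at a cost that is small when the qualities move little. -/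

namespace RatingDesign

/-! ### Integrals of increasing functions against functions with nonnegative primitive -/

theorem integral_zero_one_eq_Ioo (u : ℝ → ℝ) :
    ∫ x in (0 : ℝ)..1, u x = ∫ x in Ioo (0 : ℝ) 1, u x := by
  rw [intervalIntegral.integral_of_le zero_le_one, integral_Ioc_eq_integral_Ioo]

theorem integrableOn_Ioo_of_intervalIntegrable {u : ℝ → ℝ}
    (hu : IntervalIntegrable u volume 0 1) : IntegrableOn u (Ioo 0 1) :=
  ((intervalIntegrable_iff_integrableOn_Ioo_of_le zero_le_one).1 hu)

theorem integral_congr_Ioo {u v : ℝ → ℝ} (huv : ∀ x ∈ Ioo (0 : ℝ) 1, u x = v x) :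
    ∫ x in (0 : ℝ)..1, u x = ∫ x in (0 : ℝ)..1, v x := by
  rw [integral_zero_one_eq_Ioo, integral_zero_one_eq_Ioo]
  exact setIntegral_congr_fun measurableSet_Ioo huv

theorem intervalIntegrable_congr_Ioo {u v : ℝ → ℝ} (huv : ∀ x ∈ Ioo (0 : ℝ) 1, u x = v x)
    (hu : IntervalIntegrable u volume 0 1) : IntervalIntegrable v volume 0 1 := by
  rw [intervalIntegrable_iff_integrableOn_Ioo_of_le zero_le_one] at hu ⊢
  exact hu.congr_fun huv measurableSet_Ioo

theorem intervalIntegrable_sub {u : ℝ → ℝ} (hu : IntervalIntegrable u volume 0 1) {a b : ℝ}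
    (ha : a ∈ Icc (0 : ℝ) 1) (hb : b ∈ Icc (0 : ℝ) 1) : IntervalIntegrable u volume a b := by
  apply hu.mono_set
  rw [uIcc_of_le zero_le_one]
  exact uIcc_subset_Icc ha hb

/-- A superlevel set of an increasing function is a final interval `(s,1)` up to a null set, and the
integral of `u` over it is minus the primitive at `s`. The last clause locates `s` between `a` and
`b` for the levels separating `α a` from `α b`; these levels produce the gap. -/
theorem exists_upper_threshold {u α : ℝ → ℝ} (hu : IntervalIntegrable u volume 0 1)
    (hU1 : ∫ t in (0 : ℝ)..1, u t = 0) (hα : Monotone α) (t : ℝ) :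
    ∃ s ∈ Icc (0 : ℝ) 1,
      (∫ x in Ioo (0 : ℝ) 1, {x | t < α x}.indicator u x) = - ∫ x in (0 : ℝ)..s, u x ∧
      ∀ a ∈ Ioo (0 : ℝ) 1, ∀ b ∈ Ioo (0 : ℝ) 1, α a ≤ t → t < α b → s ∈ Icc a b := by
  -- Adjoining 1 makes the infimum equal to 1 when the superlevel set is empty.
  set S : Set ℝ := {x | x ∈ Icc (0 : ℝ) 1 ∧ t < α x} ∪ {1} with hS
  have h1 : (1 : ℝ) ∈ S := Or.inr rfl
  have hb : ∀ x ∈ S, 0 ≤ x := by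
    rintro x (hx | hx)
    · exact hx.1.1
    · rw [hx]; exact zero_le_one
  have hbdd : BddBelow S := ⟨0, hb⟩
  have hs0 : 0 ≤ sInf S := le_csInf ⟨1, h1⟩ hb
  have hs1 : sInf S ≤ 1 := csInf_le hbdd h1
  have hgt : ∀ x ∈ Ioo (0 : ℝ) 1, sInf S < x → t < α x := by
    intro x hx hlt
    obtain ⟨y, hy, hyx⟩ := exists_lt_of_csInf_lt ⟨1, h1⟩ hlt
    rcases hy with hy | hy
    · exact hy.2.trans_le (hα hyx.le)
    · rw [mem_singleton_iff] at hy; rw [hy] at hyx; exact absurd hx.2 hyx.not_gt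
  have hle : ∀ x ∈ Ioo (0 : ℝ) 1, t < α x → sInf S ≤ x := fun x hx hlt =>
    csInf_le hbdd (Or.inl ⟨⟨hx.1.le, hx.2.le⟩, hlt⟩)
  refine ⟨sInf S, ⟨hs0, hs1⟩, ?_, ?_⟩
  · have hadd := intervalIntegral.integral_add_adjacent_intervals
      (intervalIntegrable_sub hu (left_mem_Icc.2 zero_le_one) ⟨hs0, hs1⟩)
      (intervalIntegrable_sub hu ⟨hs0, hs1⟩ (right_mem_Icc.2 zero_le_one))
    have : - ∫ x in (0 : ℝ)..sInf S, u x = ∫ x in (sInf S)..1, u x := by linarith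
    have hm : MeasurableSet {x | t < α x} := hα.measurable measurableSet_Ioi
    rw [this, intervalIntegral.integral_of_le hs1, integral_Ioc_eq_integral_Ioo,
      integral_indicator hm, Measure.restrict_restrict hm]
    apply setIntegral_congr_set
    have hne : ∀ᵐ x : ℝ, x ≠ sInf S := by simp [ae_iff, measure_singleton]
    filter_upwards [hne] with x hx
    apply propext
    constructor
    · rintro ⟨hx1, hx2⟩
      exact ⟨lt_of_le_of_ne (hle x hx2 hx1) (Ne.symm hx), hx2.2⟩
    · rintro ⟨hx1, hx2⟩
      exact ⟨hgt x ⟨hs0.trans_lt hx1, hx2⟩ hx1, hs0.trans_lt hx1, hx2⟩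
  · intro a ha b hb' hat htb
    refine ⟨?_, hle b hb' htb⟩
    by_contra hcon
    exact absurd (hgt a ha (not_le.1 hcon)) (not_lt.2 hat)

/-- Layer cake: `α x + M` is the length of the set of levels `t ∈ (-M, M]` with `t < α x`. Fubini
turns the integral into one over levels of minus the primitive of `u` at the threshold of the level.
Every level contributes at most 0, and those between `α a` and `α b` at most `-c`. The constant `M`
drops out since `u` has integral zero. -/
theorem integral_mul_le_of_bounded {u α : ℝ → ℝ} (hu : IntervalIntegrable u volume 0 1)
    (hU : ∀ x ∈ Icc (0 : ℝ) 1, 0 ≤ ∫ t in (0 : ℝ)..x, u t) (hU1 : ∫ t in (0 : ℝ)..1, u t = 0)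
    (hα : Monotone α) {M : ℝ} (hM : ∀ x, α x ∈ Icc (-M) M) {a b c : ℝ}
    (ha : a ∈ Ioo (0 : ℝ) 1) (hb : b ∈ Ioo (0 : ℝ) 1) (hab : a ≤ b)
    (hc : ∀ x ∈ Icc a b, c ≤ ∫ t in (0 : ℝ)..x, u t) :
    ∫ x in (0 : ℝ)..1, α x * u x ≤ -(c * (α b - α a)) := by
  have hMM : -M ≤ M := (hM 0).1.trans (hM 0).2
  have huI := integrableOn_Ioo_of_intervalIntegrable hu
  set μ : Measure ℝ := volume.restrict (Ioo (0 : ℝ) 1) with hμ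
  set ν : Measure ℝ := volume.restrict (Ioc (-M) M) with hν
  have hfin : IsFiniteMeasure ν := ⟨by simp [hν]⟩
  set S : Set (ℝ × ℝ) := {p | p.2 < α p.1} with hS
  have hSm : MeasurableSet S :=
    measurableSet_lt measurable_snd (hα.measurable.comp measurable_fst)
  have hFint : Integrable (S.indicator (fun p : ℝ × ℝ => u p.1)) (μ.prod ν) :=
    (Integrable.comp_fst huI ν).indicator hSm
  have hinner : ∀ x, ∫ t, S.indicator (fun p : ℝ × ℝ => u p.1) (x, t) ∂ν = (α x + M) * u x := by
    intro x
    have h1 : (fun t => S.indicator (fun p : ℝ × ℝ => u p.1) (x, t))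
        = (Iio (α x)).indicator (fun _ => u x) := by
      funext t
      simp only [Set.indicator, hS, mem_ofPred_eq, mem_Iio]
    rw [h1, integral_indicator measurableSet_Iio, hν, Measure.restrict_restrict measurableSet_Iio]
    rw [setIntegral_const]
    have : volume.real (Iio (α x) ∩ Ioc (-M) M) = α x + M := by
      have hEq : Iio (α x) ∩ Ioc (-M) M = Ioo (-M) (α x) := by
        ext t
        simp only [mem_inter_iff, mem_Iio, mem_Ioc, mem_Ioo]
        constructor
        · rintro ⟨h1, h2, h3⟩; exact ⟨h2, h1⟩
        · rintro ⟨h1, h2⟩; exact ⟨h2, h1, h2.le.trans (hM x).2⟩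
      rw [hEq, Real.volume_real_Ioo_of_le (hM x).1]
      ring
    rw [this, smul_eq_mul]
  have hswap := integral_integral_swap
    (f := fun x t => S.indicator (fun p : ℝ × ℝ => u p.1) (x, t)) hFint
  simp only [hinner] at hswap
  have hαu : Integrable (fun x => α x * u x) μ := by
    refine Integrable.bdd_mul (c := M) huI hα.measurable.aestronglyMeasurable ?_
    filter_upwards with x
    rw [Real.norm_eq_abs, abs_le]
    exact hM x
  have hlhs : ∫ x, (α x + M) * u x ∂μ = ∫ x in (0 : ℝ)..1, α x * u x := by
    have : ∀ x, (α x + M) * u x = α x * u x + M * u x := fun x => by ring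
    simp only [this]
    rw [integral_add hαu (huI.const_mul M), integral_const_mul, hμ,
      ← integral_zero_one_eq_Ioo, ← integral_zero_one_eq_Ioo, hU1]
    ring
  rw [← hlhs, hswap]
  have hright : Integrable (fun t => ∫ x, S.indicator (fun p : ℝ × ℝ => u p.1) (x, t) ∂μ) ν :=
    hFint.integral_prod_right
  have hbound : ∀ t, ∫ x, S.indicator (fun p : ℝ × ℝ => u p.1) (x, t) ∂μ
      ≤ (Ico (α a) (α b)).indicator (fun _ => -c) t := by
    intro t
    obtain ⟨s, hs, hs1, hs2⟩ := exists_upper_threshold hu hU1 hα t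
    have h1 : (fun x => S.indicator (fun p : ℝ × ℝ => u p.1) (x, t))
        = {x | t < α x}.indicator u := by
      funext x
      simp only [Set.indicator, hS, mem_ofPred_eq]
    rw [h1, hs1]
    by_cases ht : t ∈ Ico (α a) (α b)
    · rw [indicator_of_mem ht]
      exact neg_le_neg (hc s (hs2 a ha b hb ht.1 ht.2))
    · rw [indicator_of_notMem ht]
      exact neg_nonpos.2 (hU s hs)
  refine (integral_mono hright ((integrable_const _).indicator measurableSet_Ico) hbound).trans ?_
  rw [integral_indicator measurableSet_Ico, hν, Measure.restrict_restrict measurableSet_Ico,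
    setIntegral_const]
  have : volume.real (Ico (α a) (α b) ∩ Ioc (-M) M) = α b - α a := by
    rw [← Real.volume_real_Ico_of_le (hα hab)]
    apply measureReal_congr
    have hne : ∀ᵐ x : ℝ, x ≠ -M := by simp [ae_iff, measure_singleton]
    filter_upwards [hne] with x hx
    apply propext
    constructor
    · rintro ⟨h1, h2⟩; exact h1
    · intro h1
      exact ⟨h1, lt_of_le_of_ne ((hM a).1.trans h1.1) (Ne.symm hx), h1.2.le.trans (hM b).2⟩
  rw [this, smul_eq_mul]
  linarith

/-- If the primitive of `u` is nonnegative on `[0,1]` and vanishes at `1`, then `u` integrates to a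
nonpositive number against every increasing function, with a quantitative gap. -/
theorem integral_mul_le {u α : ℝ → ℝ} (hu : IntervalIntegrable u volume 0 1)
    (hU : ∀ x ∈ Icc (0 : ℝ) 1, 0 ≤ ∫ t in (0 : ℝ)..x, u t) (hU1 : ∫ t in (0 : ℝ)..1, u t = 0)
    (hα : MonotoneOn α (Ioo 0 1)) (hαu : IntervalIntegrable (fun x => α x * u x) volume 0 1)
    {a b c : ℝ}
    (ha : a ∈ Ioo (0 : ℝ) 1) (hb : b ∈ Ioo (0 : ℝ) 1) (hab : a ≤ b)
    (hc : ∀ x ∈ Icc a b, c ≤ ∫ t in (0 : ℝ)..x, u t) :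
    ∫ x in (0 : ℝ)..1, α x * u x ≤ -(c * (α b - α a)) := by
  -- Truncation at `±n` reduces to the bounded case; the limit is taken by dominated convergence
  -- with bound `|α u|`.
  set β : ℕ → ℝ → ℝ := fun n x => max (-(n : ℝ)) (min n (α x)) with hβ
  have hclamp : ∀ (n : ℕ) (y : ℝ), max (-(n : ℝ)) (min n y) ∈ Icc (-(n : ℝ)) n := fun n y =>
    ⟨le_max_left _ _, max_le (by linarith [n.cast_nonneg (α := ℝ)]) (min_le_left _ _)⟩
  have hcm : ∀ n : ℕ, Monotone (fun y : ℝ => max (-(n : ℝ)) (min n y)) := fun n x y hxy =>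
    max_le_max le_rfl (min_le_min le_rfl hxy)
  have hineq : ∀ n : ℕ, ∫ x in (0 : ℝ)..1, β n x * u x ≤ -(c * (β n b - β n a)) := by
    intro n
    have hmono : MonotoneOn (β n) (Ioo 0 1) := fun x hx y hy hxy => hcm n (hα hx hy hxy)
    obtain ⟨γ, hγ, hγe⟩ := hmono.exists_monotone_extension
      ⟨-(n : ℝ), by rintro _ ⟨x, -, rfl⟩; exact (hclamp n _).1⟩
      ⟨(n : ℝ), by rintro _ ⟨x, -, rfl⟩; exact (hclamp n _).2⟩
    -- The monotone extension `γ` comes without a bound on all of ℝ, so it is clamped again; on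
    -- `(0,1)` nothing changes.
    set δ : ℝ → ℝ := fun x => max (-(n : ℝ)) (min n (γ x)) with hδ
    have hδe : ∀ x ∈ Ioo (0 : ℝ) 1, δ x = β n x := by
      intro x hx
      have h1 := hγe hx
      have h2 := hclamp n (α x)
      simp only [hδ]
      rw [← h1, min_eq_right h2.2, max_eq_right h2.1]
    have := integral_mul_le_of_bounded hu hU hU1 (α := δ) ((hcm n).comp hγ)
      (fun x => hclamp n _) ha hb hab hc
    rw [hδe a ha, hδe b hb] at this
    rwa [integral_congr_Ioo (fun x hx => by rw [hδe x hx])] at this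
  have hlim : ∀ y : ℝ, Filter.Tendsto (fun n : ℕ => max (-(n : ℝ)) (min n y)) Filter.atTop
      (nhds y) := by
    intro y
    apply tendsto_const_nhds.congr'
    obtain ⟨N, hN⟩ := exists_nat_ge |y|
    filter_upwards [Filter.eventually_ge_atTop N] with n hn
    have : |y| ≤ n := hN.trans (by exact_mod_cast hn)
    rw [abs_le] at this
    rw [min_eq_right this.2, max_eq_right this.1]
  have hclabs : ∀ (n : ℕ) (y : ℝ), |max (-(n : ℝ)) (min n y)| ≤ |y| := by
    intro n y
    have := n.cast_nonneg (α := ℝ)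
    rcases le_total 0 y with hy | hy
    · rw [abs_of_nonneg hy, max_eq_right (by linarith [le_min this hy]),
        abs_of_nonneg (le_min this hy)]
      exact min_le_right _ _
    · rw [abs_of_nonpos hy, min_eq_right (hy.trans this), abs_of_nonpos (max_le (by linarith) hy)]
      linarith [le_max_right (-(n : ℝ)) y]
  have hαu' := integrableOn_Ioo_of_intervalIntegrable hαu
  have huI := integrableOn_Ioo_of_intervalIntegrable hu
  have hmeas : ∀ n, AEStronglyMeasurable (fun x => β n x * u x) (volume.restrict (Ioo (0:ℝ) 1)) := by
    intro n
    refine AEStronglyMeasurable.mul ?_ huI.aestronglyMeasurable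
    have : MonotoneOn (β n) (Ioo 0 1) := fun x hx y hy hxy => hcm n (hα hx hy hxy)
    exact (aemeasurable_restrict_of_monotoneOn measurableSet_Ioo this).aestronglyMeasurable
  have htend : Filter.Tendsto (fun n => ∫ x in (0 : ℝ)..1, β n x * u x) Filter.atTop
      (nhds (∫ x in (0 : ℝ)..1, α x * u x)) := by
    simp only [integral_zero_one_eq_Ioo]
    refine tendsto_integral_of_dominated_convergence (fun x => ‖α x * u x‖) hmeas hαu'.norm ?_ ?_
    · intro n
      filter_upwards with x
      rw [norm_mul, norm_mul]
      exact mul_le_mul_of_nonneg_right (hclabs n (α x)) (norm_nonneg _)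
    · filter_upwards with x
      exact (hlim (α x)).mul tendsto_const_nhds
  refine le_of_tendsto_of_tendsto' htend ?_ hineq
  exact (((hlim (α b)).sub (hlim (α a))).const_mul c).neg

/-- A function that is first nonnegative, then nonpositive, with vanishing integral, has a
nonnegative primitive. -/
theorem primitive_nonneg {u : ℝ → ℝ} {a b d : ℝ} (hu : IntervalIntegrable u volume a b)
    (hd : d ∈ Icc a b) (h1 : ∀ x ∈ Ioo a d, 0 ≤ u x) (h2 : ∀ x ∈ Ioo d b, u x ≤ 0)
    (h0 : 0 ≤ ∫ t in a..b, u t) {x : ℝ} (hx : x ∈ Icc a b) : 0 ≤ ∫ t in a..x, u t := by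
  have hab : a ≤ b := hd.1.trans hd.2
  have hsub : ∀ c ∈ Icc a b, ∀ e ∈ Icc a b, IntervalIntegrable u volume c e := by
    intro c hc e he
    apply hu.mono_set
    rw [uIcc_of_le hab]
    exact uIcc_subset_Icc hc he
  rcases le_total x d with hxd | hxd
  · rw [intervalIntegral.integral_of_le hx.1, integral_Ioc_eq_integral_Ioo]
    exact setIntegral_nonneg measurableSet_Ioo fun t ht => h1 t ⟨ht.1, ht.2.trans_le hxd⟩
  · have hadd := intervalIntegral.integral_add_adjacent_intervals
      (hsub a ⟨le_rfl, hab⟩ x hx) (hsub x hx b ⟨hab, le_rfl⟩)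
    have : ∫ t in x..b, u t ≤ 0 := by
      rw [intervalIntegral.integral_of_le hx.2, integral_Ioc_eq_integral_Ioo]
      exact setIntegral_nonpos measurableSet_Ioo fun t ht => h2 t ⟨hxd.trans_lt ht.1, ht.2⟩
    linarith

theorem primitive_pos {u : ℝ → ℝ} {a b d : ℝ} (hu : IntervalIntegrable u volume a b)
    (hd : d ∈ Icc a b) (h1 : ∀ x ∈ Ioo a d, 0 < u x) (h2 : ∀ x ∈ Ioo d b, u x < 0)
    (h0 : 0 ≤ ∫ t in a..b, u t) {x : ℝ} (hx : x ∈ Ioo a b) : 0 < ∫ t in a..x, u t := by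
  have hab : a ≤ b := hd.1.trans hd.2
  have hsub : ∀ c ∈ Icc a b, ∀ e ∈ Icc a b, IntervalIntegrable u volume c e := by
    intro c hc e he
    apply hu.mono_set
    rw [uIcc_of_le hab]
    exact uIcc_subset_Icc hc he
  rcases le_total x d with hxd | hxd
  · exact intervalIntegral.intervalIntegral_pos_of_pos_on
      (hsub a ⟨le_rfl, hab⟩ x ⟨hx.1.le, hx.2.le⟩) (fun t ht => h1 t ⟨ht.1, ht.2.trans_le hxd⟩) hx.1
  · have hadd := intervalIntegral.integral_add_adjacent_intervals
      (hsub a ⟨le_rfl, hab⟩ x ⟨hx.1.le, hx.2.le⟩) (hsub x ⟨hx.1.le, hx.2.le⟩ b ⟨hab, le_rfl⟩)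
    have : 0 < ∫ t in x..b, - u t := intervalIntegral.intervalIntegral_pos_of_pos_on
      (hsub x ⟨hx.1.le, hx.2.le⟩ b ⟨hab, le_rfl⟩).neg
      (fun t ht => neg_pos.2 (h2 t ⟨hxd.trans_lt ht.1, ht.2⟩)) hx.2
    rw [intervalIntegral.integral_neg] at this
    linarith

end RatingDesign

/-! ### Threshold qualities and certificates of optimality -/

namespace RatingDesign

theorem intervalIntegral_congr_Ioo {u v : ℝ → ℝ} {a b : ℝ} (hab : a ≤ b)
    (huv : ∀ x ∈ Ioo a b, u x = v x) : ∫ x in a..b, u x = ∫ x in a..b, v x := by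
  rw [intervalIntegral.integral_of_le hab, intervalIntegral.integral_of_le hab,
    integral_Ioc_eq_integral_Ioo, integral_Ioc_eq_integral_Ioo]
  exact setIntegral_congr_fun measurableSet_Ioo huv

theorem intervalIntegrable_of_monotoneOn {y : ℝ → ℝ} (hy : MonotoneOn y (Icc 0 1)) :
    IntervalIntegrable y volume 0 1 := by
  apply MonotoneOn.intervalIntegrable
  rwa [uIcc_of_le zero_le_one]

theorem intervalIntegrable_of_continuousOn {K : ℝ → ℝ} (hK : ContinuousOn K (Icc 0 1)) :
    IntervalIntegrable K volume 0 1 := by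
  apply ContinuousOn.intervalIntegrable
  rwa [uIcc_of_le zero_le_one]

theorem intervalIntegrable_mul {y K : ℝ → ℝ} (hy : IntervalIntegrable y volume 0 1)
    (hK : ContinuousOn K (Icc 0 1)) : IntervalIntegrable (fun x => y x * K x) volume 0 1 := by
  apply hy.mul_continuousOn
  rwa [uIcc_of_le zero_le_one]

theorem integral_split {u : ℝ → ℝ} (hu : IntervalIntegrable u volume 0 1) {a b c : ℝ}
    (ha : a ∈ Icc (0 : ℝ) 1) (hb : b ∈ Icc (0 : ℝ) 1) (hc : c ∈ Icc (0 : ℝ) 1) :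
    (∫ x in a..b, u x) + ∫ x in b..c, u x = ∫ x in a..c, u x :=
  intervalIntegral.integral_add_adjacent_intervals (intervalIntegrable_sub hu ha hb)
    (intervalIntegrable_sub hu hb hc)

section Threshold

variable {h : ℝ → ℝ} {x₁ x₂ : ℝ}

/-- The mean of the outcomes in `(x₁,x₂)`. -/
noncomputable def poolMean (h : ℝ → ℝ) (x₁ x₂ : ℝ) : ℝ :=
  (∫ t in x₁..x₂, t * h t) / (∫ t in x₁..x₂, h t)

theorem thresholdQuality_of_mem {x : ℝ} (hx : x ∈ Ioo x₁ x₂) :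
    thresholdQuality h x₁ x₂ x = poolMean h x₁ x₂ := by
  simp only [thresholdQuality, if_pos hx, poolMean]

theorem thresholdQuality_of_notMem {x : ℝ} (hx : x ∉ Ioo x₁ x₂) :
    thresholdQuality h x₁ x₂ x = x := by
  simp only [thresholdQuality, if_neg hx]

theorem continuousOn_id_mul {h : ℝ → ℝ} (hc : ContinuousOn h (Icc 0 1)) :
    ContinuousOn (fun t => t * h t) (Icc 0 1) := continuousOn_id.mul hc

theorem integral_pos_of_pos (hc : ContinuousOn h (Icc 0 1)) (hp : ∀ x ∈ Ioo (0 : ℝ) 1, 0 < h x)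
    (h0 : 0 ≤ x₁) (h12 : x₁ < x₂) (h1 : x₂ ≤ 1) : 0 < ∫ t in x₁..x₂, h t :=
  intervalIntegral.intervalIntegral_pos_of_pos_on
    (intervalIntegrable_sub (intervalIntegrable_of_continuousOn hc) ⟨h0, h12.le.trans h1⟩
      ⟨h0.trans h12.le, h1⟩) (fun t ht => hp t ⟨h0.trans_lt ht.1, ht.2.trans_le h1⟩) h12

theorem poolMean_mem (hc : ContinuousOn h (Icc 0 1)) (hp : ∀ x ∈ Ioo (0 : ℝ) 1, 0 < h x)
    (h0 : 0 ≤ x₁) (h12 : x₁ < x₂) (h1 : x₂ ≤ 1) : poolMean h x₁ x₂ ∈ Ioo x₁ x₂ := by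
  have hI := integral_pos_of_pos hc hp h0 h12 h1
  have hi := intervalIntegrable_sub (intervalIntegrable_of_continuousOn hc)
    ⟨h0, h12.le.trans h1⟩ ⟨h0.trans h12.le, h1⟩
  have hi' := intervalIntegrable_sub (intervalIntegrable_of_continuousOn (continuousOn_id_mul hc))
    ⟨h0, h12.le.trans h1⟩ ⟨h0.trans h12.le, h1⟩
  have hp' : ∀ t ∈ Ioo x₁ x₂, 0 < h t := fun t ht =>
    hp t ⟨h0.trans_lt ht.1, ht.2.trans_le h1⟩
  constructor
  · rw [poolMean, lt_div_iff₀ hI]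
    have : 0 < ∫ t in x₁..x₂, (t * h t - x₁ * h t) :=
      intervalIntegral.intervalIntegral_pos_of_pos_on (hi'.sub (hi.const_mul x₁))
        (fun t ht => by nlinarith [hp' t ht, ht.1]) h12
    rw [intervalIntegral.integral_sub hi' (hi.const_mul x₁),
      intervalIntegral.integral_const_mul] at this
    linarith
  · rw [poolMean, div_lt_iff₀ hI]
    have : 0 < ∫ t in x₁..x₂, (x₂ * h t - t * h t) :=
      intervalIntegral.intervalIntegral_pos_of_pos_on ((hi.const_mul x₂).sub hi')
        (fun t ht => by nlinarith [hp' t ht, ht.2]) h12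
    rw [intervalIntegral.integral_sub (hi.const_mul x₂) hi',
      intervalIntegral.integral_const_mul] at this
    linarith

/-- The product form remains valid for `x₁ = x₂`, where the quotient defining the mean is `0 / 0`.
-/
theorem poolMean_mul (hc : ContinuousOn h (Icc 0 1)) (hp : ∀ x ∈ Ioo (0 : ℝ) 1, 0 < h x)
    (h0 : 0 ≤ x₁) (h12 : x₁ ≤ x₂) (h1 : x₂ ≤ 1) :
    poolMean h x₁ x₂ * ∫ t in x₁..x₂, h t = ∫ t in x₁..x₂, t * h t := by
  rcases h12.eq_or_lt with rfl | h12
  · simp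
  · rw [poolMean, div_mul_cancel₀ _ (integral_pos_of_pos hc hp h0 h12 h1).ne']

theorem monotone_thresholdQuality (hc : ContinuousOn h (Icc 0 1))
    (hp : ∀ x ∈ Ioo (0 : ℝ) 1, 0 < h x) (h0 : 0 ≤ x₁) (h1 : x₂ ≤ 1) :
    Monotone (thresholdQuality h x₁ x₂) := by
  intro x y hxy
  by_cases hx : x ∈ Ioo x₁ x₂
  · have hm := poolMean_mem hc hp h0 (hx.1.trans hx.2) h1
    rw [thresholdQuality_of_mem hx]
    by_cases hy : y ∈ Ioo x₁ x₂
    · rw [thresholdQuality_of_mem hy]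
    · rw [thresholdQuality_of_notMem hy]
      have : x₂ ≤ y := by
        by_contra hcon
        exact hy ⟨hx.1.trans_le hxy, not_le.1 hcon⟩
      exact hm.2.le.trans this
  · rw [thresholdQuality_of_notMem hx]
    by_cases hy : y ∈ Ioo x₁ x₂
    · have hm := poolMean_mem hc hp h0 (hy.1.trans hy.2) h1
      rw [thresholdQuality_of_mem hy]
      have : x ≤ x₁ := by
        by_contra hcon
        exact hx ⟨not_le.1 hcon, hxy.trans_lt hy.2⟩
      exact this.trans hm.1.le
    · rwa [thresholdQuality_of_notMem hy]

theorem intervalIntegrable_thresholdQuality (hc : ContinuousOn h (Icc 0 1))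
    (hp : ∀ x ∈ Ioo (0 : ℝ) 1, 0 < h x) (h0 : 0 ≤ x₁) (h1 : x₂ ≤ 1) :
    IntervalIntegrable (thresholdQuality h x₁ x₂) volume 0 1 :=
  (monotone_thresholdQuality hc hp h0 h1).intervalIntegrable

theorem integral_thresholdQuality_mul (hc : ContinuousOn h (Icc 0 1))
    (hp : ∀ x ∈ Ioo (0 : ℝ) 1, 0 < h x) (h0 : 0 ≤ x₁) (h12 : x₁ ≤ x₂) (h1 : x₂ ≤ 1)
    {K : ℝ → ℝ} (hK : ContinuousOn K (Icc 0 1)) :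
    ∫ t in (0 : ℝ)..1, thresholdQuality h x₁ x₂ t * K t =
      (∫ t in (0 : ℝ)..x₁, t * K t) + poolMean h x₁ x₂ * (∫ t in x₁..x₂, K t) +
        ∫ t in x₂..1, t * K t := by
  have hi := intervalIntegrable_mul (intervalIntegrable_thresholdQuality hc hp h0 h1) hK
  have m1 : x₁ ∈ Icc (0 : ℝ) 1 := ⟨h0, h12.trans h1⟩
  have m2 : x₂ ∈ Icc (0 : ℝ) 1 := ⟨h0.trans h12, h1⟩
  have z0 : (0 : ℝ) ∈ Icc (0 : ℝ) 1 := left_mem_Icc.2 zero_le_one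
  have z1 : (1 : ℝ) ∈ Icc (0 : ℝ) 1 := right_mem_Icc.2 zero_le_one
  rw [← integral_split hi z0 m2 z1, ← integral_split hi z0 m1 m2]
  congr 1
  · congr 1
    · exact intervalIntegral_congr_Ioo h0 fun x hx => by
        rw [thresholdQuality_of_notMem fun hx' => absurd hx'.1 hx.2.not_gt]
    · rw [← intervalIntegral.integral_const_mul]
      exact intervalIntegral_congr_Ioo h12 fun x hx => by rw [thresholdQuality_of_mem hx]
  · exact intervalIntegral_congr_Ioo h1 fun x hx => by
      rw [thresholdQuality_of_notMem fun hx' => absurd hx'.2 hx.1.not_gt]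

theorem intervalIntegrable_sub_id_mul {u : ℝ → ℝ} (hu : IntervalIntegrable u volume 0 1)
    (hc : ContinuousOn h (Icc 0 1)) : IntervalIntegrable (fun t => (u t - t) * h t) volume 0 1 :=
  intervalIntegrable_mul (hu.sub intervalIntegral.intervalIntegrable_id) hc

theorem integral_sub_id_mul {y K : ℝ → ℝ} (hy : IntervalIntegrable y volume 0 1)
    (hK : ContinuousOn K (Icc 0 1)) :
    ∫ t in (0 : ℝ)..1, (y t - t) * K t =
      (∫ t in (0 : ℝ)..1, y t * K t) - ∫ t in (0 : ℝ)..1, t * K t := by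
  rw [← intervalIntegral.integral_sub (intervalIntegrable_mul hy hK)
    (intervalIntegrable_of_continuousOn (continuousOn_id_mul hK))]
  simp only [sub_mul]

/-- Pooling preserves the total, and it moves outcomes below the pool mean up and those above it
down. The distortion therefore changes sign once, from nonnegative to nonpositive, at the pool mean.
-/
theorem isMajorized_thresholdQuality (hc : ContinuousOn h (Icc 0 1))
    (hp : ∀ x ∈ Ioo (0 : ℝ) 1, 0 < h x) (h0 : 0 ≤ x₁) (h12 : x₁ ≤ x₂) (h1 : x₂ ≤ 1) :
    IsMajorized h (thresholdQuality h x₁ x₂) := by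
  have hi := intervalIntegrable_thresholdQuality hc hp h0 h1
  have m1 : x₁ ∈ Icc (0 : ℝ) 1 := ⟨h0, h12.trans h1⟩
  have m2 : x₂ ∈ Icc (0 : ℝ) 1 := ⟨h0.trans h12, h1⟩
  have z0 : (0 : ℝ) ∈ Icc (0 : ℝ) 1 := left_mem_Icc.2 zero_le_one
  have z1 : (1 : ℝ) ∈ Icc (0 : ℝ) 1 := right_mem_Icc.2 zero_le_one
  have htot : ∫ t in (0 : ℝ)..1, (thresholdQuality h x₁ x₂ t - t) * h t = 0 := by
    rw [integral_sub_id_mul hi hc, integral_thresholdQuality_mul hc hp h0 h12 h1 hc,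
      poolMean_mul hc hp h0 h12 h1]
    have hid := intervalIntegrable_of_continuousOn (continuousOn_id_mul hc)
    rw [integral_split hid z0 m1 m2, integral_split hid z0 m2 z1, sub_self]
  refine ⟨fun x hx => ?_, htot⟩
  rcases h12.eq_or_lt with rfl | h12
  · have : ∀ t, (thresholdQuality h x₁ x₁ t - t) * h t = 0 := fun t => by
      rw [thresholdQuality_of_notMem (by simp), sub_self, zero_mul]
    simp [this]
  have hm := poolMean_mem hc hp h0 h12 h1
  refine primitive_nonneg (d := poolMean h x₁ x₂) (intervalIntegrable_sub_id_mul hi hc)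
    ⟨h0.trans hm.1.le, hm.2.le.trans h1⟩ (fun t ht => ?_) (fun t ht => ?_) htot.ge hx
  · refine mul_nonneg ?_ (hp t ⟨ht.1, ht.2.trans (hm.2.trans_le h1)⟩).le
    by_cases htm : t ∈ Ioo x₁ x₂
    · rw [thresholdQuality_of_mem htm]; linarith [ht.2]
    · rw [thresholdQuality_of_notMem htm, sub_self]
  · refine mul_nonpos_of_nonpos_of_nonneg ?_ (hp t ⟨h0.trans_lt (hm.1.trans ht.1), ht.2⟩).le
    by_cases htm : t ∈ Ioo x₁ x₂
    · rw [thresholdQuality_of_mem htm]; linarith [ht.1]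
    · rw [thresholdQuality_of_notMem htm, sub_self]

/-- Sufficient conditions for the threshold quality to maximize `y ↦ ∫ y P` among the increasing
functions that are majorized by the outcome. -/
structure Certificate (h P α : ℝ → ℝ) (x₁ x₃ x₂ : ℝ) : Prop where
  nonneg : 0 ≤ x₁
  le_left : x₁ ≤ x₃
  le_right : x₃ ≤ x₂
  le_one : x₂ ≤ 1
  cont : ContinuousOn P (Icc 0 1)
  eq : ∀ x ∈ Ioo (0 : ℝ) 1, P x = α x * h x
  mono_left : MonotoneOn α (Ioo 0 x₁)
  nonpos_left : ∀ x ∈ Ioo 0 x₁, α x ≤ 0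
  nonneg_mid : ∀ x ∈ Ioo x₁ x₃, 0 ≤ P x
  nonpos_mid : ∀ x ∈ Ioo x₃ x₂, P x ≤ 0
  integral_mid : ∫ x in x₁..x₂, P x = 0
  nonneg_right : ∀ x ∈ Ioo x₂ 1, 0 ≤ α x
  mono_right : MonotoneOn α (Ioo x₂ 1)

/-- A certificate that makes the threshold quality the unique maximizer. -/
structure StrictCertificate (h P α : ℝ → ℝ) (x₁ x₃ x₂ : ℝ) : Prop extends
    Certificate h P α x₁ x₃ x₂ where
  strictMono_left : StrictMonoOn α (Ioo 0 x₁)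
  pos_mid : ∀ x ∈ Ioo x₁ x₃, 0 < P x
  neg_mid : ∀ x ∈ Ioo x₃ x₂, P x < 0
  strictMono_right : StrictMonoOn α (Ioo x₂ 1)

open Classical in
/-- The multiplier of a certificate, ironed to `0` on the pooling interval. -/
noncomputable def ironed (α : ℝ → ℝ) (x₁ x₂ x : ℝ) : ℝ := if x ∈ Icc x₁ x₂ then 0 else α x

namespace Certificate

variable {P α y : ℝ → ℝ} {x₃ : ℝ}

theorem le (H : Certificate h P α x₁ x₃ x₂) :
    x₁ ≤ x₂ := H.le_left.trans H.le_right

theorem mem₁ (H : Certificate h P α x₁ x₃ x₂) :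
    x₁ ∈ Icc (0 : ℝ) 1 := ⟨H.nonneg, H.le.trans H.le_one⟩

theorem mem₂ (H : Certificate h P α x₁ x₃ x₂) :
    x₂ ∈ Icc (0 : ℝ) 1 := ⟨H.nonneg.trans H.le, H.le_one⟩

theorem ironed_left {x : ℝ} (hx : x < x₁) : ironed α x₁ x₂ x = α x := by
  rw [ironed, if_neg fun h => absurd h.1 hx.not_ge]

theorem ironed_right {x : ℝ} (hx : x₂ < x) : ironed α x₁ x₂ x = α x := by
  rw [ironed, if_neg fun h => absurd h.2 hx.not_ge]

theorem ironed_mid {x : ℝ} (hx : x ∈ Icc x₁ x₂) : ironed α x₁ x₂ x = 0 := by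
  rw [ironed, if_pos hx]

theorem monotoneOn_ironed (H : Certificate h P α x₁ x₃ x₂) :
    MonotoneOn (ironed α x₁ x₂) (Ioo 0 1) := by
  intro x hx z hz hxz
  rcases lt_or_ge x x₁ with h1 | h1
  · rw [ironed_left h1]
    rcases lt_or_ge z x₁ with h2 | h2
    · rw [ironed_left h2]
      exact H.mono_left ⟨hx.1, h1⟩ ⟨hz.1, h2⟩ hxz
    · refine (H.nonpos_left x ⟨hx.1, h1⟩).trans ?_
      rcases le_or_gt z x₂ with h3 | h3
      · rw [ironed_mid ⟨h2, h3⟩]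
      · rw [ironed_right h3]
        exact H.nonneg_right z ⟨h3, hz.2⟩
  · rcases le_or_gt x x₂ with h2 | h2
    · rw [ironed_mid ⟨h1, h2⟩]
      rcases le_or_gt z x₂ with h3 | h3
      · rw [ironed_mid ⟨h1.trans hxz, h3⟩]
      · rw [ironed_right h3]
        exact H.nonneg_right z ⟨h3, hz.2⟩
    · rw [ironed_right h2, ironed_right (h2.trans_le hxz)]
      exact H.mono_right ⟨h2, hx.2⟩ ⟨h2.trans_le hxz, hz.2⟩ hxz

theorem ironed_mul (H : Certificate h P α x₁ x₃ x₂) (x : ℝ) (hx : x ∈ Ioo (0 : ℝ) 1) :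
    (Icc x₁ x₂)ᶜ.indicator (fun t => (y t - t) * P t) x
      = ironed α x₁ x₂ x * ((y x - x) * h x) := by
  by_cases hm : x ∈ Icc x₁ x₂
  · rw [indicator_of_notMem (by simpa using hm), ironed_mid hm, zero_mul]
  · rw [indicator_of_mem (by simpa using hm), ironed, if_neg hm, H.eq x hx]
    ring

theorem intervalIntegrable_indicator {u : ℝ → ℝ} (hu : IntervalIntegrable u volume 0 1) {s : Set ℝ}
    (hs : MeasurableSet s) : IntervalIntegrable (s.indicator u) volume 0 1 := by
  rw [intervalIntegrable_iff] at hu ⊢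
  exact hu.indicator hs

theorem intervalIntegrable_mid (H : Certificate h P α x₁ x₃ x₂) :
    IntervalIntegrable ((Ioo x₁ x₂).indicator P) volume 0 1 :=
  intervalIntegrable_indicator (intervalIntegrable_of_continuousOn H.cont) measurableSet_Ioo

theorem intervalIntegrable_mul_mid (H : Certificate h P α x₁ x₃ x₂) (hy : MonotoneOn y (Icc 0 1)) :
    IntervalIntegrable (fun x => y x * (Ioo x₁ x₂).indicator P x) volume 0 1 := by
  have := intervalIntegrable_indicator
    (intervalIntegrable_mul (intervalIntegrable_of_monotoneOn hy) H.cont)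
    (measurableSet_Ioo (a := x₁) (b := x₂))
  refine intervalIntegrable_congr_Ioo (fun x _ => ?_) this
  by_cases hm : x ∈ Ioo x₁ x₂
  · rw [indicator_of_mem hm, indicator_of_mem hm]
  · rw [indicator_of_notMem hm, indicator_of_notMem hm, mul_zero]

theorem intervalIntegrable_ironed (H : Certificate h P α x₁ x₃ x₂) (hy : MonotoneOn y (Icc 0 1)) :
    IntervalIntegrable (fun x => ironed α x₁ x₂ x * ((y x - x) * h x)) volume 0 1 :=
  intervalIntegrable_congr_Ioo H.ironed_mul
    (intervalIntegrable_indicator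
      (intervalIntegrable_sub_id_mul (intervalIntegrable_of_monotoneOn hy) H.cont)
      measurableSet_Icc.compl)

/-- As `P` integrates to zero over the pool, the constant value of the threshold quality there does
not matter. What remains is the distortion of `y` outside the pool, weighted by the ironed
multiplier, plus the integral of `y P` over the pool; `integral_mul_le` applies to each separately.
-/
theorem integral_eq (H : Certificate h P α x₁ x₃ x₂)
    (hc : ContinuousOn h (Icc 0 1)) (hp : ∀ x ∈ Ioo (0 : ℝ) 1, 0 < h x)
    (hy : MonotoneOn y (Icc 0 1)) :
    (∫ x in (0 : ℝ)..1, y x * P x) - ∫ x in (0 : ℝ)..1, thresholdQuality h x₁ x₂ x * P x =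
      (∫ x in (0 : ℝ)..1, ironed α x₁ x₂ x * ((y x - x) * h x)) +
        ∫ x in (0 : ℝ)..1, y x * (Ioo x₁ x₂).indicator P x := by
  have i1 := intervalIntegrable_mul (intervalIntegrable_of_monotoneOn hy) H.cont
  have i3 := H.intervalIntegrable_ironed hy
  have i4 := H.intervalIntegrable_mul_mid hy
  have z0 : (0 : ℝ) ∈ Icc (0 : ℝ) 1 := left_mem_Icc.2 zero_le_one
  have z1 : (1 : ℝ) ∈ Icc (0 : ℝ) 1 := right_mem_Icc.2 zero_le_one
  have iid := intervalIntegrable_of_continuousOn (continuousOn_id_mul H.cont)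
  rw [integral_thresholdQuality_mul hc hp H.nonneg H.le H.le_one H.cont, H.integral_mid, mul_zero,
    add_zero, ← intervalIntegral.integral_add i3 i4,
    ← integral_split i1 z0 H.mem₂ z1, ← integral_split i1 z0 H.mem₁ H.mem₂,
    ← integral_split (i3.add i4) z0 H.mem₂ z1, ← integral_split (i3.add i4) z0 H.mem₁ H.mem₂]
  have e1 : ∫ x in (0 : ℝ)..x₁, (ironed α x₁ x₂ x * ((y x - x) * h x)
      + y x * (Ioo x₁ x₂).indicator P x) =
      (∫ x in (0 : ℝ)..x₁, y x * P x) - ∫ x in (0 : ℝ)..x₁, x * P x := by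
    rw [← intervalIntegral.integral_sub (intervalIntegrable_sub i1 z0 H.mem₁)
      (intervalIntegrable_sub iid z0 H.mem₁)]
    refine intervalIntegral_congr_Ioo H.nonneg fun x hx => ?_
    have hx' : x ∈ Ioo (0 : ℝ) 1 := ⟨hx.1, hx.2.trans_le H.mem₁.2⟩
    rw [indicator_of_notMem (fun h => absurd h.1 hx.2.not_gt), ironed_left hx.2, H.eq x hx']
    ring
  have e2 : ∫ x in x₁..x₂, (ironed α x₁ x₂ x * ((y x - x) * h x)
      + y x * (Ioo x₁ x₂).indicator P x) = ∫ x in x₁..x₂, y x * P x := by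
    refine intervalIntegral_congr_Ioo H.le fun x hx => ?_
    rw [indicator_of_mem hx, ironed_mid ⟨hx.1.le, hx.2.le⟩]
    ring
  have e3 : ∫ x in x₂..1, (ironed α x₁ x₂ x * ((y x - x) * h x)
      + y x * (Ioo x₁ x₂).indicator P x) =
      (∫ x in x₂..1, y x * P x) - ∫ x in x₂..1, x * P x := by
    rw [← intervalIntegral.integral_sub (intervalIntegrable_sub i1 H.mem₂ z1)
      (intervalIntegrable_sub iid H.mem₂ z1)]
    refine intervalIntegral_congr_Ioo H.le_one fun x hx => ?_
    have hx' : x ∈ Ioo (0 : ℝ) 1 := ⟨H.mem₂.1.trans_lt hx.1, hx.2⟩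
    rw [indicator_of_notMem (fun h => absurd h.2 hx.1.not_gt), ironed_right hx.1, H.eq x hx']
    ring
  rw [e1, e2, e3]
  ring

theorem primitive_mid (H : Certificate h P α x₁ x₃ x₂) {x : ℝ} (hx : x ∈ Icc (0 : ℝ) 1) :
    (∫ t in (0 : ℝ)..x, (Ioo x₁ x₂).indicator P t) =
      if x ∈ Icc x₁ x₂ then ∫ t in x₁..x, P t else 0 := by
  have i := H.intervalIntegrable_mid
  have z0 : (0 : ℝ) ∈ Icc (0 : ℝ) 1 := left_mem_Icc.2 zero_le_one
  have hz1 : ∀ b, 0 ≤ b → b ≤ x₁ → ∫ t in (0 : ℝ)..b, (Ioo x₁ x₂).indicator P t = 0 := by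
    intro b hb hb1
    rw [intervalIntegral_congr_Ioo (v := fun _ => 0) hb fun t ht =>
      indicator_of_notMem (fun h => absurd h.1 (ht.2.trans_le hb1).not_gt) _]
    simp
  have hz2 : ∀ b, x₁ ≤ b → b ≤ x₂ →
      ∫ t in x₁..b, (Ioo x₁ x₂).indicator P t = ∫ t in x₁..b, P t := by
    intro b hb hb1
    exact intervalIntegral_congr_Ioo hb fun t ht =>
      indicator_of_mem (s := Ioo x₁ x₂) ⟨ht.1, ht.2.trans_le hb1⟩ _
  split_ifs with hm
  · rw [← integral_split i z0 H.mem₁ hx, hz1 x₁ H.nonneg le_rfl, zero_add, hz2 x hm.1 hm.2]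
  · rcases le_or_gt x x₁ with h1 | h1
    · exact hz1 x hx.1 h1
    · have h2 : x₂ < x := by
        by_contra hcon
        exact hm ⟨h1.le, not_lt.1 hcon⟩
      rw [← integral_split i z0 H.mem₂ hx, ← integral_split i z0 H.mem₁ H.mem₂,
        hz1 x₁ H.nonneg le_rfl, hz2 x₂ H.le le_rfl, H.integral_mid,
        intervalIntegral_congr_Ioo (v := fun _ => 0) h2.le fun t ht =>
          indicator_of_notMem (fun h : t ∈ Ioo x₁ x₂ => absurd h.2 ht.1.not_gt) _]
      simp

theorem primitive_mid_nonneg (H : Certificate h P α x₁ x₃ x₂) (x : ℝ) (hx : x ∈ Icc (0 : ℝ) 1) :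
    0 ≤ ∫ t in (0 : ℝ)..x, (Ioo x₁ x₂).indicator P t := by
  rw [H.primitive_mid hx]
  split_ifs with hm
  · exact primitive_nonneg (d := x₃)
      (intervalIntegrable_sub (intervalIntegrable_of_continuousOn H.cont) H.mem₁ H.mem₂)
      ⟨H.le_left, H.le_right⟩ H.nonneg_mid H.nonpos_mid H.integral_mid.ge hm
  · exact le_rfl

theorem primitive_mid_one (H : Certificate h P α x₁ x₃ x₂) :
    ∫ t in (0 : ℝ)..1, (Ioo x₁ x₂).indicator P t = 0 := by
  rw [H.primitive_mid (right_mem_Icc.2 zero_le_one)]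
  split_ifs with hm
  · rw [← le_antisymm H.le_one hm.2]; exact H.integral_mid
  · rfl

theorem integral_ironed_le (H : Certificate h P α x₁ x₃ x₂) (hc : ContinuousOn h (Icc 0 1))
    (hy : MonotoneOn y (Icc 0 1)) (hmaj : IsMajorized h y) {a b c : ℝ}
    (ha : a ∈ Ioo (0 : ℝ) 1) (hb : b ∈ Ioo (0 : ℝ) 1) (hab : a ≤ b)
    (hcU : ∀ x ∈ Icc a b, c ≤ ∫ t in (0 : ℝ)..x, (y t - t) * h t) :
    (∫ x in (0 : ℝ)..1, ironed α x₁ x₂ x * ((y x - x) * h x)) ≤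
      -(c * (ironed α x₁ x₂ b - ironed α x₁ x₂ a)) :=
  integral_mul_le (intervalIntegrable_sub_id_mul (intervalIntegrable_of_monotoneOn hy) hc) hmaj.1 hmaj.2
    H.monotoneOn_ironed (H.intervalIntegrable_ironed hy) ha hb hab hcU

theorem integral_mid_le (H : Certificate h P α x₁ x₃ x₂) (hy : MonotoneOn y (Icc 0 1)) {a b c : ℝ}
    (ha : a ∈ Ioo (0 : ℝ) 1) (hb : b ∈ Ioo (0 : ℝ) 1) (hab : a ≤ b)
    (hcU : ∀ x ∈ Icc a b, c ≤ ∫ t in (0 : ℝ)..x, (Ioo x₁ x₂).indicator P t) :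
    (∫ x in (0 : ℝ)..1, y x * (Ioo x₁ x₂).indicator P x) ≤ -(c * (y b - y a)) :=
  integral_mul_le H.intervalIntegrable_mid H.primitive_mid_nonneg H.primitive_mid_one
    (hy.mono Ioo_subset_Icc_self) (H.intervalIntegrable_mul_mid hy) ha hb hab hcU

theorem integral_ironed_nonpos (H : Certificate h P α x₁ x₃ x₂) (hc : ContinuousOn h (Icc 0 1))
    (hy : MonotoneOn y (Icc 0 1)) (hmaj : IsMajorized h y) :
    (∫ x in (0 : ℝ)..1, ironed α x₁ x₂ x * ((y x - x) * h x)) ≤ 0 := by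
  -- Only the sign is wanted: with `a = b` and `c = 0` the gap term vanishes, and any interior point
  -- would do.
  have m : (1 / 2 : ℝ) ∈ Ioo (0 : ℝ) 1 := by norm_num
  have := H.integral_ironed_le (c := 0) hc hy hmaj m m le_rfl
    fun x hx => hmaj.1 x ⟨m.1.le.trans hx.1, hx.2.trans m.2.le⟩
  simpa using this

theorem integral_mid_nonpos (H : Certificate h P α x₁ x₃ x₂) (hy : MonotoneOn y (Icc 0 1)) :
    (∫ x in (0 : ℝ)..1, y x * (Ioo x₁ x₂).indicator P x) ≤ 0 := by
  have m : (1 / 2 : ℝ) ∈ Ioo (0 : ℝ) 1 := by norm_num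
  have := H.integral_mid_le (c := 0) hy m m le_rfl
    fun x hx => H.primitive_mid_nonneg x ⟨m.1.le.trans hx.1, hx.2.trans m.2.le⟩
  simpa using this

/-- Weak duality: both terms of `integral_eq` are nonpositive. -/
theorem integral_le (H : Certificate h P α x₁ x₃ x₂)
    (hc : ContinuousOn h (Icc 0 1)) (hp : ∀ x ∈ Ioo (0 : ℝ) 1, 0 < h x)
    (hy : MonotoneOn y (Icc 0 1)) (hmaj : IsMajorized h y) :
    ∫ x in (0 : ℝ)..1, y x * P x ≤ ∫ x in (0 : ℝ)..1, thresholdQuality h x₁ x₂ x * P x := by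
  have h1 := H.integral_eq hc hp hy
  have h2 := H.integral_ironed_nonpos hc hy hmaj
  have h3 := H.integral_mid_nonpos hy
  linarith

end Certificate

/-- Continuity of the primitive spreads positivity at a point to a uniform bound on an interval, the
form in which the gap of `integral_mul_le` is used. -/
theorem exists_nhd_lower_bound {u : ℝ → ℝ} (hu : IntervalIntegrable u volume 0 1) {a b s : ℝ}
    (ha : 0 ≤ a) (hb : b ≤ 1) (hs : s ∈ Ioo a b) (hpos : 0 < ∫ t in (0 : ℝ)..s, u t) :
    ∃ c > 0, ∃ a' ∈ Ioo a s, ∃ b' ∈ Ioo s b, ∀ x ∈ Icc a' b', c ≤ ∫ t in (0 : ℝ)..x, u t := by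
  have hcont : ContinuousOn (fun x => ∫ t in (0 : ℝ)..x, u t) (uIcc 0 1) :=
    intervalIntegral.continuousOn_primitive_interval
      ((intervalIntegrable_iff_integrableOn_Icc_of_le zero_le_one).1 hu |>.mono_set
        (by rw [uIcc_of_le zero_le_one]))
  rw [uIcc_of_le zero_le_one] at hcont
  have hat : ContinuousAt (fun x => ∫ t in (0 : ℝ)..x, u t) s :=
    hcont.continuousAt (Icc_mem_nhds (ha.trans_lt hs.1) (hs.2.trans_le hb))
  have hev : ∀ᶠ x in nhds s, (∫ t in (0 : ℝ)..s, u t) / 2 < ∫ t in (0 : ℝ)..x, u t :=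
    hat.eventually_const_lt (half_lt_self hpos)
  obtain ⟨ε, hε, hball⟩ := Metric.eventually_nhds_iff.1 hev
  refine ⟨_, half_pos hpos, max (s - ε / 2) ((a + s) / 2), ⟨?_, ?_⟩,
    min (s + ε / 2) ((s + b) / 2), ⟨?_, ?_⟩, fun x hx => (hball ?_).le⟩
  · exact lt_max_of_lt_right (by linarith [hs.1])
  · exact max_lt (by linarith) (by linarith [hs.1])
  · exact lt_min (by linarith) (by linarith [hs.2])
  · exact min_lt_of_right_lt (by linarith [hs.2])
  · rw [Real.dist_eq, abs_lt]
    constructor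
    · linarith [(le_max_left (s - ε / 2) ((a + s) / 2)).trans hx.1]
    · linarith [hx.2.trans (min_le_left (s + ε / 2) ((s + b) / 2))]

/-- If the signaled quality `y` is not distorted on average on any initial part of `(a,b)`, it
reveals all the outcomes there. -/
theorem eq_id_of_primitive_eq_zero (hc : ContinuousOn h (Icc 0 1))
    (hp : ∀ x ∈ Ioo (0 : ℝ) 1, 0 < h x) {y : ℝ → ℝ} (hy : MonotoneOn y (Icc 0 1)) {a b : ℝ}
    (ha : 0 ≤ a) (hb : b ≤ 1) (hD : ∀ x ∈ Ioo a b, ∫ t in (0 : ℝ)..x, (y t - t) * h t = 0) :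
    ∀ x ∈ Ioo a b, y x = x := by
  have hi := intervalIntegrable_sub_id_mul (intervalIntegrable_of_monotoneOn hy) hc
  have hsub : ∀ c ∈ Ioo a b, ∀ d ∈ Ioo a b, ∫ t in c..d, (y t - t) * h t = 0 := by
    intro c hc' d hd
    have := integral_split hi (left_mem_Icc.2 zero_le_one)
      ⟨ha.trans hc'.1.le, hc'.2.le.trans hb⟩ ⟨ha.trans hd.1.le, hd.2.le.trans hb⟩
    rw [hD c hc', hD d hd] at this
    linarith
  intro x hx
  have hx01 : x ∈ Icc (0 : ℝ) 1 := ⟨ha.trans hx.1.le, hx.2.le.trans hb⟩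
  -- If `y x < x`, monotonicity gives `y t ≤ y x < t` for `t` just left of `x`, so the primitive
  -- strictly decreases there. If `y x > x`, it strictly increases just right of `x`.
  rcases lt_trichotomy (y x) x with hlt | heq | hgt
  · exfalso
    set c := max (y x) ((a + x) / 2)
    have hcx : c < x := max_lt hlt (by linarith [hx.1])
    have hca : a < c := lt_max_of_lt_right (by linarith [hx.1])
    have : 0 < ∫ t in c..x, -((y t - t) * h t) := by
      refine intervalIntegral.intervalIntegral_pos_of_pos_on
        (intervalIntegrable_sub hi ⟨(ha.trans hca.le), hcx.le.trans hx01.2⟩ hx01).neg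
        (fun t ht => ?_) hcx
      have ht01 : t ∈ Ioo (0 : ℝ) 1 := ⟨(ha.trans_lt hca).trans ht.1, ht.2.trans_le hx01.2⟩
      have h1 : y t ≤ y x := hy (Ioo_subset_Icc_self ht01) hx01 ht.2.le
      have h2 : y x < t := (le_max_left _ _).trans_lt ht.1
      nlinarith [hp t ht01]
    rw [intervalIntegral.integral_neg, hsub c ⟨hca, hcx.trans hx.2⟩ x hx] at this
    simp at this
  · exact heq
  · exfalso
    set c := min (y x) ((x + b) / 2)
    have hcx : x < c := lt_min hgt (by linarith [hx.2])
    have hca : c < b := min_lt_of_right_lt (by linarith [hx.2])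
    have : 0 < ∫ t in x..c, (y t - t) * h t := by
      refine intervalIntegral.intervalIntegral_pos_of_pos_on
        (intervalIntegrable_sub hi hx01 ⟨hx01.1.trans hcx.le, (hca.le.trans hb)⟩)
        (fun t ht => ?_) hcx
      have ht01 : t ∈ Ioo (0 : ℝ) 1 := ⟨hx01.1.trans_lt ht.1, ht.2.trans (hca.trans_le hb)⟩
      have h1 : y x ≤ y t := hy hx01 (Ioo_subset_Icc_self ht01) ht.1.le
      have h2 : t < y x := ht.2.trans_le (min_le_left _ _)
      nlinarith [hp t ht01]
    rw [hsub x hx c ⟨hx.1.trans hcx, hca⟩] at this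
    simp at this

/-- Equality in the duality forces both nonpositive terms of `integral_eq` to vanish. The first then
excludes distortion outside the pool, the second makes `y` constant on it. The points `x₁`, `x₂` are
excepted, since the integrals do not see them. -/
theorem StrictCertificate.eq_thresholdQuality {P α y : ℝ → ℝ} {x₃ : ℝ}
    (H : StrictCertificate h P α x₁ x₃ x₂)
    (hc : ContinuousOn h (Icc 0 1)) (hp : ∀ x ∈ Ioo (0 : ℝ) 1, 0 < h x)
    (hy : MonotoneOn y (Icc 0 1)) (hmaj : IsMajorized h y)
    (heq : ∫ x in (0 : ℝ)..1, thresholdQuality h x₁ x₂ x * P x ≤ ∫ x in (0 : ℝ)..1, y x * P x) :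
    ∀ x ∈ Ioo (0 : ℝ) 1, x ≠ x₁ → x ≠ x₂ → y x = thresholdQuality h x₁ x₂ x := by
  have H' := H.toCertificate
  have h1 := H'.integral_eq hc hp hy
  have h2 := H'.integral_ironed_nonpos hc hy hmaj
  have h3 := H'.integral_mid_nonpos hy
  have i0 := intervalIntegrable_sub_id_mul (intervalIntegrable_of_monotoneOn hy) hc
  -- A positive primitive at a point where the multiplier strictly increases would make the first
  -- term strictly negative.
  have hzero : ∀ a b : ℝ, 0 ≤ a → b ≤ 1 → StrictMonoOn (ironed α x₁ x₂) (Ioo a b) →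
      ∀ x ∈ Ioo a b, ∫ t in (0 : ℝ)..x, (y t - t) * h t = 0 := by
    intro a b ha hb hmono x hx
    by_contra hne
    have hpos := (hmaj.1 x ⟨ha.trans hx.1.le, hx.2.le.trans hb⟩).lt_of_ne (Ne.symm hne)
    obtain ⟨c, hc0, a', ha', b', hb', hbd⟩ := exists_nhd_lower_bound i0 ha hb hx hpos
    have hab' : a' < b' := ha'.2.trans hb'.1
    have := H'.integral_ironed_le hc hy hmaj (a := a') (b := b')
      ⟨ha.trans_lt ha'.1, hab'.trans (hb'.2.trans_le hb)⟩
      ⟨(ha.trans_lt ha'.1).trans hab', hb'.2.trans_le hb⟩ hab'.le hbd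
    have hlt := hmono ⟨ha'.1, hab'.trans hb'.2⟩ ⟨ha'.1.trans hab', hb'.2⟩ hab'
    nlinarith
  have hL := hzero 0 x₁ le_rfl H'.mem₁.2 fun x hx z hz hxz => by
    rw [Certificate.ironed_left hx.2, Certificate.ironed_left hz.2]
    exact H.strictMono_left hx hz hxz
  have hR := hzero x₂ 1 H'.mem₂.1 le_rfl fun x hx z hz hxz => by
    rw [Certificate.ironed_right hx.1, Certificate.ironed_right hz.1]
    exact H.strictMono_right hx hz hxz
  have hcontD : ContinuousOn (fun x => ∫ t in (0 : ℝ)..x, (y t - t) * h t) (Icc 0 1) := by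
    have := intervalIntegral.continuousOn_primitive_interval (a := (0 : ℝ)) (b := 1)
      (f := fun t => (y t - t) * h t) (μ := volume)
      (by rw [uIcc_of_le zero_le_one]
          exact (intervalIntegrable_iff_integrableOn_Icc_of_le zero_le_one).1 i0)
    rwa [uIcc_of_le zero_le_one] at this
  -- The primitive vanishes at the ends of the pool by continuity from outside, or by majorization
  -- at 0 and 1. This later identifies the constant value of `y` on the pool with the pool mean.
  have hD1 : ∫ t in (0 : ℝ)..x₁, (y t - t) * h t = 0 := by
    rcases H.nonneg.eq_or_lt with h0 | h0
    · rw [← h0]; simp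
    · have hcw := (hcontD x₁ H'.mem₁).mono (s := Ioo 0 x₁) fun t ht =>
        ⟨ht.1.le, ht.2.le.trans H'.mem₁.2⟩
      have hne : (nhdsWithin x₁ (Ioo 0 x₁)).NeBot := right_nhdsWithin_Ioo_neBot h0
      exact tendsto_nhds_unique hcw.tendsto (tendsto_const_nhds.congr'
        (by filter_upwards [self_mem_nhdsWithin] with t ht using (hL t ht).symm))
  have hD2 : ∫ t in (0 : ℝ)..x₂, (y t - t) * h t = 0 := by
    rcases H.le_one.eq_or_lt with h0 | h0
    · rw [h0]; exact hmaj.2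
    · have hcw := (hcontD x₂ H'.mem₂).mono (s := Ioo x₂ 1) fun t ht =>
        ⟨H'.mem₂.1.trans ht.1.le, ht.2.le⟩
      have hne : (nhdsWithin x₂ (Ioo x₂ 1)).NeBot := left_nhdsWithin_Ioo_neBot h0
      exact tendsto_nhds_unique hcw.tendsto (tendsto_const_nhds.congr'
        (by filter_upwards [self_mem_nhdsWithin] with t ht using (hR t ht).symm))
  intro x hx hx1 hx2
  rcases lt_or_gt_of_ne hx1 with h4 | h4
  · rw [thresholdQuality_of_notMem fun h => absurd h.1 h4.not_gt]
    exact eq_id_of_primitive_eq_zero hc hp hy le_rfl H'.mem₁.2 hL x ⟨hx.1, h4⟩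
  rcases lt_or_gt_of_ne hx2 with h5 | h5
  swap
  · rw [thresholdQuality_of_notMem fun h => absurd h.2 h5.not_gt]
    exact eq_id_of_primitive_eq_zero hc hp hy H'.mem₂.1 le_rfl hR x ⟨h5, hx.2⟩
  have h12 : x₁ < x₂ := h4.trans h5
  have hconst : ∀ s ∈ Ioo x₁ x₂, y s = y x := by
    have key : ∀ s ∈ Ioo x₁ x₂, ∀ t ∈ Ioo x₁ x₂, s < t → y t ≤ y s := by
      intro s hs t ht hst
      have hs01 : s ∈ Ioo (0 : ℝ) 1 := ⟨H.nonneg.trans_lt hs.1, hs.2.trans_le H.le_one⟩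
      have ht01 : t ∈ Ioo (0 : ℝ) 1 := ⟨H.nonneg.trans_lt ht.1, ht.2.trans_le H.le_one⟩
      have hVc : ContinuousOn (fun x => ∫ t in (0 : ℝ)..x, (Ioo x₁ x₂).indicator P t)
          (Icc s t) := by
        have := intervalIntegral.continuousOn_primitive_interval (a := (0 : ℝ)) (b := 1)
          (f := (Ioo x₁ x₂).indicator P) (μ := volume)
          (by rw [uIcc_of_le zero_le_one]
              exact (intervalIntegrable_iff_integrableOn_Icc_of_le zero_le_one).1
                H'.intervalIntegrable_mid)
        rw [uIcc_of_le zero_le_one] at this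
        exact this.mono (Icc_subset_Icc hs01.1.le ht01.2.le)
      -- The minimum over `[s,t]` of the primitive of `P` is positive and serves as the constant `c`
      -- of the gap; an increase of `y` from `s` to `t` would make the second term negative.
      obtain ⟨r, hr, hmin⟩ := isCompact_Icc.exists_isMinOn (nonempty_Icc.2 hst.le) hVc
      have hr12 : r ∈ Ioo x₁ x₂ := ⟨hs.1.trans_le hr.1, hr.2.trans_lt ht.2⟩
      have hpos : 0 < ∫ t in (0 : ℝ)..r, (Ioo x₁ x₂).indicator P t := by
        rw [H'.primitive_mid ⟨H.nonneg.trans hr12.1.le, hr12.2.le.trans H.le_one⟩,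
          if_pos ⟨hr12.1.le, hr12.2.le⟩]
        exact primitive_pos (d := x₃)
          (intervalIntegrable_sub (intervalIntegrable_of_continuousOn H.cont) H'.mem₁ H'.mem₂)
          ⟨H.le_left, H.le_right⟩ H.pos_mid H.neg_mid H.integral_mid.ge hr12
      have := H'.integral_mid_le hy hs01 ht01 hst.le fun x hx => hmin hx
      nlinarith
    intro s hs
    have hmem : ∀ t ∈ Ioo x₁ x₂, t ∈ Icc (0 : ℝ) 1 := fun t ht =>
      ⟨H.nonneg.trans ht.1.le, ht.2.le.trans H.le_one⟩
    rcases lt_trichotomy s x with h6 | h6 | h6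
    · exact le_antisymm (hy (hmem s hs) (hmem x ⟨h4, h5⟩) h6.le) (key s hs x ⟨h4, h5⟩ h6)
    · rw [h6]
    · exact le_antisymm (key x ⟨h4, h5⟩ s hs h6) (hy (hmem x ⟨h4, h5⟩) (hmem s hs) h6.le)
  have hmid : ∫ t in x₁..x₂, (y t - t) * h t = 0 := by
    have := integral_split i0 (left_mem_Icc.2 zero_le_one) H'.mem₁ H'.mem₂
    linarith
  have hI := integral_pos_of_pos hc hp H.nonneg h12 H.le_one
  have hi := intervalIntegrable_sub (intervalIntegrable_of_continuousOn hc) H'.mem₁ H'.mem₂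
  have hi' := intervalIntegrable_sub (intervalIntegrable_of_continuousOn (continuousOn_id_mul hc))
    H'.mem₁ H'.mem₂
  rw [intervalIntegral_congr_Ioo (v := fun t => y x * h t - t * h t) h12.le
    (fun t ht => by rw [hconst t ht, sub_mul]),
    intervalIntegral.integral_sub (hi.const_mul _) hi', intervalIntegral.integral_const_mul] at hmid
  rw [thresholdQuality_of_mem ⟨h4, h5⟩, poolMean, eq_div_iff hI.ne']
  linarith

end Threshold

end RatingDesign

/-! ### Concavity in the likelihood ratio and monotone multipliers -/

namespace RatingDesign

/-- The chord inequality with denominators cleared, so that sign arguments become polynomial. -/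
theorem concaveOn_three {S : Set ℝ} {N : ℝ → ℝ} (hN : ConcaveOn ℝ S N) {u v w : ℝ} (hu : u ∈ S)
    (hw : w ∈ S) (huv : u < v) (hvw : v < w) :
    (w - v) * N u + (v - u) * N w ≤ (w - u) * N v := by
  have hp : 0 < w - u := by linarith
  have := hN.2 hu hw 
    (show 0 ≤ (w - v) / (w - u) from div_nonneg (by linarith) hp.le)
    (show 0 ≤ (v - u) / (w - u) from div_nonneg (by linarith) hp.le) (by field_simp; ring)
  have he : ((w - v) / (w - u)) • u + ((v - u) / (w - u)) • w = v := by
    simp only [smul_eq_mul]; field_simp; ring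
  rw [he] at this
  simp only [smul_eq_mul] at this
  calc _ = (w - u) * ((w - v) / (w - u) * N u + (v - u) / (w - u) * N w) := by field_simp
    _ ≤ _ := mul_le_mul_of_nonneg_left this hp.le

theorem strictConcaveOn_three {S : Set ℝ} {N : ℝ → ℝ} (hN : StrictConcaveOn ℝ S N) {u v w : ℝ}
    (hu : u ∈ S) (hw : w ∈ S) (huv : u < v) (hvw : v < w) :
    (w - v) * N u + (v - u) * N w < (w - u) * N v := by
  have hp : 0 < w - u := by linarith
  have := hN.2 hu hw (huv.trans hvw).ne 
    (show 0 < (w - v) / (w - u) from div_pos (by linarith) hp)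
    (show 0 < (v - u) / (w - u) from div_pos (by linarith) hp) (by field_simp; ring)
  have he : ((w - v) / (w - u)) • u + ((v - u) / (w - u)) • w = v := by
    simp only [smul_eq_mul]; field_simp; ring
  rw [he] at this
  simp only [smul_eq_mul] at this
  calc _ = (w - u) * ((w - v) / (w - u) * N u + (v - u) / (w - u) * N w) := by field_simp
    _ < _ := mul_lt_mul_of_pos_left this hp

theorem convexOn_three {S : Set ℝ} {N : ℝ → ℝ} (hN : ConvexOn ℝ S N) {u v w : ℝ} (hu : u ∈ S)
    (hw : w ∈ S) (huv : u < v) (hvw : v < w) :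
    (w - u) * N v ≤ (w - v) * N u + (v - u) * N w := by
  have := concaveOn_three hN.neg hu hw huv hvw
  simp only [Pi.neg_apply] at this
  linarith

theorem strictConvexOn_three {S : Set ℝ} {N : ℝ → ℝ} (hN : StrictConvexOn ℝ S N) {u v w : ℝ}
    (hu : u ∈ S) (hw : w ∈ S) (huv : u < v) (hvw : v < w) :
    (w - u) * N v < (w - v) * N u + (v - u) * N w := by
  have := strictConcaveOn_three hN.neg hu hw huv hvw
  simp only [Pi.neg_apply] at this
  linarith

/-- The density of the outcomes for a mixture. -/
def mix (f₁ f₂ : ℝ) (g₁ g₂ : ℝ → ℝ) (x : ℝ) : ℝ := f₁ * g₁ x + f₂ * g₂ x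

/-- Two positive continuous functions with a strictly increasing ratio `g₂/g₁`. -/
structure IsRatioPair (f₁ f₂ : ℝ) (g₁ g₂ : ℝ → ℝ) : Prop where
  f₁_pos : 0 < f₁
  f₂_pos : 0 < f₂
  cont₁ : ContinuousOn g₁ (Icc 0 1)
  cont₂ : ContinuousOn g₂ (Icc 0 1)
  pos₁ : ∀ x ∈ Ioo (0 : ℝ) 1, 0 < g₁ x
  pos₂ : ∀ x ∈ Ioo (0 : ℝ) 1, 0 < g₂ x
  strictMono : StrictMonoOn (fun x => g₂ x / g₁ x) (Ioo 0 1)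

namespace IsRatioPair

variable {f₁ f₂ : ℝ} {g₁ g₂ : ℝ → ℝ}

theorem cont (H : IsRatioPair f₁ f₂ g₁ g₂) : ContinuousOn (mix f₁ f₂ g₁ g₂) (Icc 0 1) :=
  (H.cont₁.const_mul f₁).add (H.cont₂.const_mul f₂)

theorem pos (H : IsRatioPair f₁ f₂ g₁ g₂) : ∀ x ∈ Ioo (0 : ℝ) 1, 0 < mix f₁ f₂ g₁ g₂ x :=
  fun x hx => add_pos (mul_pos H.f₁_pos (H.pos₁ x hx)) (mul_pos H.f₂_pos (H.pos₂ x hx))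

theorem ratio_pos (H : IsRatioPair f₁ f₂ g₁ g₂) {x : ℝ} (hx : x ∈ Ioo (0 : ℝ) 1) :
    0 < g₂ x / g₁ x := div_pos (H.pos₂ x hx) (H.pos₁ x hx)

theorem continuousOn_ratio (H : IsRatioPair f₁ f₂ g₁ g₂) :
    ContinuousOn (fun x => g₂ x / g₁ x) (Ioo 0 1) :=
  (H.cont₂.mono Ioo_subset_Icc_self).div (H.cont₁.mono Ioo_subset_Icc_self)
    fun x hx => (H.pos₁ x hx).ne'

theorem mix_eq (H : IsRatioPair f₁ f₂ g₁ g₂) {x : ℝ} (hx : x ∈ Ioo (0 : ℝ) 1) :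
    mix f₁ f₂ g₁ g₂ x = (f₁ + f₂ * (g₂ x / g₁ x)) * g₁ x := by
  have := (H.pos₁ x hx).ne'
  rw [mix]; field_simp

theorem convex_range (H : IsRatioPair f₁ f₂ g₁ g₂) :
    Convex ℝ ((fun x => g₂ x / g₁ x) '' Ioo 0 1) :=
  (isPreconnected_Ioo.image _ H.continuousOn_ratio).convex

/-- The range is order connected and each of its values lies strictly between two others. Openness
makes derivatives on the range meaningful. -/
theorem isOpen_range (H : IsRatioPair f₁ f₂ g₁ g₂) :
    IsOpen ((fun x => g₂ x / g₁ x) '' Ioo 0 1) := by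
  rw [isOpen_iff_mem_nhds]
  rintro _ ⟨x, hx, rfl⟩
  have ha : x / 2 ∈ Ioo (0 : ℝ) 1 := ⟨by linarith [hx.1], by linarith [hx.1, hx.2]⟩
  have hb : (x + 1) / 2 ∈ Ioo (0 : ℝ) 1 := ⟨by linarith [hx.1], by linarith [hx.2]⟩
  refine Filter.mem_of_superset (Icc_mem_nhds (H.strictMono ha hx (by linarith [hx.1]))
    (H.strictMono hx hb (by linarith [hx.2]))) ?_
  have hoc := H.convex_range.ordConnected
  exact hoc.out (mem_image_of_mem _ ha) (mem_image_of_mem _ hb)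

theorem ratio_lt_iff (H : IsRatioPair f₁ f₂ g₁ g₂) {x y : ℝ} (hx : x ∈ Ioo (0 : ℝ) 1)
    (hy : y ∈ Ioo (0 : ℝ) 1) : g₂ x / g₁ x < g₂ y / g₁ y ↔ x < y :=
  H.strictMono.lt_iff_lt hx hy

section Sides

variable {P N : ℝ → ℝ} {S : Set ℝ}

theorem quotient_eq (H : IsRatioPair f₁ f₂ g₁ g₂)
    (hP : ∀ x ∈ Ioo (0 : ℝ) 1, P x = N (g₂ x / g₁ x) * g₁ x) {x : ℝ} (hx : x ∈ Ioo (0 : ℝ) 1) :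
    P x / mix f₁ f₂ g₁ g₂ x = N (g₂ x / g₁ x) / (f₁ + f₂ * (g₂ x / g₁ x)) := by
  rw [H.mix_eq hx, hP x hx, mul_div_mul_right _ _ (H.pos₁ x hx).ne']

theorem ell_pos (H : IsRatioPair f₁ f₂ g₁ g₂) {x : ℝ} (hx : x ∈ Ioo (0 : ℝ) 1) :
    0 < f₁ + f₂ * (g₂ x / g₁ x) :=
  add_pos H.f₁_pos (mul_pos H.f₂_pos (H.ratio_pos hx))

theorem quotient_sign (H : IsRatioPair f₁ f₂ g₁ g₂)
    (hP : ∀ x ∈ Ioo (0 : ℝ) 1, P x = N (g₂ x / g₁ x) * g₁ x) {x : ℝ} (hx : x ∈ Ioo (0 : ℝ) 1) :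
    (P x ≤ 0 ↔ N (g₂ x / g₁ x) ≤ 0) ∧ (0 ≤ P x ↔ 0 ≤ N (g₂ x / g₁ x)) ∧
      (P x < 0 ↔ N (g₂ x / g₁ x) < 0) ∧ (0 < P x ↔ 0 < N (g₂ x / g₁ x)) := by
  have := H.pos₁ x hx
  rw [hP x hx]
  refine ⟨⟨fun h => ?_, fun h => mul_nonpos_of_nonpos_of_nonneg h this.le⟩,
    mul_nonneg_iff_of_pos_right this, ⟨fun h => ?_, fun h => mul_neg_of_neg_of_pos h this⟩,
    mul_pos_iff_of_pos_right this⟩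
  · by_contra hcon
    exact absurd (mul_pos (not_le.1 hcon) this) (not_lt.2 h)
  · by_contra hcon
    exact absurd (mul_nonneg (not_lt.1 hcon) this.le) (not_le.2 h)

/-- A concave `N` that vanishes at `z₁ = z(x₁)` and is nonnegative at some later point is
nonpositive before `z₁`. The multiplier is `N(z) / (f₁ + f₂ z)`, and the chord from a point to the
zero `z₁` shows that it increases there. -/
theorem left_side (H : IsRatioPair f₁ f₂ g₁ g₂)
    (hP : ∀ x ∈ Ioo (0 : ℝ) 1, P x = N (g₂ x / g₁ x) * g₁ x) (hN : ConcaveOn ℝ S N) {x₁ y : ℝ}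
    (hx₁ : x₁ ∈ Ioo (0 : ℝ) 1) (hS : ∀ x ∈ Ioc 0 x₁, g₂ x / g₁ x ∈ S)
    (hzero : N (g₂ x₁ / g₁ x₁) = 0) (hy : y ∈ S) (hy1 : g₂ x₁ / g₁ x₁ < y) (hNy : 0 ≤ N y) :
    (∀ x ∈ Ioo 0 x₁, P x / mix f₁ f₂ g₁ g₂ x ≤ 0) ∧
      MonotoneOn (fun x => P x / mix f₁ f₂ g₁ g₂ x) (Ioo 0 x₁) ∧
      (StrictConcaveOn ℝ S N → StrictMonoOn (fun x => P x / mix f₁ f₂ g₁ g₂ x) (Ioo 0 x₁)) := by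
  have mem : ∀ x ∈ Ioo 0 x₁, x ∈ Ioo (0 : ℝ) 1 := fun x hx => ⟨hx.1, hx.2.trans hx₁.2⟩
  have hS1 := hS x₁ ⟨hx₁.1, le_rfl⟩
  have hneg : ∀ x ∈ Ioo 0 x₁, N (g₂ x / g₁ x) ≤ 0 := by
    intro x hx
    have hlt := H.strictMono (mem x hx) hx₁ hx.2
    have := concaveOn_three hN (hS x ⟨hx.1, hx.2.le⟩) hy hlt hy1
    simp only at hlt
    rw [hzero] at this
    nlinarith
  refine ⟨fun x hx => ?_, ?_, fun hs => ?_⟩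
  · rw [H.quotient_eq hP (mem x hx)]
    exact div_nonpos_of_nonpos_of_nonneg (hneg x hx) (H.ell_pos (mem x hx)).le
  · intro x hx x' hx' hxx
    rcases hxx.eq_or_lt with rfl | hxx
    · exact le_rfl
    simp only
    rw [H.quotient_eq hP (mem x hx), H.quotient_eq hP (mem x' hx'),
      div_le_div_iff₀ (H.ell_pos (mem x hx)) (H.ell_pos (mem x' hx'))]
    have h1 := H.strictMono (mem x hx) (mem x' hx') hxx
    have h2 := H.strictMono (mem x' hx') hx₁ hx'.2
    have h3 := concaveOn_three hN (hS x ⟨hx.1, hx.2.le⟩) hS1 h1 h2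
    have h4 := hneg x hx
    have h5 := H.ell_pos (mem x hx)
    have h6 := H.ell_pos hx₁
    have h7 := H.f₂_pos
    simp only at h1 h2
    rw [hzero] at h3
    set a := g₂ x / g₁ x
    set b := g₂ x' / g₁ x'
    set d := g₂ x₁ / g₁ x₁
    have h8 : 0 < d - a := by linarith
    -- This is the chord inequality `(d - b) N(a) ≤ (d - a) N(b)` multiplied by `f₁ + f₂ a`,
    -- together with the identity `(d - b)(f₁ + f₂ a) - (d - a)(f₁ + f₂ b) = -(b - a)(f₁ + f₂ d)`.
    have key : (d - a) * (N b * (f₁ + f₂ * a) - N a * (f₁ + f₂ * b)) ≥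
        - N a * ((b - a) * (f₁ + f₂ * d)) := by nlinarith
    have h9 : 0 ≤ - N a * ((b - a) * (f₁ + f₂ * d)) :=
      mul_nonneg (by linarith) (mul_nonneg (by linarith) h6.le)
    have := nonneg_of_mul_nonneg_right (h9.trans key) h8
    linarith
  · intro x hx x' hx' hxx
    simp only
    rw [H.quotient_eq hP (mem x hx), H.quotient_eq hP (mem x' hx'),
      div_lt_div_iff₀ (H.ell_pos (mem x hx)) (H.ell_pos (mem x' hx'))]
    have h1 := H.strictMono (mem x hx) (mem x' hx') hxx
    have h2 := H.strictMono (mem x' hx') hx₁ hx'.2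
    have h3 := strictConcaveOn_three hs (hS x ⟨hx.1, hx.2.le⟩) hS1 h1 h2
    have h4 := hneg x hx
    have h5 := H.ell_pos (mem x hx)
    have h6 := H.ell_pos hx₁
    have h7 := H.f₂_pos
    simp only at h1 h2
    rw [hzero] at h3
    set a := g₂ x / g₁ x
    set b := g₂ x' / g₁ x'
    set d := g₂ x₁ / g₁ x₁
    have h8 : 0 < d - a := by linarith
    have key : (d - a) * (N b * (f₁ + f₂ * a) - N a * (f₁ + f₂ * b)) >
        - N a * ((b - a) * (f₁ + f₂ * d)) := by nlinarith
    have h9 : 0 ≤ - N a * ((b - a) * (f₁ + f₂ * d)) :=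
      mul_nonneg (by linarith) (mul_nonneg (by linarith) h6.le)
    have := (mul_pos_iff_of_pos_left h8).1 (h9.trans_lt key)
    linarith

/-- Mirror image of `left_side`: convexity replaces concavity and the auxiliary point lies before
the zero. -/
theorem right_side (H : IsRatioPair f₁ f₂ g₁ g₂)
    (hP : ∀ x ∈ Ioo (0 : ℝ) 1, P x = N (g₂ x / g₁ x) * g₁ x) (hN : ConvexOn ℝ S N) {x₂ y : ℝ}
    (hx₂ : x₂ ∈ Ioo (0 : ℝ) 1) (hS : ∀ x ∈ Ico x₂ 1, g₂ x / g₁ x ∈ S)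
    (hzero : N (g₂ x₂ / g₁ x₂) = 0) (hy : y ∈ S) (hy1 : y < g₂ x₂ / g₁ x₂) (hNy : N y ≤ 0) :
    (∀ x ∈ Ioo x₂ 1, 0 ≤ P x / mix f₁ f₂ g₁ g₂ x) ∧
      MonotoneOn (fun x => P x / mix f₁ f₂ g₁ g₂ x) (Ioo x₂ 1) ∧
      (StrictConvexOn ℝ S N → StrictMonoOn (fun x => P x / mix f₁ f₂ g₁ g₂ x) (Ioo x₂ 1)) := by
  have mem : ∀ x ∈ Ioo x₂ 1, x ∈ Ioo (0 : ℝ) 1 := fun x hx => ⟨hx₂.1.trans hx.1, hx.2⟩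
  have hS1 := hS x₂ ⟨le_rfl, hx₂.2⟩
  have hneg : ∀ x ∈ Ioo x₂ 1, 0 ≤ N (g₂ x / g₁ x) := by
    intro x hx
    have hlt := H.strictMono hx₂ (mem x hx) hx.1
    have := convexOn_three hN hy (hS x ⟨hx.1.le, hx.2⟩) hy1 hlt
    simp only at hlt
    rw [hzero] at this
    nlinarith
  refine ⟨fun x hx => ?_, ?_, fun hs => ?_⟩
  · rw [H.quotient_eq hP (mem x hx)]
    exact div_nonneg (hneg x hx) (H.ell_pos (mem x hx)).le
  · intro x hx x' hx' hxx
    rcases hxx.eq_or_lt with rfl | hxx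
    · exact le_rfl
    simp only
    rw [H.quotient_eq hP (mem x hx), H.quotient_eq hP (mem x' hx'),
      div_le_div_iff₀ (H.ell_pos (mem x hx)) (H.ell_pos (mem x' hx'))]
    have h1 := H.strictMono (mem x hx) (mem x' hx') hxx
    have h2 := H.strictMono hx₂ (mem x hx) hx.1
    have h3 := convexOn_three hN hS1 (hS x' ⟨hx'.1.le, hx'.2⟩) h2 h1
    have h4 := hneg x' hx'
    have h5 := H.ell_pos (mem x' hx')
    have h6 := H.ell_pos hx₂
    have h7 := H.f₂_pos
    simp only at h1 h2
    rw [hzero] at h3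
    set a := g₂ x / g₁ x
    set b := g₂ x' / g₁ x'
    set d := g₂ x₂ / g₁ x₂
    have h8 : 0 < b - d := by linarith
    have key : (b - d) * (N b * (f₁ + f₂ * a) - N a * (f₁ + f₂ * b)) ≥
        N b * ((b - a) * (f₁ + f₂ * d)) := by nlinarith
    have h9 : 0 ≤ N b * ((b - a) * (f₁ + f₂ * d)) :=
      mul_nonneg h4 (mul_nonneg (by linarith) h6.le)
    have := nonneg_of_mul_nonneg_right (h9.trans key) h8
    linarith
  · intro x hx x' hx' hxx
    simp only
    rw [H.quotient_eq hP (mem x hx), H.quotient_eq hP (mem x' hx'),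
      div_lt_div_iff₀ (H.ell_pos (mem x hx)) (H.ell_pos (mem x' hx'))]
    have h1 := H.strictMono (mem x hx) (mem x' hx') hxx
    have h2 := H.strictMono hx₂ (mem x hx) hx.1
    have h3 := strictConvexOn_three hs hS1 (hS x' ⟨hx'.1.le, hx'.2⟩) h2 h1
    have h4 := hneg x' hx'
    have h5 := H.ell_pos (mem x' hx')
    have h6 := H.ell_pos hx₂
    have h7 := H.f₂_pos
    simp only at h1 h2
    rw [hzero] at h3
    set a := g₂ x / g₁ x
    set b := g₂ x' / g₁ x'
    set d := g₂ x₂ / g₁ x₂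
    have h8 : 0 < b - d := by linarith
    have key : (b - d) * (N b * (f₁ + f₂ * a) - N a * (f₁ + f₂ * b)) >
        N b * ((b - a) * (f₁ + f₂ * d)) := by nlinarith
    have h9 : 0 ≤ N b * ((b - a) * (f₁ + f₂ * d)) :=
      mul_nonneg h4 (mul_nonneg (by linarith) h6.le)
    have := (mul_pos_iff_of_pos_left h8).1 (h9.trans_lt key)
    linarith

end Sides

end IsRatioPair

/-- Rolle's theorem for the primitive of `P`. It provides the sign change `x₃` inside a pool. -/
theorem exists_zero_of_integral_eq_zero {P : ℝ → ℝ} (hP : ContinuousOn P (Icc 0 1)) {a b : ℝ}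
    (ha : 0 ≤ a) (hab : a < b) (hb : b ≤ 1) (h0 : ∫ t in a..b, P t = 0) :
    ∃ x ∈ Ioo a b, P x = 0 := by
  have hi : IntervalIntegrable P volume a b :=
    intervalIntegrable_sub (intervalIntegrable_of_continuousOn hP) ⟨ha, hab.le.trans hb⟩
      ⟨ha.trans hab.le, hb⟩
  have hc : ContinuousOn (fun x => ∫ t in a..x, P t) (Icc a b) := by
    have := intervalIntegral.continuousOn_primitive_interval (a := a) (b := b)
      (f := P) (μ := volume)
      (by rw [uIcc_of_le hab.le]
          exact (intervalIntegrable_iff_integrableOn_Icc_of_le hab.le).1 hi)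
    rwa [uIcc_of_le hab.le] at this
  obtain ⟨x, hx, hd⟩ := exists_deriv_eq_zero (f := fun x => ∫ t in a..x, P t) hab hc
    (by simp [h0])
  refine ⟨x, hx, ?_⟩
  have hx01 : x ∈ Ioo (0 : ℝ) 1 := ⟨ha.trans_lt hx.1, hx.2.trans_le hb⟩
  have hnh : Ioo (0 : ℝ) 1 ∈ nhds x := isOpen_Ioo.mem_nhds hx01
  have hd' := intervalIntegral.integral_hasDerivAt_right
    (intervalIntegrable_sub (intervalIntegrable_of_continuousOn hP) ⟨ha, hab.le.trans hb⟩
      (Ioo_subset_Icc_self hx01))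
    ((hP.mono Ioo_subset_Icc_self).stronglyMeasurableAtFilter isOpen_Ioo x hx01)
    (hP.continuousAt (Filter.mem_of_superset hnh Ioo_subset_Icc_self))
  rw [← hd, hd'.deriv]

end RatingDesign

/-! ### Certificates for pools at an end, full pooling and full revelation -/

namespace RatingDesign

namespace IsRatioPair

variable {f₁ f₂ : ℝ} {g₁ g₂ K : ℝ → ℝ} {χ : ℝ → ℝ}

/-- The combination of `K` with the two densities that serves as objective of a certificate. -/
def tilt (K g₁ g₂ : ℝ → ℝ) (A B x : ℝ) : ℝ := K x + A * g₁ x + B * g₂ x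

theorem continuousOn_tilt (H : IsRatioPair f₁ f₂ g₁ g₂) (hK : ContinuousOn K (Icc 0 1)) (A B : ℝ) :
    ContinuousOn (tilt K g₁ g₂ A B) (Icc 0 1) :=
  (hK.add (H.cont₁.const_mul A)).add (H.cont₂.const_mul B)

theorem tilt_eq (H : IsRatioPair f₁ f₂ g₁ g₂)
    (hχ : ∀ x ∈ Ioo (0 : ℝ) 1, K x = χ (g₂ x / g₁ x) * g₁ x) (A B : ℝ) :
    ∀ x ∈ Ioo (0 : ℝ) 1, tilt K g₁ g₂ A B x
      = (fun z => χ z + (A + B * z)) (g₂ x / g₁ x) * g₁ x := by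
  intro x hx
  have := (H.pos₁ x hx).ne'
  simp only [tilt, hχ x hx]
  field_simp
  ring

theorem integral_tilt (H : IsRatioPair f₁ f₂ g₁ g₂) (hK : ContinuousOn K (Icc 0 1)) (A B : ℝ)
    {a b : ℝ} (ha : a ∈ Icc (0 : ℝ) 1) (hb : b ∈ Icc (0 : ℝ) 1) :
    ∫ x in a..b, tilt K g₁ g₂ A B x =
      (∫ x in a..b, K x) + A * (∫ x in a..b, g₁ x) + B * ∫ x in a..b, g₂ x := by
  have i0 := intervalIntegrable_sub (intervalIntegrable_of_continuousOn hK) ha hb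
  have i1 := intervalIntegrable_sub (intervalIntegrable_of_continuousOn H.cont₁) ha hb
  have i2 := intervalIntegrable_sub (intervalIntegrable_of_continuousOn H.cont₂) ha hb
  simp only [tilt]
  rw [intervalIntegral.integral_add (i0.add (i1.const_mul A)) (i2.const_mul B),
    intervalIntegral.integral_add i0 (i1.const_mul A), intervalIntegral.integral_const_mul,
    intervalIntegral.integral_const_mul]

theorem integral_mul_tilt (H : IsRatioPair f₁ f₂ g₁ g₂) (hK : ContinuousOn K (Icc 0 1)) (A B : ℝ)
    {y : ℝ → ℝ} (hy : IntervalIntegrable y volume 0 1) :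
    ∫ x in (0 : ℝ)..1, y x * tilt K g₁ g₂ A B x =
      (∫ x in (0 : ℝ)..1, y x * K x) + A * (∫ x in (0 : ℝ)..1, y x * g₁ x) +
        B * ∫ x in (0 : ℝ)..1, y x * g₂ x := by
  have i0 := intervalIntegrable_mul hy hK
  have i1 := intervalIntegrable_mul hy H.cont₁
  have i2 := intervalIntegrable_mul hy H.cont₂
  rw [← intervalIntegral.integral_const_mul, ← intervalIntegral.integral_const_mul,
    ← intervalIntegral.integral_add i0 (i1.const_mul A),
    ← intervalIntegral.integral_add (i0.add (i1.const_mul A)) (i2.const_mul B)]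
  refine intervalIntegral.integral_congr fun x _ => ?_
  simp only [tilt]
  ring

theorem integral_mul_mix (H : IsRatioPair f₁ f₂ g₁ g₂)
    {y : ℝ → ℝ} (hy : IntervalIntegrable y volume 0 1) :
    ∫ x in (0 : ℝ)..1, y x * mix f₁ f₂ g₁ g₂ x =
      f₁ * (∫ x in (0 : ℝ)..1, y x * g₁ x) + f₂ * ∫ x in (0 : ℝ)..1, y x * g₂ x := by
  have i1 := intervalIntegrable_mul hy H.cont₁
  have i2 := intervalIntegrable_mul hy H.cont₂
  rw [← intervalIntegral.integral_const_mul, ← intervalIntegral.integral_const_mul,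
    ← intervalIntegral.integral_add (i1.const_mul f₁) (i2.const_mul f₂)]
  refine intervalIntegral.integral_congr fun x _ => ?_
  simp only [mix]
  ring

/-- Signaled qualities that are majorized by the outcome and have the same mean under `g₁` have the
same mean under `g₂`. -/
theorem integral_mul_right_eq (H : IsRatioPair f₁ f₂ g₁ g₂) {y y' : ℝ → ℝ}
    (hy : IntervalIntegrable y volume 0 1) (hm : IsMajorized (mix f₁ f₂ g₁ g₂) y)
    (hy' : IntervalIntegrable y' volume 0 1) (hm' : IsMajorized (mix f₁ f₂ g₁ g₂) y')
    (h1 : ∫ x in (0 : ℝ)..1, y x * g₁ x = ∫ x in (0 : ℝ)..1, y' x * g₁ x) :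
    ∫ x in (0 : ℝ)..1, y x * g₂ x = ∫ x in (0 : ℝ)..1, y' x * g₂ x := by
  have e := hm.2
  have e' := hm'.2
  rw [integral_sub_id_mul hy H.cont, H.integral_mul_mix hy] at e
  rw [integral_sub_id_mul hy' H.cont, H.integral_mul_mix hy'] at e'
  have : f₂ * (∫ x in (0 : ℝ)..1, y x * g₂ x) = f₂ * ∫ x in (0 : ℝ)..1, y' x * g₂ x := by
    rw [h1] at e
    linarith
  exact mul_left_cancel₀ H.f₂_pos.ne' this

/-- `A` and `B` act as multipliers: both functions have equal integrals against `g₁`, hence against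
`g₂`, so the added terms cancel and the comparison concerns `K` alone. -/
theorem le_of_certificate (H : IsRatioPair f₁ f₂ g₁ g₂) (hK : ContinuousOn K (Icc 0 1)) {A B : ℝ}
    {α : ℝ → ℝ} {x₁ x₃ x₂ : ℝ}
    (hcert : Certificate (mix f₁ f₂ g₁ g₂) (tilt K g₁ g₂ A B) α x₁ x₃ x₂) {y : ℝ → ℝ}
    (hy : MonotoneOn y (Icc 0 1)) (hm : IsMajorized (mix f₁ f₂ g₁ g₂) y)
    (h1 : ∫ x in (0 : ℝ)..1, y x * g₁ x =
      ∫ x in (0 : ℝ)..1, thresholdQuality (mix f₁ f₂ g₁ g₂) x₁ x₂ x * g₁ x) :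
    ∫ x in (0 : ℝ)..1, y x * K x ≤
      ∫ x in (0 : ℝ)..1, thresholdQuality (mix f₁ f₂ g₁ g₂) x₁ x₂ x * K x := by
  have hyi := intervalIntegrable_of_monotoneOn hy
  have hTi := intervalIntegrable_thresholdQuality H.cont H.pos hcert.nonneg hcert.le_one
  have h2 := H.integral_mul_right_eq hyi hm hTi
    (isMajorized_thresholdQuality H.cont H.pos hcert.nonneg hcert.le hcert.le_one) h1
  have := hcert.integral_le H.cont H.pos hy hm
  rw [H.integral_mul_tilt hK A B hyi, H.integral_mul_tilt hK A B hTi, h1, h2] at this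
  linarith

theorem eq_of_strictCertificate (H : IsRatioPair f₁ f₂ g₁ g₂) (hK : ContinuousOn K (Icc 0 1))
    {A B : ℝ} {α : ℝ → ℝ} {x₁ x₃ x₂ : ℝ}
    (hcert : StrictCertificate (mix f₁ f₂ g₁ g₂) (tilt K g₁ g₂ A B) α x₁ x₃ x₂) {y : ℝ → ℝ}
    (hy : MonotoneOn y (Icc 0 1)) (hm : IsMajorized (mix f₁ f₂ g₁ g₂) y)
    (h1 : ∫ x in (0 : ℝ)..1, y x * g₁ x =
      ∫ x in (0 : ℝ)..1, thresholdQuality (mix f₁ f₂ g₁ g₂) x₁ x₂ x * g₁ x)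
    (hKy : ∫ x in (0 : ℝ)..1, thresholdQuality (mix f₁ f₂ g₁ g₂) x₁ x₂ x * K x ≤
      ∫ x in (0 : ℝ)..1, y x * K x) :
    ∀ x ∈ Ioo (0 : ℝ) 1, x ≠ x₁ → x ≠ x₂ →
      y x = thresholdQuality (mix f₁ f₂ g₁ g₂) x₁ x₂ x := by
  have hc := hcert.toCertificate
  have hyi := intervalIntegrable_of_monotoneOn hy
  have hTi := intervalIntegrable_thresholdQuality H.cont H.pos hc.nonneg hc.le_one
  have h2 := H.integral_mul_right_eq hyi hm hTi
    (isMajorized_thresholdQuality H.cont H.pos hc.nonneg hc.le hc.le_one) h1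
  refine hcert.eq_thresholdQuality H.cont H.pos hy hm ?_
  rw [H.integral_mul_tilt hK A B hyi, H.integral_mul_tilt hK A B hTi, h1, h2]
  linarith

theorem eq_div_mul_mix (H : IsRatioPair f₁ f₂ g₁ g₂) (P : ℝ → ℝ) :
    ∀ x ∈ Ioo (0 : ℝ) 1, P x = P x / mix f₁ f₂ g₁ g₂ x * mix f₁ f₂ g₁ g₂ x :=
  fun x hx => (div_mul_cancel₀ _ (H.pos x hx).ne').symm

theorem sub_ratio_mul_pos (H : IsRatioPair f₁ f₂ g₁ g₂) {x y : ℝ} (hx : x ∈ Ioo (0 : ℝ) 1)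
    (hy : y ∈ Ioo (0 : ℝ) 1) (hxy : x < y) : 0 < g₂ y - g₂ x / g₁ x * g₁ y := by
  have := (H.ratio_lt_iff hx hy).2 hxy
  rw [lt_div_iff₀ (H.pos₁ y hy)] at this
  linarith

theorem sub_ratio_mul_neg (H : IsRatioPair f₁ f₂ g₁ g₂) {x y : ℝ} (hx : x ∈ Ioo (0 : ℝ) 1)
    (hy : y ∈ Ioo (0 : ℝ) 1) (hxy : y < x) : g₂ y - g₂ x / g₁ x * g₁ y < 0 := by
  have := (H.ratio_lt_iff hy hx).2 hxy
  rw [div_lt_iff₀ (H.pos₁ y hy)] at this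
  linarith

theorem convexOn_add_affine {S : Set ℝ} {χ : ℝ → ℝ} (hS : Convex ℝ S) (hχ : ConvexOn ℝ S χ)
    (A B : ℝ) : ConvexOn ℝ S (fun z => χ z + (A + B * z)) := by
  refine hχ.add ⟨hS, fun x _ y _ a b _ _ hab => le_of_eq ?_⟩
  simp only [smul_eq_mul]
  linear_combination (-A) * hab

theorem strictConvexOn_add_affine {S : Set ℝ} {χ : ℝ → ℝ} (hS : Convex ℝ S)
    (hχ : StrictConvexOn ℝ S χ) (A B : ℝ) :
    StrictConvexOn ℝ S (fun z => χ z + (A + B * z)) := by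
  refine hχ.add_convexOn ⟨hS, fun x _ y _ a b _ _ hab => le_of_eq ?_⟩
  simp only [smul_eq_mul]
  linear_combination (-A) * hab

/-- Adding an affine function to the convex `χ` gives a convex `N` with zeros at `z(x₃) < z(x₂)`:
nonnegative, nonpositive, nonnegative in turn. With the pool `(0,x₂)` there is nothing to check on
the left. -/
theorem exists_certificate_lower (H : IsRatioPair f₁ f₂ g₁ g₂) (hK : ContinuousOn K (Icc 0 1))
    (hχ : ∀ x ∈ Ioo (0 : ℝ) 1, K x = χ (g₂ x / g₁ x) * g₁ x)
    (hconv : ConvexOn ℝ ((fun x => g₂ x / g₁ x) '' Ioo 0 1) χ) {x₂ : ℝ}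
    (hx₂ : x₂ ∈ Ioo (0 : ℝ) 1) :
    ∃ A B x₃ : ℝ, ∃ α : ℝ → ℝ,
      Certificate (mix f₁ f₂ g₁ g₂) (tilt K g₁ g₂ A B) α 0 x₃ x₂ ∧
      (StrictConvexOn ℝ ((fun x => g₂ x / g₁ x) '' Ioo 0 1) χ →
        StrictCertificate (mix f₁ f₂ g₁ g₂) (tilt K g₁ g₂ A B) α 0 x₃ x₂) := by
  set Z := (fun x => g₂ x / g₁ x) '' Ioo 0 1 with hZ
  set z₂ := g₂ x₂ / g₁ x₂ with hz₂
  have z0 : (0 : ℝ) ∈ Icc (0 : ℝ) 1 := left_mem_Icc.2 zero_le_one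
  have m2 : x₂ ∈ Icc (0 : ℝ) 1 := Ioo_subset_Icc_self hx₂
  have hneg : (∫ x in (0 : ℝ)..x₂, g₂ x) - z₂ * ∫ x in (0 : ℝ)..x₂, g₁ x ≠ 0 := by
    have i1 := intervalIntegrable_sub (intervalIntegrable_of_continuousOn H.cont₁) z0 m2
    have i2 := intervalIntegrable_sub (intervalIntegrable_of_continuousOn H.cont₂) z0 m2
    have : 0 < ∫ x in (0 : ℝ)..x₂, -(g₂ x - z₂ * g₁ x) :=
      intervalIntegral.intervalIntegral_pos_of_pos_on (i2.sub (i1.const_mul z₂)).neg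
        (fun x hx => neg_pos.2 (H.sub_ratio_mul_neg hx₂ ⟨hx.1, hx.2.trans hx₂.2⟩ hx.2)) hx₂.1
    rw [intervalIntegral.integral_neg, intervalIntegral.integral_sub i2 (i1.const_mul z₂),
      intervalIntegral.integral_const_mul] at this
    intro h0
    rw [h0] at this
    simp at this
  -- `A` and `B` solve two linear equations: `N` vanishes at `z₂`, and the tilted objective
  -- integrates to zero on the pool. The denominator is nonzero because `g₂ < z₂ g₁` on the pool.
  set B : ℝ := -((∫ x in (0 : ℝ)..x₂, K x) - χ z₂ * ∫ x in (0 : ℝ)..x₂, g₁ x) /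
    ((∫ x in (0 : ℝ)..x₂, g₂ x) - z₂ * ∫ x in (0 : ℝ)..x₂, g₁ x) with hB
  set A : ℝ := -χ z₂ - B * z₂ with hA
  set N : ℝ → ℝ := fun z => χ z + (A + B * z) with hN
  have hP : ∀ x ∈ Ioo (0 : ℝ) 1, tilt K g₁ g₂ A B x = N (g₂ x / g₁ x) * g₁ x :=
    H.tilt_eq hχ A B
  have hPc := H.continuousOn_tilt hK A B
  have hint : ∫ x in (0 : ℝ)..x₂, tilt K g₁ g₂ A B x = 0 := by
    rw [H.integral_tilt hK A B z0 m2]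
    have : B * ((∫ x in (0 : ℝ)..x₂, g₂ x) - z₂ * ∫ x in (0 : ℝ)..x₂, g₁ x) =
        -((∫ x in (0 : ℝ)..x₂, K x) - χ z₂ * ∫ x in (0 : ℝ)..x₂, g₁ x) :=
      div_mul_cancel₀ _ hneg
    rw [hA]
    linarith
  obtain ⟨x₃, hx₃, hx₃0⟩ := exists_zero_of_integral_eq_zero hPc le_rfl hx₂.1 m2.2 hint
  have hx₃' : x₃ ∈ Ioo (0 : ℝ) 1 := ⟨hx₃.1, hx₃.2.trans hx₂.2⟩
  have hN2 : N (g₂ x₂ / g₁ x₂) = 0 := by simp only [hN, hA]; ring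
  have hN3 : N (g₂ x₃ / g₁ x₃) = 0 := by
    have := hP x₃ hx₃'
    rw [hx₃0] at this
    exact (mul_eq_zero.1 this.symm).resolve_right (H.pos₁ x₃ hx₃').ne'
  have hNc := convexOn_add_affine H.convex_range hconv A B
  have h32 : g₂ x₃ / g₁ x₃ < g₂ x₂ / g₁ x₂ := (H.ratio_lt_iff hx₃' hx₂).2 hx₃.2
  have memZ : ∀ x ∈ Ioo (0 : ℝ) 1, g₂ x / g₁ x ∈ Z := fun x hx => mem_image_of_mem _ hx
  obtain ⟨hr1, hr2, hr3⟩ := H.right_side hP hNc hx₂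
    (fun x hx => memZ x ⟨hx₂.1.trans_le hx.1, hx.2⟩) hN2 (memZ x₃ hx₃') h32 hN3.le
  have hcert : Certificate (mix f₁ f₂ g₁ g₂) (tilt K g₁ g₂ A B)
      (fun x => tilt K g₁ g₂ A B x / mix f₁ f₂ g₁ g₂ x) 0 x₃ x₂ :=
    { nonneg := le_rfl
      le_left := hx₃.1.le
      le_right := hx₃.2.le
      le_one := m2.2
      cont := hPc
      eq := H.eq_div_mul_mix _
      mono_left := fun x hx => absurd (hx.1.trans hx.2) (lt_irrefl _)
      nonpos_left := fun x hx => absurd (hx.1.trans hx.2) (lt_irrefl _)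
      nonneg_mid := by
        intro x hx
        have hx' : x ∈ Ioo (0 : ℝ) 1 := ⟨hx.1, hx.2.trans hx₃'.2⟩
        rw [(H.quotient_sign hP hx').2.1]
        have h1 := (H.ratio_lt_iff hx' hx₃').2 hx.2
        have := convexOn_three hNc (memZ x hx') (memZ x₂ hx₂) h1 h32
        change (_ : ℝ) * N _ ≤ _ * N _ + _ * N _ at this
        rw [hN2, hN3, mul_zero, mul_zero, add_zero] at this
        exact nonneg_of_mul_nonneg_right this (sub_pos.2 h32)
      nonpos_mid := by
        intro x hx
        have hx' : x ∈ Ioo (0 : ℝ) 1 := ⟨hx₃'.1.trans hx.1, hx.2.trans hx₂.2⟩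
        rw [(H.quotient_sign hP hx').1]
        have h1 := (H.ratio_lt_iff hx₃' hx').2 hx.1
        have h2 := (H.ratio_lt_iff hx' hx₂).2 hx.2
        have := convexOn_three hNc (memZ x₃ hx₃') (memZ x₂ hx₂) h1 h2
        change (_ : ℝ) * N _ ≤ _ * N _ + _ * N _ at this
        rw [hN2, hN3, mul_zero, mul_zero, add_zero] at this
        exact nonpos_of_mul_nonpos_right this (sub_pos.2 h32)
      integral_mid := hint
      nonneg_right := hr1
      mono_right := hr2 }
  refine ⟨A, B, x₃, _, hcert, fun hs => ?_⟩
  have hNs := strictConvexOn_add_affine H.convex_range hs A B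
  exact
    { hcert with
      strictMono_left := fun x hx => absurd (hx.1.trans hx.2) (lt_irrefl _)
      pos_mid := by
        intro x hx
        have hx' : x ∈ Ioo (0 : ℝ) 1 := ⟨hx.1, hx.2.trans hx₃'.2⟩
        rw [(H.quotient_sign hP hx').2.2.2]
        have h1 := (H.ratio_lt_iff hx' hx₃').2 hx.2
        have := strictConvexOn_three hNs (memZ x hx') (memZ x₂ hx₂) h1 h32
        change (_ : ℝ) * N _ < _ * N _ + _ * N _ at this
        rw [hN2, hN3, mul_zero, mul_zero, add_zero] at this
        exact (mul_pos_iff_of_pos_left (sub_pos.2 h32)).1 this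
      neg_mid := by
        intro x hx
        have hx' : x ∈ Ioo (0 : ℝ) 1 := ⟨hx₃'.1.trans hx.1, hx.2.trans hx₂.2⟩
        rw [(H.quotient_sign hP hx').2.2.1]
        have h1 := (H.ratio_lt_iff hx₃' hx').2 hx.1
        have h2 := (H.ratio_lt_iff hx' hx₂).2 hx.2
        have := strictConvexOn_three hNs (memZ x₃ hx₃') (memZ x₂ hx₂) h1 h2
        change (_ : ℝ) * N _ < _ * N _ + _ * N _ at this
        rw [hN2, hN3, mul_zero, mul_zero, add_zero] at this
        exact neg_of_mul_neg_right this (sub_pos.2 h32).le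
      strictMono_right := hr3 hNs }

/-- Counterpart of the lower certificate for pools `(x₁,1)`: a strictly concave `N` with zeros at
`z(x₁) < z(x₃)` is negative, positive, negative in turn. -/
theorem exists_strictCertificate_upper (H : IsRatioPair f₁ f₂ g₁ g₂)
    (hK : ContinuousOn K (Icc 0 1))
    (hχ : ∀ x ∈ Ioo (0 : ℝ) 1, K x = χ (g₂ x / g₁ x) * g₁ x)
    (hconc : StrictConcaveOn ℝ ((fun x => g₂ x / g₁ x) '' Ioo 0 1) χ) {x₁ : ℝ}
    (hx₁ : x₁ ∈ Ioo (0 : ℝ) 1) :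
    ∃ A B x₃ : ℝ, ∃ α : ℝ → ℝ,
      StrictCertificate (mix f₁ f₂ g₁ g₂) (tilt K g₁ g₂ A B) α x₁ x₃ 1 := by
  set Z := (fun x => g₂ x / g₁ x) '' Ioo 0 1 with hZ
  set z₁ := g₂ x₁ / g₁ x₁ with hz₁
  have z1 : (1 : ℝ) ∈ Icc (0 : ℝ) 1 := right_mem_Icc.2 zero_le_one
  have m1 : x₁ ∈ Icc (0 : ℝ) 1 := Ioo_subset_Icc_self hx₁
  have hne : (∫ x in x₁..1, g₂ x) - z₁ * ∫ x in x₁..1, g₁ x ≠ 0 := by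
    have i1 := intervalIntegrable_sub (intervalIntegrable_of_continuousOn H.cont₁) m1 z1
    have i2 := intervalIntegrable_sub (intervalIntegrable_of_continuousOn H.cont₂) m1 z1
    have : 0 < ∫ x in x₁..1, (g₂ x - z₁ * g₁ x) :=
      intervalIntegral.intervalIntegral_pos_of_pos_on (i2.sub (i1.const_mul z₁))
        (fun x hx => H.sub_ratio_mul_pos hx₁ ⟨hx₁.1.trans hx.1, hx.2⟩ hx.1) hx₁.2
    rw [intervalIntegral.integral_sub i2 (i1.const_mul z₁),
      intervalIntegral.integral_const_mul] at this
    exact this.ne'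
  set B : ℝ := -((∫ x in x₁..1, K x) - χ z₁ * ∫ x in x₁..1, g₁ x) /
    ((∫ x in x₁..1, g₂ x) - z₁ * ∫ x in x₁..1, g₁ x) with hB
  set A : ℝ := -χ z₁ - B * z₁ with hA
  set N : ℝ → ℝ := fun z => χ z + (A + B * z) with hN
  have hP : ∀ x ∈ Ioo (0 : ℝ) 1, tilt K g₁ g₂ A B x = N (g₂ x / g₁ x) * g₁ x :=
    H.tilt_eq hχ A B
  have hPc := H.continuousOn_tilt hK A B
  have hint : ∫ x in x₁..1, tilt K g₁ g₂ A B x = 0 := by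
    rw [H.integral_tilt hK A B m1 z1]
    have : B * ((∫ x in x₁..1, g₂ x) - z₁ * ∫ x in x₁..1, g₁ x) =
        -((∫ x in x₁..1, K x) - χ z₁ * ∫ x in x₁..1, g₁ x) :=
      div_mul_cancel₀ _ hne
    rw [hA]
    linarith
  obtain ⟨x₃, hx₃, hx₃0⟩ := exists_zero_of_integral_eq_zero hPc m1.1 hx₁.2 le_rfl hint
  have hx₃' : x₃ ∈ Ioo (0 : ℝ) 1 := ⟨hx₁.1.trans hx₃.1, hx₃.2⟩
  have hN1 : N (g₂ x₁ / g₁ x₁) = 0 := by simp only [hN, hA]; ring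
  have hN3 : N (g₂ x₃ / g₁ x₃) = 0 := by
    have := hP x₃ hx₃'
    rw [hx₃0] at this
    exact (mul_eq_zero.1 this.symm).resolve_right (H.pos₁ x₃ hx₃').ne'
  have hNs : StrictConcaveOn ℝ Z N := by
    have := (strictConvexOn_add_affine H.convex_range hconc.neg (-A) (-B)).neg
    refine this.congr fun z _ => ?_
    simp only [hN, Pi.neg_apply]
    ring
  have h13 : g₂ x₁ / g₁ x₁ < g₂ x₃ / g₁ x₃ := (H.ratio_lt_iff hx₁ hx₃').2 hx₃.1
  have memZ : ∀ x ∈ Ioo (0 : ℝ) 1, g₂ x / g₁ x ∈ Z := fun x hx => mem_image_of_mem _ hx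
  obtain ⟨hr1, hr2, hr3⟩ := H.left_side hP hNs.concaveOn hx₁
    (fun x hx => memZ x ⟨hx.1, hx.2.trans_lt hx₁.2⟩) hN1 (memZ x₃ hx₃') h13 hN3.ge
  have hpos : ∀ x ∈ Ioo x₁ x₃, 0 < tilt K g₁ g₂ A B x := by
    intro x hx
    have hx' : x ∈ Ioo (0 : ℝ) 1 := ⟨hx₁.1.trans hx.1, hx.2.trans hx₃'.2⟩
    rw [(H.quotient_sign hP hx').2.2.2]
    have h1 := (H.ratio_lt_iff hx₁ hx').2 hx.1
    have h2 := (H.ratio_lt_iff hx' hx₃').2 hx.2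
    have := strictConcaveOn_three hNs (memZ x₁ hx₁) (memZ x₃ hx₃') h1 h2
    rw [hN1, hN3, mul_zero, mul_zero, add_zero] at this
    exact (mul_pos_iff_of_pos_left (sub_pos.2 h13)).1 this
  have hneg : ∀ x ∈ Ioo x₃ 1, tilt K g₁ g₂ A B x < 0 := by
    intro x hx
    have hx' : x ∈ Ioo (0 : ℝ) 1 := ⟨hx₃'.1.trans hx.1, hx.2⟩
    rw [(H.quotient_sign hP hx').2.2.1]
    have h1 := (H.ratio_lt_iff hx₃' hx').2 hx.1
    have := strictConcaveOn_three hNs (memZ x₁ hx₁) (memZ x hx') h13 h1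
    rw [hN1, hN3, mul_zero, mul_zero, zero_add] at this
    exact neg_of_mul_neg_right this (sub_pos.2 h13).le
  exact ⟨A, B, x₃, _,
    { nonneg := m1.1
      le_left := hx₃.1.le
      le_right := hx₃.2.le
      le_one := le_rfl
      cont := hPc
      eq := H.eq_div_mul_mix _
      mono_left := hr2
      nonpos_left := hr1
      nonneg_mid := fun x hx => (hpos x hx).le
      nonpos_mid := fun x hx => (hneg x hx).le
      integral_mid := hint
      nonneg_right := fun x hx => absurd (hx.1.trans hx.2) (lt_irrefl _)
      mono_right := fun x hx => absurd (hx.1.trans hx.2) (lt_irrefl _)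
      strictMono_left := hr3 hNs
      pos_mid := hpos
      neg_mid := hneg
      strictMono_right := fun x hx => absurd (hx.1.trans hx.2) (lt_irrefl _) }⟩

/-- Full pooling is the unique maximizer of the mean under `g₁`. -/
theorem exists_strictCertificate_none (H : IsRatioPair f₁ f₂ g₁ g₂) :
    ∃ A x₃ : ℝ, ∃ α : ℝ → ℝ,
      StrictCertificate (mix f₁ f₂ g₁ g₂) (fun x => g₁ x - A * mix f₁ f₂ g₁ g₂ x) α 0 x₃ 1 := by
  have hI := integral_pos_of_pos H.cont H.pos le_rfl zero_lt_one le_rfl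
  set A : ℝ := (∫ x in (0 : ℝ)..1, g₁ x) / ∫ x in (0 : ℝ)..1, mix f₁ f₂ g₁ g₂ x with hA
  have hPc : ContinuousOn (fun x => g₁ x - A * mix f₁ f₂ g₁ g₂ x) (Icc 0 1) :=
    H.cont₁.sub (H.cont.const_mul A)
  have hint : ∫ x in (0 : ℝ)..1, (g₁ x - A * mix f₁ f₂ g₁ g₂ x) = 0 := by
    rw [intervalIntegral.integral_sub (intervalIntegrable_of_continuousOn H.cont₁)
      ((intervalIntegrable_of_continuousOn H.cont).const_mul A),
      intervalIntegral.integral_const_mul, hA, div_mul_cancel₀ _ hI.ne', sub_self]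
  obtain ⟨x₃, hx₃, hx₃0⟩ := exists_zero_of_integral_eq_zero hPc le_rfl zero_lt_one le_rfl hint
  have hg3 := H.pos₁ x₃ hx₃
  have hA1 : 1 = A * (f₁ + f₂ * (g₂ x₃ / g₁ x₃)) := by
    rw [H.mix_eq hx₃] at hx₃0
    have : (1 - A * (f₁ + f₂ * (g₂ x₃ / g₁ x₃))) * g₁ x₃ = 0 := by linarith
    linarith [(mul_eq_zero.1 this).resolve_right hg3.ne']
  have hAf : 0 < A * f₂ := by
    have : 0 < A := div_pos (integral_pos_of_pos H.cont₁ H.pos₁ le_rfl zero_lt_one le_rfl) hI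
    exact mul_pos this H.f₂_pos
  -- Relative to `g₁` the objective is a positive multiple of `z(x₃) - z(x)`, so it changes sign
  -- exactly once, at `x₃`.
  have hP : ∀ x ∈ Ioo (0 : ℝ) 1, g₁ x - A * mix f₁ f₂ g₁ g₂ x =
      A * f₂ * (g₂ x₃ / g₁ x₃ - g₂ x / g₁ x) * g₁ x := by
    intro x hx
    rw [H.mix_eq hx]
    linear_combination g₁ x * hA1
  have hpos : ∀ x ∈ Ioo 0 x₃, 0 < g₁ x - A * mix f₁ f₂ g₁ g₂ x := by
    intro x hx
    have hx' : x ∈ Ioo (0 : ℝ) 1 := ⟨hx.1, hx.2.trans hx₃.2⟩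
    rw [hP x hx']
    exact mul_pos (mul_pos hAf (sub_pos.2 ((H.ratio_lt_iff hx' hx₃).2 hx.2))) (H.pos₁ x hx')
  have hneg : ∀ x ∈ Ioo x₃ 1, g₁ x - A * mix f₁ f₂ g₁ g₂ x < 0 := by
    intro x hx
    have hx' : x ∈ Ioo (0 : ℝ) 1 := ⟨hx₃.1.trans hx.1, hx.2⟩
    rw [hP x hx']
    exact mul_neg_of_neg_of_pos (mul_neg_of_pos_of_neg hAf
      (sub_neg.2 ((H.ratio_lt_iff hx₃ hx').2 hx.1))) (H.pos₁ x hx')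
  exact ⟨A, x₃, fun x => (g₁ x - A * mix f₁ f₂ g₁ g₂ x) / mix f₁ f₂ g₁ g₂ x,
    { nonneg := le_rfl
      le_left := hx₃.1.le
      le_right := hx₃.2.le
      le_one := le_rfl
      cont := hPc
      eq := fun x hx => (div_mul_cancel₀ _ (H.pos x hx).ne').symm
      mono_left := fun x hx => absurd (hx.1.trans hx.2) (lt_irrefl _)
      nonpos_left := fun x hx => absurd (hx.1.trans hx.2) (lt_irrefl _)
      nonneg_mid := fun x hx => (hpos x hx).le
      nonpos_mid := fun x hx => (hneg x hx).le
      integral_mid := hint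
      nonneg_right := fun x hx => absurd (hx.1.trans hx.2) (lt_irrefl _)
      mono_right := fun x hx => absurd (hx.1.trans hx.2) (lt_irrefl _)
      strictMono_left := fun x hx => absurd (hx.1.trans hx.2) (lt_irrefl _)
      pos_mid := hpos
      neg_mid := hneg
      strictMono_right := fun x hx => absurd (hx.1.trans hx.2) (lt_irrefl _) }⟩

/-- Full revelation is the unique minimizer of the mean under `g₁`. -/
theorem exists_strictCertificate_full (H : IsRatioPair f₁ f₂ g₁ g₂) :
    ∃ A : ℝ, ∃ α : ℝ → ℝ,
      StrictCertificate (mix f₁ f₂ g₁ g₂) (fun x => A * mix f₁ f₂ g₁ g₂ x - g₁ x) α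
        (1 / 2) (1 / 2) (1 / 2) := by
  have hm : (1 / 2 : ℝ) ∈ Ioo (0 : ℝ) 1 := by norm_num
  have hl := H.ell_pos hm
  set z₀ := g₂ (1 / 2) / g₁ (1 / 2)
  -- The pool is degenerate and its location 1/2 arbitrary. The multiplier `A - 1/(f₁ + f₂ z)` is
  -- strictly increasing, and this `A` puts its zero at 1/2.
  set A : ℝ := (f₁ + f₂ * z₀)⁻¹ with hA
  have hA0 : 0 < A := inv_pos.2 hl
  have hα : ∀ x ∈ Ioo (0 : ℝ) 1, (A * mix f₁ f₂ g₁ g₂ x - g₁ x) / mix f₁ f₂ g₁ g₂ x =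
      A - (f₁ + f₂ * (g₂ x / g₁ x))⁻¹ := by
    intro x hx
    rw [sub_div, mul_div_cancel_right₀ _ (H.pos x hx).ne', H.mix_eq hx,
      div_mul_cancel_right₀ (H.pos₁ x hx).ne']
  have hmono : StrictMonoOn
      (fun x => (A * mix f₁ f₂ g₁ g₂ x - g₁ x) / mix f₁ f₂ g₁ g₂ x) (Ioo 0 1) := by
    intro x hx y hy hxy
    simp only
    rw [hα x hx, hα y hy]
    apply sub_lt_sub_left
    apply inv_strictAnti₀ (H.ell_pos hx)
    have := mul_lt_mul_of_pos_left ((H.ratio_lt_iff hx hy).2 hxy) H.f₂_pos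
    linarith
  have hzero : (A * mix f₁ f₂ g₁ g₂ (1 / 2) - g₁ (1 / 2)) / mix f₁ f₂ g₁ g₂ (1 / 2) = 0 := by
    rw [hα _ hm, hA, sub_self]
  have hmL : StrictMonoOn
      (fun x => (A * mix f₁ f₂ g₁ g₂ x - g₁ x) / mix f₁ f₂ g₁ g₂ x) (Ioo 0 (1 / 2)) :=
    hmono.mono (Ioo_subset_Ioo_right hm.2.le)
  have hmR : StrictMonoOn
      (fun x => (A * mix f₁ f₂ g₁ g₂ x - g₁ x) / mix f₁ f₂ g₁ g₂ x) (Ioo (1 / 2) 1) :=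
    hmono.mono (Ioo_subset_Ioo_left hm.1.le)
  exact ⟨A, fun x => (A * mix f₁ f₂ g₁ g₂ x - g₁ x) / mix f₁ f₂ g₁ g₂ x,
    { nonneg := hm.1.le
      le_left := le_rfl
      le_right := le_rfl
      le_one := hm.2.le
      cont := (H.cont.const_mul A).sub H.cont₁
      eq := fun x hx => (div_mul_cancel₀ _ (H.pos x hx).ne').symm
      mono_left := hmL.monotoneOn
      nonpos_left := fun x hx => by
        have := hmono ⟨hx.1, hx.2.trans hm.2⟩ hm hx.2
        simp only at this
        rw [hzero] at this
        exact this.le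
      nonneg_mid := fun x hx => absurd (hx.1.trans hx.2) (lt_irrefl _)
      nonpos_mid := fun x hx => absurd (hx.1.trans hx.2) (lt_irrefl _)
      integral_mid := intervalIntegral.integral_same
      nonneg_right := fun x hx => by
        have := hmono hm ⟨hm.1.trans hx.1, hx.2⟩ hx.1
        simp only at this
        rw [hzero] at this
        exact this.le
      mono_right := hmR.monotoneOn
      strictMono_left := hmL
      pos_mid := fun x hx => absurd (hx.1.trans hx.2) (lt_irrefl _)
      neg_mid := fun x hx => absurd (hx.1.trans hx.2) (lt_irrefl _)
      strictMono_right := hmR }⟩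

end IsRatioPair

end RatingDesign

/-! ### Inflection of `φ + γψ + A + Bz` and certificates for interior pools -/

namespace RatingDesign

/-- Curvature conditions on `φ` and `ψ` on an open set `Z`. -/
structure IsCurved (φ ψ : ℝ → ℝ) (Z : Set ℝ) : Prop where
  isOpen : IsOpen Z
  convex : Convex ℝ Z
  diffφ : DifferentiableOn ℝ φ Z
  diffφ' : DifferentiableOn ℝ (deriv φ) Z
  diffψ : DifferentiableOn ℝ ψ Z
  diffψ' : DifferentiableOn ℝ (deriv ψ) Z
  nonpos : ∀ z ∈ Z, deriv (deriv φ) z ≤ 0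
  pos : ∀ z ∈ Z, 0 < deriv (deriv ψ) z
  mono : MonotoneOn (fun z => deriv (deriv φ) z / deriv (deriv ψ) z) Z

namespace IsCurved

variable {φ ψ : ℝ → ℝ} {Z : Set ℝ}

theorem differentiableAt (C : IsCurved φ ψ Z) {z : ℝ} (hz : z ∈ Z) :
    DifferentiableAt ℝ φ z ∧ DifferentiableAt ℝ ψ z ∧
      DifferentiableAt ℝ (deriv φ) z ∧ DifferentiableAt ℝ (deriv ψ) z :=
  have h := C.isOpen.mem_nhds hz
  ⟨C.diffφ.differentiableAt h, C.diffψ.differentiableAt h, C.diffφ'.differentiableAt h,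
    C.diffψ'.differentiableAt h⟩

theorem hasDerivAt (C : IsCurved φ ψ Z) (γ A B : ℝ) {z : ℝ} (hz : z ∈ Z) :
    HasDerivAt (fun z => φ z + γ * ψ z + (A + B * z)) (deriv φ z + γ * deriv ψ z + B) z := by
  obtain ⟨h1, h2, -, -⟩ := C.differentiableAt hz
  have := (h1.hasDerivAt.add (h2.hasDerivAt.const_mul γ)).add
    (((hasDerivAt_id z).const_mul B).const_add A)
  exact this.congr_deriv (by rw [mul_one])

theorem eventuallyEq (C : IsCurved φ ψ Z) (γ A B : ℝ) {z : ℝ} (hz : z ∈ Z) :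
    deriv (fun z => φ z + γ * ψ z + (A + B * z)) =ᶠ[nhds z]
      fun z => deriv φ z + γ * deriv ψ z + B := by
  filter_upwards [C.isOpen.mem_nhds hz] with w hw
  exact (C.hasDerivAt γ A B hw).deriv

theorem hasDerivAt_deriv (C : IsCurved φ ψ Z) (γ A B : ℝ) {z : ℝ} (hz : z ∈ Z) :
    HasDerivAt (deriv (fun z => φ z + γ * ψ z + (A + B * z)))
      (deriv (deriv φ) z + γ * deriv (deriv ψ) z) z := by
  obtain ⟨-, -, h1, h2⟩ := C.differentiableAt hz
  have := (h1.hasDerivAt.add (h2.hasDerivAt.const_mul γ)).add_const B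
  exact this.congr_of_eventuallyEq (C.eventuallyEq γ A B hz)

/-- Factoring out `ψ'' > 0` leaves an increasing function of `z`; hence a zero of the second
derivative separates a concave from a convex part. -/
theorem deriv2 (C : IsCurved φ ψ Z) (γ A B : ℝ) {z : ℝ} (hz : z ∈ Z) :
    deriv^[2] (fun z => φ z + γ * ψ z + (A + B * z)) z =
      deriv (deriv ψ) z * (deriv (deriv φ) z / deriv (deriv ψ) z + γ) := by
  have := (C.pos z hz).ne'
  rw [Function.iterate_succ, Function.iterate_one, Function.comp_apply,
    (C.hasDerivAt_deriv γ A B hz).deriv]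
  field_simp

theorem continuousOn (C : IsCurved φ ψ Z) (γ A B : ℝ) :
    ContinuousOn (fun z => φ z + γ * ψ z + (A + B * z)) Z :=
  fun _ hz => (C.hasDerivAt γ A B hz).continuousAt.continuousWithinAt

theorem concaveOn (C : IsCurved φ ψ Z) (γ A B : ℝ) {ζ : ℝ} (hζ : ζ ∈ Z)
    (h0 : deriv (deriv φ) ζ / deriv (deriv ψ) ζ + γ = 0) :
    ConcaveOn ℝ (Z ∩ Iic ζ) (fun z => φ z + γ * ψ z + (A + B * z)) ∧
    ConvexOn ℝ (Z ∩ Ici ζ) (fun z => φ z + γ * ψ z + (A + B * z)) ∧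
    (StrictMonoOn (fun z => deriv (deriv φ) z / deriv (deriv ψ) z) Z →
      StrictConcaveOn ℝ (Z ∩ Iic ζ) (fun z => φ z + γ * ψ z + (A + B * z)) ∧
      StrictConvexOn ℝ (Z ∩ Ici ζ) (fun z => φ z + γ * ψ z + (A + B * z))) := by
  have hi1 : interior (Z ∩ Iic ζ) = Z ∩ Iio ζ := by
    rw [interior_inter, interior_Iic, C.isOpen.interior_eq]
  have hi2 : interior (Z ∩ Ici ζ) = Z ∩ Ioi ζ := by
    rw [interior_inter, interior_Ici, C.isOpen.interior_eq]
  have c1 : Convex ℝ (Z ∩ Iic ζ) := C.convex.inter (convex_Iic ζ)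
  have c2 : Convex ℝ (Z ∩ Ici ζ) := C.convex.inter (convex_Ici ζ)
  have k1 := (C.continuousOn γ A B).mono (inter_subset_left (s := Z) (t := Iic ζ))
  have k2 := (C.continuousOn γ A B).mono (inter_subset_left (s := Z) (t := Ici ζ))
  refine ⟨concaveOn_of_deriv2_nonpos c1 k1 ?_ ?_ ?_, convexOn_of_deriv2_nonneg c2 k2 ?_ ?_ ?_,
    fun hs => ⟨strictConcaveOn_of_deriv2_neg c1 k1 ?_, strictConvexOn_of_deriv2_pos c2 k2 ?_⟩⟩
  · rw [hi1]
    exact fun z hz => (C.hasDerivAt γ A B hz.1).differentiableAt.differentiableWithinAt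
  · rw [hi1]
    exact fun z hz => (C.hasDerivAt_deriv γ A B hz.1).differentiableAt.differentiableWithinAt
  · rw [hi1]
    intro z hz
    rw [C.deriv2 γ A B hz.1]
    have := C.mono hz.1 hζ (le_of_lt hz.2)
    simp only at this
    exact mul_nonpos_of_nonneg_of_nonpos (C.pos z hz.1).le (by linarith)
  · rw [hi2]
    exact fun z hz => (C.hasDerivAt γ A B hz.1).differentiableAt.differentiableWithinAt
  · rw [hi2]
    exact fun z hz => (C.hasDerivAt_deriv γ A B hz.1).differentiableAt.differentiableWithinAt
  · rw [hi2]
    intro z hz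
    rw [C.deriv2 γ A B hz.1]
    have := C.mono hζ hz.1 (le_of_lt hz.2)
    simp only at this
    exact mul_nonneg (C.pos z hz.1).le (by linarith)
  · rw [hi1]
    intro z hz
    rw [C.deriv2 γ A B hz.1]
    have := hs hz.1 hζ hz.2
    simp only at this
    exact mul_neg_of_pos_of_neg (C.pos z hz.1) (by linarith)
  · rw [hi2]
    intro z hz
    rw [C.deriv2 γ A B hz.1]
    have := hs hζ hz.1 hz.2
    simp only at this
    exact mul_pos (C.pos z hz.1) (by linarith)

theorem strictConvexOn (C : IsCurved φ ψ Z) : StrictConvexOn ℝ Z ψ := by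
  apply strictConvexOn_of_deriv2_pos C.convex C.diffψ.continuousOn
  rw [C.isOpen.interior_eq]
  exact C.pos

theorem convexOn_neg (C : IsCurved φ ψ Z) : ConvexOn ℝ Z (fun z => -φ z) := by
  have : ConcaveOn ℝ Z φ := by
    apply concaveOn_of_deriv2_nonpos C.convex C.diffφ.continuousOn
    · rw [C.isOpen.interior_eq]; exact C.diffφ
    · rw [C.isOpen.interior_eq]; exact C.diffφ'
    · rw [C.isOpen.interior_eq]; exact C.nonpos
  exact this.neg

/-- Rolle's theorem twice: three zeros of the function give two of the derivative and one of the
second derivative. -/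
theorem exists_inflection (C : IsCurved φ ψ Z) (γ A B : ℝ) {z₁ z₃ z₂ : ℝ} (h1 : z₁ ∈ Z)
    (h2 : z₂ ∈ Z) (h13 : z₁ < z₃) (h32 : z₃ < z₂)
    (e1 : φ z₁ + γ * ψ z₁ + (A + B * z₁) = 0) (e3 : φ z₃ + γ * ψ z₃ + (A + B * z₃) = 0)
    (e2 : φ z₂ + γ * ψ z₂ + (A + B * z₂) = 0) :
    ∃ ζ ∈ Ioo z₁ z₂, ζ ∈ Z ∧ deriv (deriv φ) ζ / deriv (deriv ψ) ζ + γ = 0 := by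
  have hsub : Icc z₁ z₂ ⊆ Z := C.convex.ordConnected.out h1 h2
  have hc := C.continuousOn γ A B
  obtain ⟨a, ha, hda⟩ := exists_deriv_eq_zero h13
    (hc.mono ((Icc_subset_Icc_right h32.le).trans hsub)) (by simp only [e1, e3])
  obtain ⟨b, hb, hdb⟩ := exists_deriv_eq_zero h32
    (hc.mono ((Icc_subset_Icc_left h13.le).trans hsub)) (by simp only [e2, e3])
  have hab : a < b := ha.2.trans hb.1
  obtain ⟨ζ, hζ, hd⟩ := exists_deriv_eq_zero
    (f := deriv (fun z => φ z + γ * ψ z + (A + B * z))) hab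
    (fun _ hz => (C.hasDerivAt_deriv γ A B (hsub ⟨ha.1.le.trans hz.1,
      hz.2.trans hb.2.le⟩)).continuousAt.continuousWithinAt) (by rw [hda, hdb])
  have hζ' : ζ ∈ Ioo z₁ z₂ := ⟨ha.1.trans hζ.1, hζ.2.trans hb.2⟩
  have hζZ := hsub (Ioo_subset_Icc_self hζ')
  refine ⟨ζ, hζ', hζZ, ?_⟩
  have := C.deriv2 γ A B hζZ
  rw [Function.iterate_succ, Function.iterate_one, Function.comp_apply, hd] at this
  exact (mul_eq_zero.1 this.symm).resolve_left (C.pos ζ hζZ).ne'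

end IsCurved

section Inflection

variable {Z : Set ℝ} {N : ℝ → ℝ} {ζ z₁ z₃ z₂ : ℝ}

/-- A concave function with zeros `z₁ < z₃` is nonpositive beyond `z₃`, in particular at the end `ζ`
of the concave part. -/
theorem nonpos_at_inflection (hL : ConcaveOn ℝ (Z ∩ Iic ζ) N) (hZ1 : z₁ ∈ Z) (hζZ : ζ ∈ Z)
    (hζ : z₁ < ζ) (h13 : z₁ < z₃) (hN1 : N z₁ = 0) (hN3 : N z₃ = 0) (h : z₃ ≤ ζ) : N ζ ≤ 0 := by
  rcases h.eq_or_lt with h | h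
  · rw [← h]; exact hN3.le
  · have := concaveOn_three hL ⟨hZ1, hζ.le⟩ ⟨hζZ, by simp⟩ h13 h
    rw [hN1, hN3] at this
    nlinarith

theorem nonneg_at_inflection (hR : ConvexOn ℝ (Z ∩ Ici ζ) N) (hZ2 : z₂ ∈ Z) (hζZ : ζ ∈ Z)
    (hζ : ζ < z₂) (h32 : z₃ < z₂) (hN2 : N z₂ = 0) (hN3 : N z₃ = 0) (h : ζ ≤ z₃) : 0 ≤ N ζ := by
  rcases h.eq_or_lt with h | h
  · rw [h]; exact hN3.ge
  · have := convexOn_three hR ⟨hζZ, by simp⟩ ⟨hZ2, hζ.le⟩ h h32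
    rw [hN2, hN3] at this
    nlinarith

/-- Between zeros in the same part the sign follows from concavity or convexity. When `z` and `z₃`
are on opposite sides of `ζ`, the sign of `N` at `ζ` takes the place of one zero. -/
theorem inflection_signs (hL : ConcaveOn ℝ (Z ∩ Iic ζ) N) (hR : ConvexOn ℝ (Z ∩ Ici ζ) N)
    (hZ1 : z₁ ∈ Z) (hZ3 : z₃ ∈ Z) (hZ2 : z₂ ∈ Z) (hζZ : ζ ∈ Z) (hζ : ζ ∈ Ioo z₁ z₂)
    (h13 : z₁ < z₃) (h32 : z₃ < z₂) (hN1 : N z₁ = 0) (hN3 : N z₃ = 0) (hN2 : N z₂ = 0) :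
    (∀ z ∈ Z, z₁ < z → z < z₃ → 0 ≤ N z) ∧ (∀ z ∈ Z, z₃ < z → z < z₂ → N z ≤ 0) := by
  have n1 := nonpos_at_inflection hL hZ1 hζZ hζ.1 h13 hN1 hN3
  have n2 := nonneg_at_inflection hR hZ2 hζZ hζ.2 h32 hN2 hN3
  constructor
  · intro z hZz h1 h3
    rcases le_total z₃ ζ with h | h
    · have := concaveOn_three hL ⟨hZ1, hζ.1.le⟩ ⟨hZ3, h⟩ h1 h3
      rw [hN1, hN3] at this
      nlinarith
    · rcases lt_or_ge z ζ with h4 | h4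
      · have := concaveOn_three hL ⟨hZ1, hζ.1.le⟩ ⟨hζZ, by simp⟩ h1 h4
        rw [hN1] at this
        nlinarith [n2 h]
      · have := convexOn_three hR ⟨hZz, h4⟩ ⟨hZ2, hζ.2.le⟩ h3 h32
        rw [hN2, hN3] at this
        nlinarith
  · intro z hZz h1 h3
    rcases le_total z₃ ζ with h | h
    · rcases le_or_gt z ζ with h4 | h4
      · have := concaveOn_three hL ⟨hZ1, hζ.1.le⟩ ⟨hZz, h4⟩ h13 h1
        rw [hN1, hN3] at this
        nlinarith
      · have := convexOn_three hR ⟨hζZ, by simp⟩ ⟨hZ2, hζ.2.le⟩ h4 h3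
        rw [hN2] at this
        nlinarith [n1 h]
    · have := convexOn_three hR ⟨hZ3, h⟩ ⟨hZ2, hζ.2.le⟩ h1 h3
      rw [hN2, hN3] at this
      nlinarith

theorem inflection_signs_strict (hL : StrictConcaveOn ℝ (Z ∩ Iic ζ) N)
    (hR : StrictConvexOn ℝ (Z ∩ Ici ζ) N)
    (hZ1 : z₁ ∈ Z) (hZ3 : z₃ ∈ Z) (hZ2 : z₂ ∈ Z) (hζZ : ζ ∈ Z) (hζ : ζ ∈ Ioo z₁ z₂)
    (h13 : z₁ < z₃) (h32 : z₃ < z₂) (hN1 : N z₁ = 0) (hN3 : N z₃ = 0) (hN2 : N z₂ = 0) :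
    (∀ z ∈ Z, z₁ < z → z < z₃ → 0 < N z) ∧ (∀ z ∈ Z, z₃ < z → z < z₂ → N z < 0) := by
  have n1 := nonpos_at_inflection hL.concaveOn hZ1 hζZ hζ.1 h13 hN1 hN3
  have n2 := nonneg_at_inflection hR.convexOn hZ2 hζZ hζ.2 h32 hN2 hN3
  constructor
  · intro z hZz h1 h3
    rcases le_total z₃ ζ with h | h
    · have := strictConcaveOn_three hL ⟨hZ1, hζ.1.le⟩ ⟨hZ3, h⟩ h1 h3
      rw [hN1, hN3] at this
      nlinarith
    · rcases lt_or_ge z ζ with h4 | h4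
      · have := strictConcaveOn_three hL ⟨hZ1, hζ.1.le⟩ ⟨hζZ, by simp⟩ h1 h4
        rw [hN1] at this
        nlinarith [n2 h]
      · have := strictConvexOn_three hR ⟨hZz, h4⟩ ⟨hZ2, hζ.2.le⟩ h3 h32
        rw [hN2, hN3] at this
        nlinarith
  · intro z hZz h1 h3
    rcases le_total z₃ ζ with h | h
    · rcases le_or_gt z ζ with h4 | h4
      · have := strictConcaveOn_three hL ⟨hZ1, hζ.1.le⟩ ⟨hZz, h4⟩ h13 h1
        rw [hN1, hN3] at this
        nlinarith
      · have := strictConvexOn_three hR ⟨hζZ, by simp⟩ ⟨hZ2, hζ.2.le⟩ h4 h3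
        rw [hN2] at this
        nlinarith [n1 h]
    · have := strictConvexOn_three hR ⟨hZ3, h⟩ ⟨hZ2, hζ.2.le⟩ h1 h3
      rw [hN2, hN3] at this
      nlinarith

end Inflection

namespace IsRatioPair

variable {f₁ f₂ : ℝ} {g₁ g₂ K₁ K₂ : ℝ → ℝ} {φ ψ : ℝ → ℝ}

/-- Subtracting from `φ` and `ψ` their chords over `[z₁,z₂]` makes both vanish at the ends. It
remains to choose `γ` so that the integrals cancel, which is possible because the strictly convex
`ψ` lies below its chord and so contributes a nonzero integral. -/
theorem exists_multipliers (H : IsRatioPair f₁ f₂ g₁ g₂)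
    (hK₁ : ContinuousOn K₁ (Icc 0 1)) (hK₂ : ContinuousOn K₂ (Icc 0 1))
    (hψ : ∀ x ∈ Ioo (0 : ℝ) 1, K₂ x = ψ (g₂ x / g₁ x) * g₁ x)
    (hc : StrictConvexOn ℝ ((fun x => g₂ x / g₁ x) '' Ioo 0 1) ψ) {x₁ x₂ : ℝ}
    (hx₁ : x₁ ∈ Ioo (0 : ℝ) 1) (hx₂ : x₂ ∈ Ioo (0 : ℝ) 1) (h12 : x₁ < x₂) :
    ∃ γ A B : ℝ,
      φ (g₂ x₁ / g₁ x₁) + γ * ψ (g₂ x₁ / g₁ x₁) + (A + B * (g₂ x₁ / g₁ x₁)) = 0 ∧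
      φ (g₂ x₂ / g₁ x₂) + γ * ψ (g₂ x₂ / g₁ x₂) + (A + B * (g₂ x₂ / g₁ x₂)) = 0 ∧
      ∫ x in x₁..x₂, tilt (fun x => K₁ x + γ * K₂ x) g₁ g₂ A B x = 0 := by
  have m1 := Ioo_subset_Icc_self hx₁
  have m2 := Ioo_subset_Icc_self hx₂
  have hz := (H.ratio_lt_iff hx₁ hx₂).2 h12
  have hZ : ∀ x ∈ Ioo (0 : ℝ) 1, g₂ x / g₁ x ∈ (fun x => g₂ x / g₁ x) '' Ioo 0 1 :=
    fun x hx => mem_image_of_mem _ hx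
  have hZ1 := hZ x₁ hx₁
  have hZ2 := hZ x₂ hx₂
  have hr : ∀ x ∈ Ioo x₁ x₂, x ∈ Ioo (0 : ℝ) 1 := fun x hx =>
    ⟨hx₁.1.trans hx.1, hx.2.trans hx₂.2⟩
  set z₁ := g₂ x₁ / g₁ x₁
  set z₂ := g₂ x₂ / g₁ x₂
  have hD : z₂ - z₁ ≠ 0 := (sub_pos.2 hz).ne'
  have hi2 := intervalIntegrable_sub (intervalIntegrable_of_continuousOn
    (H.continuousOn_tilt hK₂ (-ψ z₁ + (ψ z₂ - ψ z₁) / (z₂ - z₁) * z₁)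
      (-((ψ z₂ - ψ z₁) / (z₂ - z₁))))) m1 m2
  have hJ : ∫ x in x₁..x₂, tilt K₂ g₁ g₂ (-ψ z₁ + (ψ z₂ - ψ z₁) / (z₂ - z₁) * z₁)
      (-((ψ z₂ - ψ z₁) / (z₂ - z₁))) x ≠ 0 := by
    have : 0 < ∫ x in x₁..x₂, -tilt K₂ g₁ g₂ (-ψ z₁ + (ψ z₂ - ψ z₁) / (z₂ - z₁) * z₁)
        (-((ψ z₂ - ψ z₁) / (z₂ - z₁))) x := by
      refine intervalIntegral.intervalIntegral_pos_of_pos_on hi2.neg (fun x hx => neg_pos.2 ?_) h12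
      rw [H.tilt_eq hψ _ _ x (hr x hx)]
      refine mul_neg_of_neg_of_pos ?_ (H.pos₁ x (hr x hx))
      have l1 : z₁ < g₂ x / g₁ x := (H.ratio_lt_iff hx₁ (hr x hx)).2 hx.1
      have l2 : g₂ x / g₁ x < z₂ := (H.ratio_lt_iff (hr x hx) hx₂).2 hx.2
      have := strictConvexOn_three hc hZ1 hZ2 l1 l2
      simp only
      set z := g₂ x / g₁ x
      have e : (z₂ - z₁) * (ψ z + (-ψ z₁ + (ψ z₂ - ψ z₁) / (z₂ - z₁) * z₁ +
          -((ψ z₂ - ψ z₁) / (z₂ - z₁)) * z)) =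
          (z₂ - z₁) * ψ z - ((z₂ - z) * ψ z₁ + (z - z₁) * ψ z₂) := by
        field_simp
        ring
      refine neg_of_mul_neg_right ?_ (sub_pos.2 hz).le
      rw [e]
      linarith
    intro h0
    rw [intervalIntegral.integral_neg, h0] at this
    simp at this
  rw [H.integral_tilt hK₂ _ _ m1 m2] at hJ
  set G₁ := ∫ x in x₁..x₂, g₁ x
  set G₂ := ∫ x in x₁..x₂, g₂ x
  set J := (∫ x in x₁..x₂, K₂ x) + (-ψ z₁ + (ψ z₂ - ψ z₁) / (z₂ - z₁) * z₁) * G₁ +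
    -((ψ z₂ - ψ z₁) / (z₂ - z₁)) * G₂ with hJdef
  set I := (∫ x in x₁..x₂, K₁ x) + (-φ z₁ + (φ z₂ - φ z₁) / (z₂ - z₁) * z₁) * G₁ +
    -((φ z₂ - φ z₁) / (z₂ - z₁)) * G₂ with hIdef
  -- `I` and `J` are the integrals over the pool of `K₁` and `K₂` after removal of the chords; `A`
  -- and `B` below collect the chord coefficients.
  set γ := -I / J with hγ
  set B := -((φ z₂ - φ z₁) / (z₂ - z₁)) + γ * (-((ψ z₂ - ψ z₁) / (z₂ - z₁))) with hB
  set A := -φ z₁ + (φ z₂ - φ z₁) / (z₂ - z₁) * z₁ +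
    γ * (-ψ z₁ + (ψ z₂ - ψ z₁) / (z₂ - z₁) * z₁) with hA
  refine ⟨γ, A, B, ?_, ?_, ?_⟩
  · rw [hA, hB]; ring
  · have e : ∀ c : ℝ, c / (z₂ - z₁) * (z₂ - z₁) = c := fun c => div_mul_cancel₀ _ hD
    rw [hA, hB]
    linear_combination (-1 : ℝ) * e (φ z₂ - φ z₁) - γ * e (ψ z₂ - ψ z₁)
  · have hK : ContinuousOn (fun x => K₁ x + γ * K₂ x) (Icc 0 1) := hK₁.add (hK₂.const_mul γ)
    have i1 := intervalIntegrable_sub (intervalIntegrable_of_continuousOn hK₁) m1 m2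
    have i2 := intervalIntegrable_sub (intervalIntegrable_of_continuousOn hK₂) m1 m2
    rw [H.integral_tilt hK A B m1 m2, intervalIntegral.integral_add i1 (i2.const_mul γ),
      intervalIntegral.integral_const_mul]
    have : γ * J = -I := div_mul_cancel₀ _ hJ
    rw [hJdef, hIdef] at this
    rw [hA, hB]
    linear_combination this

/-- Here `N` has zeros at the two ends of the pool and at `x₃` inside, hence an inflection `ζ`
between the ends. Its concave part supplies the left multiplier, its convex part the right one, and
both together the signs on the pool. -/
theorem exists_certificate_middle (H : IsRatioPair f₁ f₂ g₁ g₂)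
    (hK₁ : ContinuousOn K₁ (Icc 0 1)) (hK₂ : ContinuousOn K₂ (Icc 0 1))
    (hφ : ∀ x ∈ Ioo (0 : ℝ) 1, K₁ x = φ (g₂ x / g₁ x) * g₁ x)
    (hψ : ∀ x ∈ Ioo (0 : ℝ) 1, K₂ x = ψ (g₂ x / g₁ x) * g₁ x)
    (C : IsCurved φ ψ ((fun x => g₂ x / g₁ x) '' Ioo 0 1)) {x₁ x₂ : ℝ}
    (hx₁ : x₁ ∈ Ioo (0 : ℝ) 1) (hx₂ : x₂ ∈ Ioo (0 : ℝ) 1) (h12 : x₁ < x₂) :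
    ∃ γ A B x₃ : ℝ, ∃ α : ℝ → ℝ,
      Certificate (mix f₁ f₂ g₁ g₂) (tilt (fun x => K₁ x + γ * K₂ x) g₁ g₂ A B) α x₁ x₃ x₂ ∧
      (StrictMonoOn (fun z => deriv (deriv φ) z / deriv (deriv ψ) z)
          ((fun x => g₂ x / g₁ x) '' Ioo 0 1) →
        StrictCertificate (mix f₁ f₂ g₁ g₂) (tilt (fun x => K₁ x + γ * K₂ x) g₁ g₂ A B) α
          x₁ x₃ x₂) := by
  set Z := (fun x => g₂ x / g₁ x) '' Ioo 0 1 with hZ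
  obtain ⟨γ, A, B, hN1, hN2, hint⟩ := H.exists_multipliers (φ := φ) hK₁ hK₂ hψ C.strictConvexOn
    hx₁ hx₂ h12
  set N : ℝ → ℝ := fun z => φ z + γ * ψ z + (A + B * z) with hN
  change N _ = 0 at hN1 hN2
  have hK : ContinuousOn (fun x => K₁ x + γ * K₂ x) (Icc 0 1) := hK₁.add (hK₂.const_mul γ)
  have hPc := H.continuousOn_tilt hK A B
  have hP : ∀ x ∈ Ioo (0 : ℝ) 1,
      tilt (fun x => K₁ x + γ * K₂ x) g₁ g₂ A B x = N (g₂ x / g₁ x) * g₁ x :=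
    H.tilt_eq (χ := fun z => φ z + γ * ψ z)
      (fun x hx => by simp only [hφ x hx, hψ x hx]; ring) A B
  obtain ⟨x₃, hx₃, hx₃0⟩ := exists_zero_of_integral_eq_zero hPc hx₁.1.le h12 hx₂.2.le hint
  have hx₃' : x₃ ∈ Ioo (0 : ℝ) 1 := ⟨hx₁.1.trans hx₃.1, hx₃.2.trans hx₂.2⟩
  have hN3 : N (g₂ x₃ / g₁ x₃) = 0 := by
    have := hP x₃ hx₃'
    rw [hx₃0] at this
    exact (mul_eq_zero.1 this.symm).resolve_right (H.pos₁ x₃ hx₃').ne'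
  have memZ : ∀ x ∈ Ioo (0 : ℝ) 1, g₂ x / g₁ x ∈ Z := fun x hx => mem_image_of_mem _ hx
  have hZ1 := memZ x₁ hx₁
  have hZ2 := memZ x₂ hx₂
  have hZ3 := memZ x₃ hx₃'
  have h13 : g₂ x₁ / g₁ x₁ < g₂ x₃ / g₁ x₃ := (H.ratio_lt_iff hx₁ hx₃').2 hx₃.1
  have h32 : g₂ x₃ / g₁ x₃ < g₂ x₂ / g₁ x₂ := (H.ratio_lt_iff hx₃' hx₂).2 hx₃.2
  obtain ⟨ζ, hζ, hζZ, hζ0⟩ := C.exists_inflection γ A B hZ1 hZ2 h13 h32 hN1 hN3 hN2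
  obtain ⟨hL, hR, hS⟩ := C.concaveOn γ A B hζZ hζ0
  change ConcaveOn ℝ _ N at hL
  change ConvexOn ℝ _ N at hR
  change _ → StrictConcaveOn ℝ _ N ∧ StrictConvexOn ℝ _ N at hS
  set z₁ := g₂ x₁ / g₁ x₁
  set z₂ := g₂ x₂ / g₁ x₂
  set z₃ := g₂ x₃ / g₁ x₃
  have hζL := nonpos_at_inflection hL hZ1 hζZ hζ.1 h13 hN1 hN3
  have hζR := nonneg_at_inflection hR hZ2 hζZ hζ.2 h32 hN2 hN3
  obtain ⟨hs1, hs2⟩ := inflection_signs hL hR hZ1 hZ3 hZ2 hζZ hζ h13 h32 hN1 hN3 hN2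
  -- The auxiliary point required by `left_side` must lie in the concave part: `z₃` if it is there,
  -- otherwise `ζ`.
  have hyL : ∃ y ∈ Z ∩ Iic ζ, z₁ < y ∧ 0 ≤ N y := by
    rcases le_total z₃ ζ with h | h
    · exact ⟨z₃, ⟨hZ3, h⟩, h13, hN3.ge⟩
    · exact ⟨ζ, ⟨hζZ, by simp⟩, hζ.1, hζR h⟩
  have hyR : ∃ y ∈ Z ∩ Ici ζ, y < z₂ ∧ N y ≤ 0 := by
    rcases le_total z₃ ζ with h | h
    · exact ⟨ζ, ⟨hζZ, by simp⟩, hζ.2, hζL h⟩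
    · exact ⟨z₃, ⟨hZ3, h⟩, h32, hN3.le⟩
  obtain ⟨yL, hyL1, hyL2, hyL3⟩ := hyL
  obtain ⟨yR, hyR1, hyR2, hyR3⟩ := hyR
  obtain ⟨hl1, hl2, hl3⟩ := H.left_side hP hL hx₁ (fun x hx => by
    have hx' : x ∈ Ioo (0 : ℝ) 1 := ⟨hx.1, hx.2.trans_lt hx₁.2⟩
    exact ⟨memZ x hx', (H.strictMono.monotoneOn hx' hx₁ hx.2).trans hζ.1.le⟩) hN1 hyL1 hyL2 hyL3
  obtain ⟨hr1, hr2, hr3⟩ := H.right_side hP hR hx₂ (fun x hx => by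
    have hx' : x ∈ Ioo (0 : ℝ) 1 := ⟨hx₂.1.trans_le hx.1, hx.2⟩
    exact ⟨memZ x hx', hζ.2.le.trans (H.strictMono.monotoneOn hx₂ hx' hx.1)⟩) hN2 hyR1 hyR2 hyR3
  have hcert : Certificate (mix f₁ f₂ g₁ g₂) (tilt (fun x => K₁ x + γ * K₂ x) g₁ g₂ A B)
      (fun x => tilt (fun x => K₁ x + γ * K₂ x) g₁ g₂ A B x / mix f₁ f₂ g₁ g₂ x) x₁ x₃ x₂ :=
    { nonneg := hx₁.1.le
      le_left := hx₃.1.le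
      le_right := hx₃.2.le
      le_one := hx₂.2.le
      cont := hPc
      eq := H.eq_div_mul_mix _
      mono_left := hl2
      nonpos_left := hl1
      nonneg_mid := by
        intro x hx
        have hx' : x ∈ Ioo (0 : ℝ) 1 := ⟨hx₁.1.trans hx.1, hx.2.trans hx₃'.2⟩
        exact (H.quotient_sign hP hx').2.1.2 (hs1 _ (memZ x hx')
          ((H.ratio_lt_iff hx₁ hx').2 hx.1) ((H.ratio_lt_iff hx' hx₃').2 hx.2))
      nonpos_mid := by
        intro x hx
        have hx' : x ∈ Ioo (0 : ℝ) 1 := ⟨hx₃'.1.trans hx.1, hx.2.trans hx₂.2⟩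
        exact (H.quotient_sign hP hx').1.2 (hs2 _ (memZ x hx')
          ((H.ratio_lt_iff hx₃' hx').2 hx.1) ((H.ratio_lt_iff hx' hx₂).2 hx.2))
      integral_mid := hint
      nonneg_right := hr1
      mono_right := hr2 }
  refine ⟨γ, A, B, x₃, _, hcert, fun hs => ?_⟩
  obtain ⟨hsL, hsR⟩ := hS hs
  obtain ⟨ht1, ht2⟩ := inflection_signs_strict hsL hsR hZ1 hZ3 hZ2 hζZ hζ h13 h32 hN1 hN3 hN2
  exact
    { hcert with
      strictMono_left := hl3 hsL
      pos_mid := by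
        intro x hx
        have hx' : x ∈ Ioo (0 : ℝ) 1 := ⟨hx₁.1.trans hx.1, hx.2.trans hx₃'.2⟩
        exact (H.quotient_sign hP hx').2.2.2.2 (ht1 _ (memZ x hx')
          ((H.ratio_lt_iff hx₁ hx').2 hx.1) ((H.ratio_lt_iff hx' hx₃').2 hx.2))
      neg_mid := by
        intro x hx
        have hx' : x ∈ Ioo (0 : ℝ) 1 := ⟨hx₃'.1.trans hx.1, hx.2.trans hx₂.2⟩
        exact (H.quotient_sign hP hx').2.2.1.2 (ht2 _ (memZ x hx')
          ((H.ratio_lt_iff hx₃' hx').2 hx.1) ((H.ratio_lt_iff hx' hx₂).2 hx.2))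
      strictMono_right := hr3 hsR }

end IsRatioPair

end RatingDesign

/-! ### Threshold qualities with given mean and given incentive -/

namespace RatingDesign

/-- The pairs of thresholds. -/
def thresholdPairs : Set (ℝ × ℝ) := {p | 0 ≤ p.1 ∧ p.1 ≤ p.2 ∧ p.2 ≤ 1}

theorem isCompact_thresholdPairs : IsCompact thresholdPairs := by
  refine IsCompact.of_isClosed_subset (isCompact_Icc.prod isCompact_Icc :
    IsCompact (Icc (0 : ℝ) 1 ×ˢ Icc (0 : ℝ) 1)) ?_ ?_
  · exact (isClosed_le continuous_const continuous_fst).inter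
      ((isClosed_le continuous_fst continuous_snd).inter
        (isClosed_le continuous_snd continuous_const))
  · rintro ⟨a, b⟩ ⟨h0, h1, h2⟩
    exact ⟨⟨h0, h1.trans h2⟩, ⟨h0.trans h1, h2⟩⟩

theorem continuousOn_primitive {K : ℝ → ℝ} (hK : ContinuousOn K (Icc 0 1)) :
    ContinuousOn (fun x => ∫ t in (0 : ℝ)..x, K t) (Icc 0 1) := by
  have := intervalIntegral.continuousOn_primitive_interval (a := (0 : ℝ)) (b := 1)
    (f := K) (μ := volume)
    (by rw [uIcc_of_le zero_le_one]; exact hK.integrableOn_Icc)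
  rwa [uIcc_of_le zero_le_one] at this

theorem continuousOn_integral_thresholdPairs {K : ℝ → ℝ} (hK : ContinuousOn K (Icc 0 1)) :
    ContinuousOn (fun p : ℝ × ℝ => ∫ t in p.1..p.2, K t) thresholdPairs := by
  have h1 : ContinuousOn (fun p : ℝ × ℝ => ∫ t in (0 : ℝ)..p.1, K t) thresholdPairs :=
    (continuousOn_primitive hK).comp continuousOn_fst fun p hp => ⟨hp.1, hp.2.1.trans hp.2.2⟩
  have h2 : ContinuousOn (fun p : ℝ × ℝ => ∫ t in (0 : ℝ)..p.2, K t) thresholdPairs :=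
    (continuousOn_primitive hK).comp continuousOn_snd fun p hp => ⟨hp.1.trans hp.2.1, hp.2.2⟩
  refine (h2.sub h1).congr fun p hp => ?_
  have := integral_split (intervalIntegrable_of_continuousOn hK) (left_mem_Icc.2 zero_le_one)
    (b := p.1) (c := p.2) ⟨hp.1, hp.2.1.trans hp.2.2⟩ ⟨hp.1.trans hp.2.1, hp.2.2⟩
  exact (sub_eq_of_eq_add' this.symm).symm

section

variable {h : ℝ → ℝ} {x₁ x₂ : ℝ}

theorem continuousOn_thresholdValue (hc : ContinuousOn h (Icc 0 1))
    (hp : ∀ x ∈ Ioo (0 : ℝ) 1, 0 < h x) {K : ℝ → ℝ} (hK : ContinuousOn K (Icc 0 1)) :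
    ContinuousOn (fun p : ℝ × ℝ => ∫ t in (0 : ℝ)..1, thresholdQuality h p.1 p.2 t * K t)
      thresholdPairs := by
  have hKt := continuousOn_id_mul hK
  have h1 : ContinuousOn (fun p : ℝ × ℝ => ∫ t in (0 : ℝ)..p.1, t * K t) thresholdPairs :=
    (continuousOn_primitive hKt).comp continuousOn_fst fun p hp => ⟨hp.1, hp.2.1.trans hp.2.2⟩
  have h3 : ContinuousOn (fun p : ℝ × ℝ => ∫ t in p.2..1, t * K t) thresholdPairs := by
    refine (continuousOn_const (c := ∫ t in (0 : ℝ)..1, t * K t)).sub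
      ((continuousOn_primitive hKt).comp continuousOn_snd
        fun p hp => ⟨hp.1.trans hp.2.1, hp.2.2⟩) |>.congr fun p hp => ?_
    have := integral_split (intervalIntegrable_of_continuousOn hKt) (left_mem_Icc.2 zero_le_one)
      (b := p.2) (c := 1) ⟨hp.1.trans hp.2.1, hp.2.2⟩ (right_mem_Icc.2 zero_le_one)
    exact (sub_eq_of_eq_add' this.symm).symm
  have hG := continuousOn_integral_thresholdPairs hK
  have h2 : ContinuousOn (fun p : ℝ × ℝ => poolMean h p.1 p.2 * ∫ t in p.1..p.2, K t)
      thresholdPairs := by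
    intro p hpp
    -- On the diagonal the pool mean need not be continuous, but on nondegenerate pools it is
    -- bounded by 1, while the integral it multiplies tends to 0.
    rcases hpp.2.1.eq_or_lt with heq | hlt
    · have hGp := hG p hpp
      have hz : ∫ t in p.1..p.2, K t = 0 := by rw [heq, intervalIntegral.integral_same]
      rw [ContinuousWithinAt, hz] at hGp
      rw [ContinuousWithinAt, hz, mul_zero]
      refine squeeze_zero_norm' ?_ (tendsto_zero_iff_norm_tendsto_zero.1 hGp)
      filter_upwards [self_mem_nhdsWithin] with p' hp'
      rcases hp'.2.1.eq_or_lt with h4 | h4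
      · simp [h4]
      · have hm := poolMean_mem hc hp hp'.1 h4 hp'.2.2
        rw [norm_mul, Real.norm_eq_abs]
        have : |poolMean h p'.1 p'.2| ≤ 1 := by
          rw [abs_le]
          constructor
          · linarith [hm.1, hp'.1]
          · linarith [hm.2, hp'.2.2]
        exact mul_le_of_le_one_left (norm_nonneg _) this
    · exact (((continuousOn_integral_thresholdPairs (continuousOn_id_mul hc)) p hpp).div
        ((continuousOn_integral_thresholdPairs hc) p hpp)
        (integral_pos_of_pos hc hp hpp.1 hlt hpp.2.2).ne').mul (hG p hpp)
  exact ((h1.add h2).add h3).congr fun p hpp =>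
    integral_thresholdQuality_mul hc hp hpp.1 hpp.2.1 hpp.2.2 hK

/-- The new mean is an average, with positive weights, of the old mean, which is below `x₂`, and the
mean over `(x₂,x₂')`, which is above it. -/
theorem poolMean_lt (hc : ContinuousOn h (Icc 0 1)) (hp : ∀ x ∈ Ioo (0 : ℝ) 1, 0 < h x)
    (h0 : 0 ≤ x₁) (h12 : x₁ < x₂) {x₂' : ℝ} (h22 : x₂ < x₂') (h1 : x₂' ≤ 1) :
    poolMean h x₁ x₂ < poolMean h x₁ x₂' := by
  have a := poolMean_mem hc hp h0 h12 (h22.le.trans h1)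
  have b := poolMean_mem hc hp (h0.trans h12.le) h22 h1
  have e1 := poolMean_mul hc hp h0 h12.le (h22.le.trans h1)
  have e2 := poolMean_mul hc hp (h0.trans h12.le) h22.le h1
  have e3 := poolMean_mul hc hp h0 (h12.trans h22).le h1
  have i1 := integral_pos_of_pos hc hp h0 h12 (h22.le.trans h1)
  have i2 := integral_pos_of_pos hc hp (h0.trans h12.le) h22 h1
  have m1 : x₁ ∈ Icc (0 : ℝ) 1 := ⟨h0, h12.le.trans (h22.le.trans h1)⟩
  have m2 : x₂ ∈ Icc (0 : ℝ) 1 := ⟨h0.trans h12.le, h22.le.trans h1⟩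
  have m3 : x₂' ∈ Icc (0 : ℝ) 1 := ⟨m2.1.trans h22.le, h1⟩
  rw [← integral_split (intervalIntegrable_of_continuousOn hc) m1 m2 m3,
    ← integral_split (intervalIntegrable_of_continuousOn (continuousOn_id_mul hc)) m1 m2 m3,
    ← e1, ← e2] at e3
  have : poolMean h x₁ x₂ < poolMean h x₂ x₂' := a.2.trans b.1
  nlinarith

end

/-- The level set `W = w` contains a curve from the side `x = 0` to the side `y = 1`, and `A - a`
has opposite weak signs at its ends. Projecting to the first coordinate replaces continuity of the
curve by compactness. -/
theorem exists_level_point {W A : ℝ × ℝ → ℝ} (hW : ContinuousOn W thresholdPairs)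
    (hA : ContinuousOn A thresholdPairs)
    (hmono : ∀ x y y' : ℝ, 0 ≤ x → x ≤ y → y < y' → y' ≤ 1 → W (x, y) < W (x, y')) {w a : ℝ}
    (hdiag : ∀ x ∈ Icc (0 : ℝ) 1, W (x, x) < w) (hfull : w < W (0, 1))
    (hlow : ∀ y ∈ Ioo (0 : ℝ) 1, W (0, y) = w → a ≤ A (0, y))
    (hup : ∀ x ∈ Ioo (0 : ℝ) 1, W (x, 1) = w → A (x, 1) ≤ a) :
    ∃ x y : ℝ, 0 ≤ x ∧ x < y ∧ y ≤ 1 ∧ W (x, y) = w ∧ A (x, y) = a := by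
  have z0 : (0 : ℝ) ∈ Icc (0 : ℝ) 1 := left_mem_Icc.2 zero_le_one
  have z1 : (1 : ℝ) ∈ Icc (0 : ℝ) 1 := right_mem_Icc.2 zero_le_one
  have hW1 : ContinuousOn (fun x => W (x, 1)) (Icc 0 1) :=
    hW.comp (by fun_prop) fun x hx => ⟨hx.1, hx.2, le_rfl⟩
  have hclosed : IsClosed {x | x ∈ Icc (0 : ℝ) 1 ∧ W (x, 1) ≤ w} :=
    isClosed_Icc.isClosed_le hW1 continuousOn_const
  have hcomp : IsCompact {x | x ∈ Icc (0 : ℝ) 1 ∧ W (x, 1) ≤ w} :=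
    isCompact_Icc.of_isClosed_subset hclosed fun x hx => hx.1
  -- For the least `m` with `W (m, 1) ≤ w`, every vertical line over `[0,m]` meets the level set,
  -- and over `m` it does so at `y = 1`.
  obtain ⟨m, ⟨hm01, hmw⟩, hmin⟩ := hcomp.exists_isLeast ⟨1, z1, (hdiag 1 z1).le⟩
  have hm_eq : W (m, 1) = w := by
    obtain ⟨x, hx, hxw⟩ := intermediate_value_Icc' hm01.1
      (hW1.mono (Icc_subset_Icc_right hm01.2)) ⟨hmw, hfull.le⟩
    have : m ≤ x := hmin ⟨⟨hx.1, hx.2.trans hm01.2⟩, (le_of_eq hxw)⟩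
    rw [le_antisymm this hx.2]
    exact hxw
  have hm0 : 0 < m := by
    rcases hm01.1.eq_or_lt with h | h
    · rw [← h] at hm_eq
      exact absurd hm_eq hfull.ne'
    · exact h
  have hm1 : m < 1 := by
    rcases hm01.2.eq_or_lt with h | h
    · rw [h] at hm_eq
      exact absurd hm_eq (hdiag 1 z1).ne
    · exact h
  have hex : ∀ x ∈ Icc 0 m, ∃ y ∈ Icc x 1, W (x, y) = w := by
    intro x hx
    have hx1 := hx.2.trans hm01.2
    have hwx : w ≤ W (x, 1) := by
      rcases hx.2.eq_or_lt with h | h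
      · rw [h, hm_eq]
      · by_contra hcon
        exact absurd (hmin ⟨⟨hx.1, hx1⟩, (not_le.1 hcon).le⟩) (not_le.2 h)
    have hc : ContinuousOn (fun y => W (x, y)) (Icc x 1) :=
      hW.comp (by fun_prop) fun y hy => ⟨hx.1, hy.1, hy.2⟩
    obtain ⟨y, hy, hyw⟩ := intermediate_value_Icc hx1 hc ⟨(hdiag x ⟨hx.1, hx1⟩).le, hwx⟩
    exact ⟨y, hy, hyw⟩
  have hcl := isCompact_thresholdPairs.isClosed
  set E : Set (ℝ × ℝ) := {p | p ∈ thresholdPairs ∧ W p = w} with hE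
  have hEc : IsClosed E := by
    have h1 : IsClosed {p | p ∈ thresholdPairs ∧ W p ≤ w} := hcl.isClosed_le hW continuousOn_const
    have h2 : IsClosed {p | p ∈ thresholdPairs ∧ w ≤ W p} := hcl.isClosed_le continuousOn_const hW
    convert h1.inter h2 using 1
    ext p
    exact ⟨fun h => ⟨⟨h.1, h.2.le⟩, h.1, h.2.ge⟩, fun h => ⟨h.1.1, le_antisymm h.1.2 h.2.2⟩⟩
  have hEsub : E ⊆ thresholdPairs := fun p hp => hp.1
  have hP : IsClosed (Prod.fst '' {p | p ∈ E ∧ a ≤ A p}) :=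
    ((isCompact_thresholdPairs.of_isClosed_subset
      (hEc.isClosed_le continuousOn_const (hA.mono hEsub)) fun p hp => hp.1.1).image
      continuous_fst).isClosed
  have hM : IsClosed (Prod.fst '' {p | p ∈ E ∧ A p ≤ a}) :=
    ((isCompact_thresholdPairs.of_isClosed_subset
      (hEc.isClosed_le (hA.mono hEsub) continuousOn_const) fun p hp => hp.1.1).image
      continuous_fst).isClosed
  -- The projections of the parts `A ≥ a` and `A ≤ a` of the level set are closed and cover the
  -- connected interval `[0,m]`, so they share an `x`. Strict monotonicity in `y` then identifies
  -- the two points above it.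
  obtain ⟨x, hx, ⟨⟨p, hp, hpx⟩, ⟨p', hp', hpx'⟩⟩⟩ :=
    isPreconnected_closed_iff.1 (isPreconnected_Icc (a := (0 : ℝ)) (b := m)) _ _ hP hM
      (by
        intro x hx
        obtain ⟨y, hy, hyw⟩ := hex x hx
        have hmem : (x, y) ∈ E := ⟨⟨hx.1, hy.1, hy.2⟩, hyw⟩
        rcases le_total a (A (x, y)) with h | h
        · exact Or.inl ⟨(x, y), ⟨hmem, h⟩, rfl⟩
        · exact Or.inr ⟨(x, y), ⟨hmem, h⟩, rfl⟩)
      (by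
        obtain ⟨y, hy, hyw⟩ := hex 0 ⟨le_rfl, hm0.le⟩
        have hy0 : 0 < y := by
          rcases hy.1.eq_or_lt with h | h
          · rw [← h] at hyw
            exact absurd hyw (hdiag 0 z0).ne
          · exact h
        have hy1 : y < 1 := by
          rcases hy.2.eq_or_lt with h | h
          · rw [h] at hyw
            exact absurd hyw hfull.ne'
          · exact h
        exact ⟨0, ⟨le_rfl, hm0.le⟩, (0, y), ⟨⟨⟨le_rfl, hy.1, hy.2⟩, hyw⟩,
          hlow y ⟨hy0, hy1⟩ hyw⟩, rfl⟩)
      (by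
        exact ⟨m, ⟨hm0.le, le_rfl⟩, (m, 1), ⟨⟨⟨hm0.le, hm1.le, le_rfl⟩, hm_eq⟩,
          hup m ⟨hm0, hm1⟩ hm_eq⟩, rfl⟩)
  obtain ⟨x', y⟩ := p
  obtain ⟨x'', y'⟩ := p'
  simp only at hpx hpx'
  subst hpx
  subst hpx'
  have hyy : y = y' := by
    rcases lt_trichotomy y y' with h | h | h
    · have := hmono x'' y y' hp.1.1.1 hp.1.1.2.1 h hp'.1.1.2.2
      rw [hp.1.2, hp'.1.2] at this
      exact absurd this (lt_irrefl _)
    · exact h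
    · have := hmono x'' y' y hp.1.1.1 hp'.1.1.2.1 h hp.1.1.2.2
      rw [hp.1.2, hp'.1.2] at this
      exact absurd this (lt_irrefl _)
  subst hyy
  refine ⟨x'', y, hp.1.1.1, ?_, hp.1.1.2.2, hp.1.2, le_antisymm hp'.2 hp.2⟩
  rcases hp.1.1.2.1.eq_or_lt with h | h
  · have h' : x'' = y := h
    have := hp.1.2
    rw [← h'] at this
    exact absurd this (hdiag x'' ⟨hp.1.1.1, hp.1.1.2.1.trans hp.1.1.2.2⟩).ne
  · exact h

/-- `K` changes sign once, from nonpositive to nonnegative, so `-K` has a nonnegative primitive.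
Applied to `g_q`, this says that increasing signaled qualities give nonnegative incentives. -/
theorem integral_nonneg_of_mlr {g K y : ℝ → ℝ} (hpos : ∀ x ∈ Ioo (0 : ℝ) 1, 0 < g x)
    (hK : ContinuousOn K (Icc 0 1)) (hmono : MonotoneOn (fun x => K x / g x) (Ioo 0 1))
    (hK0 : ∫ x in (0 : ℝ)..1, K x = 0) (hy : MonotoneOn y (Icc 0 1)) :
    0 ≤ ∫ x in (0 : ℝ)..1, y x * K x := by
  obtain ⟨c, hc, hc0⟩ := exists_zero_of_integral_eq_zero hK le_rfl zero_lt_one le_rfl hK0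
  have hi := intervalIntegrable_of_continuousOn hK
  have hint : ∫ x in (0 : ℝ)..1, -K x = 0 := by rw [intervalIntegral.integral_neg, hK0, neg_zero]
  have hsign : ∀ x ∈ Ioo (0 : ℝ) 1, K x = K x / g x * g x := fun x hx =>
    (div_mul_cancel₀ _ (hpos x hx).ne').symm
  have hU : ∀ x ∈ Icc (0 : ℝ) 1, 0 ≤ ∫ t in (0 : ℝ)..x, -K t := by
    intro x hx
    refine primitive_nonneg (d := c) hi.neg (Ioo_subset_Icc_self hc) (fun t ht => ?_)
      (fun t ht => ?_) hint.ge hx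
    · have ht' : t ∈ Ioo (0 : ℝ) 1 := ⟨ht.1, ht.2.trans hc.2⟩
      have := hmono ht' hc ht.2.le
      simp only [hc0, zero_div] at this
      change 0 ≤ -K t
      rw [hsign t ht']
      exact neg_nonneg.2 (mul_nonpos_of_nonpos_of_nonneg this (hpos t ht').le)
    · have ht' : t ∈ Ioo (0 : ℝ) 1 := ⟨hc.1.trans ht.1, ht.2⟩
      have := hmono hc ht' ht.1.le
      simp only [hc0, zero_div] at this
      change -K t ≤ 0
      rw [hsign t ht']
      exact neg_nonpos.2 (mul_nonneg this (hpos t ht').le)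
  have hyK := intervalIntegrable_mul (intervalIntegrable_of_monotoneOn hy) hK.neg
  have := integral_mul_le (c := 0) hi.neg hU hint (hy.mono Ioo_subset_Icc_self) hyK hc hc le_rfl
    fun x hx => hU x ⟨hc.1.le.trans hx.1, hx.2.trans hc.2.le⟩
  have e : ∫ x in (0 : ℝ)..1, y x * (-K) x = -∫ x in (0 : ℝ)..1, y x * K x := by
    rw [← intervalIntegral.integral_neg]
    exact intervalIntegral.integral_congr fun x _ => by simp
  rw [e] at this
  simpa using this

namespace IsRatioPair

variable {f₁ f₂ : ℝ} {g₁ g₂ K₁ K₂ : ℝ → ℝ} {φ ψ : ℝ → ℝ}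

/-- Extending the pooling interval to the right strictly increases the mean under `g₁`. -/
theorem value_lt (H : IsRatioPair f₁ f₂ g₁ g₂) {x₁ x₂ x₂' : ℝ} (h0 : 0 ≤ x₁) (h12 : x₁ ≤ x₂)
    (h22 : x₂ < x₂') (h1 : x₂' ≤ 1) :
    ∫ t in (0 : ℝ)..1, thresholdQuality (mix f₁ f₂ g₁ g₂) x₁ x₂ t * g₁ t <
      ∫ t in (0 : ℝ)..1, thresholdQuality (mix f₁ f₂ g₁ g₂) x₁ x₂' t * g₁ t := by
  set h := mix f₁ f₂ g₁ g₂ with hh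
  have h12' : x₁ < x₂' := h12.trans_lt h22
  have hm' := poolMean_mem H.cont H.pos h0 h12' h1
  set m' := poolMean h x₁ x₂' with hm'def
  -- The larger pool pays weakly more before `c`, strictly less on `(c, x₂')` and the same
  -- afterwards. The constant `k` below makes `g₁ - k h` change sign at `c` too; as both qualities
  -- have the same mean under `h`, subtracting `k h` does not alter the comparison.
  set c := max m' x₂ with hcdef
  have hcx : c < x₂' := max_lt hm'.2 h22
  have hc0 : 0 < c := lt_max_of_lt_left (h0.trans_lt hm'.1)
  have hc : c ∈ Ioo (0 : ℝ) 1 := ⟨hc0, hcx.trans_le h1⟩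
  set k := (f₁ + f₂ * (g₂ c / g₁ c))⁻¹ with hk
  have hk0 : 0 < k := inv_pos.2 (H.ell_pos hc)
  have hkeq : k * (f₁ + f₂ * (g₂ c / g₁ c)) = 1 := inv_mul_cancel₀ (H.ell_pos hc).ne'
  have hker : ∀ x ∈ Ioo (0 : ℝ) 1, g₁ x - k * h x =
      k * f₂ * (g₂ c / g₁ c - g₂ x / g₁ x) * g₁ x := by
    intro x hx
    rw [hh, H.mix_eq hx]
    linear_combination (-g₁ x) * hkeq
  have hT := intervalIntegrable_thresholdQuality H.cont H.pos h0 (h22.le.trans h1)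
  have hT' := intervalIntegrable_thresholdQuality H.cont H.pos h0 h1
  have hmT := (isMajorized_thresholdQuality H.cont H.pos h0 h12 (h22.le.trans h1)).2
  have hmT' := (isMajorized_thresholdQuality H.cont H.pos h0 h12'.le h1).2
  rw [integral_sub_id_mul hT H.cont] at hmT
  rw [integral_sub_id_mul hT' H.cont] at hmT'
  have hPc : ContinuousOn (fun x => g₁ x - k * h x) (Icc 0 1) := H.cont₁.sub (H.cont.const_mul k)
  have hprod := intervalIntegrable_mul (hT'.sub hT) hPc
  have hkey : 0 < ∫ t in (0 : ℝ)..1,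
      (thresholdQuality h x₁ x₂' t - thresholdQuality h x₁ x₂ t) * (g₁ t - k * h t) := by
    have hleft : ∀ t ∈ Ioo 0 c, 0 ≤
        (thresholdQuality h x₁ x₂' t - thresholdQuality h x₁ x₂ t) * (g₁ t - k * h t) := by
      intro t ht
      have ht' : t ∈ Ioo (0 : ℝ) 1 := ⟨ht.1, ht.2.trans hc.2⟩
      refine mul_nonneg ?_ ?_
      · by_cases hx : x₁ < t
        · rw [thresholdQuality_of_mem ⟨hx, ht.2.trans hcx⟩]
          by_cases hx2 : t < x₂
          · rw [thresholdQuality_of_mem ⟨hx, hx2⟩]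
            exact sub_nonneg.2 (poolMean_lt H.cont H.pos h0 (hx.trans hx2) h22 h1).le
          · rw [thresholdQuality_of_notMem fun h => hx2 h.2]
            have : t < m' := (lt_max_iff.1 ht.2).resolve_right hx2
            exact sub_nonneg.2 this.le
        · rw [thresholdQuality_of_notMem fun h => hx h.1,
            thresholdQuality_of_notMem fun h => hx h.1, sub_self]
      · rw [hker t ht']
        exact mul_nonneg (mul_nonneg (mul_pos hk0 H.f₂_pos).le
          (sub_nonneg.2 ((H.ratio_lt_iff ht' hc).2 ht.2).le)) (H.pos₁ t ht').le
    have hmid : ∀ t ∈ Ioo c x₂', 0 <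
        (thresholdQuality h x₁ x₂' t - thresholdQuality h x₁ x₂ t) * (g₁ t - k * h t) := by
      intro t ht
      have ht' : t ∈ Ioo (0 : ℝ) 1 := ⟨hc0.trans ht.1, ht.2.trans_le h1⟩
      have h3 : m' < t := (le_max_left _ _).trans_lt ht.1
      have h4 : x₂ < t := (le_max_right _ _).trans_lt ht.1
      refine mul_pos_of_neg_of_neg ?_ ?_
      · rw [thresholdQuality_of_mem ⟨hm'.1.trans h3, ht.2⟩,
          thresholdQuality_of_notMem fun h => absurd h.2 h4.not_gt]
        exact sub_neg.2 h3
      · rw [hker t ht']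
        exact mul_neg_of_neg_of_pos (mul_neg_of_pos_of_neg (mul_pos hk0 H.f₂_pos)
          (sub_neg.2 ((H.ratio_lt_iff hc ht').2 ht.1))) (H.pos₁ t ht')
    have hright : ∀ t ∈ Ioo x₂' 1, 
        (thresholdQuality h x₁ x₂' t - thresholdQuality h x₁ x₂ t) * (g₁ t - k * h t) = 0 := by
      intro t ht
      rw [thresholdQuality_of_notMem fun h => absurd h.2 ht.1.not_gt,
        thresholdQuality_of_notMem fun h => absurd h.2 (h22.trans ht.1).not_gt, sub_self, zero_mul]
    have z0 : (0 : ℝ) ∈ Icc (0 : ℝ) 1 := left_mem_Icc.2 zero_le_one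
    have z1 : (1 : ℝ) ∈ Icc (0 : ℝ) 1 := right_mem_Icc.2 zero_le_one
    have mc := Ioo_subset_Icc_self hc
    have m2 : x₂' ∈ Icc (0 : ℝ) 1 := ⟨hc0.le.trans hcx.le, h1⟩
    rw [← integral_split hprod z0 m2 z1, ← integral_split hprod z0 mc m2,
      intervalIntegral_congr_Ioo (v := fun _ => 0) h1 hright]
    have p1 : 0 ≤ ∫ t in (0 : ℝ)..c,
        (thresholdQuality h x₁ x₂' t - thresholdQuality h x₁ x₂ t) * (g₁ t - k * h t) := by
      rw [intervalIntegral.integral_of_le hc0.le, integral_Ioc_eq_integral_Ioo]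
      exact setIntegral_nonneg measurableSet_Ioo hleft
    have p2 := intervalIntegral.intervalIntegral_pos_of_pos_on
      (intervalIntegrable_sub hprod mc m2) hmid hcx
    simp only [intervalIntegral.integral_zero, add_zero]
    exact add_pos_of_nonneg_of_pos p1 p2
  have i1 := intervalIntegrable_mul hT' hPc
  have i2 := intervalIntegrable_mul hT hPc
  simp only [sub_mul] at hkey
  rw [intervalIntegral.integral_sub i1 i2] at hkey
  have expand : ∀ {y : ℝ → ℝ}, IntervalIntegrable y volume 0 1 →
      ∫ t in (0 : ℝ)..1, y t * (g₁ t - k * h t) =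
        (∫ t in (0 : ℝ)..1, y t * g₁ t) - k * ∫ t in (0 : ℝ)..1, y t * h t := by
    intro y hy
    rw [← intervalIntegral.integral_const_mul, ← intervalIntegral.integral_sub
      (intervalIntegrable_mul hy H.cont₁) ((intervalIntegrable_mul hy H.cont).const_mul k)]
    exact intervalIntegral.integral_congr fun x _ => by ring
  rw [expand hT', expand hT] at hkey
  have : ∫ t in (0 : ℝ)..1, thresholdQuality h x₁ x₂' t * h t =
      ∫ t in (0 : ℝ)..1, thresholdQuality h x₁ x₂ t * h t := by linarith
  rw [this] at hkey
  linarith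

end IsRatioPair

end RatingDesign

/-! ### Replacing an optimal signaled quality by a threshold one -/

namespace RatingDesign

theorem integral_eq_of_eq_off {y T : ℝ → ℝ} {x₁ x₂ : ℝ}
    (h : ∀ x ∈ Ioo (0 : ℝ) 1, x ≠ x₁ → x ≠ x₂ → y x = T x) (K : ℝ → ℝ) :
    ∫ x in (0 : ℝ)..1, T x * K x = ∫ x in (0 : ℝ)..1, y x * K x := by
  rw [integral_zero_one_eq_Ioo, integral_zero_one_eq_Ioo]
  apply setIntegral_congr_ae measurableSet_Ioo
  have h1 : ∀ᵐ x : ℝ, x ≠ x₁ := by simp [ae_iff, measure_singleton]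
  have h2 : ∀ᵐ x : ℝ, x ≠ x₂ := by simp [ae_iff, measure_singleton]
  filter_upwards [h1, h2] with x hx1 hx2 hx
  rw [h x hx hx1 hx2]

theorem integral_comb {a b c K : ℝ → ℝ} (ha : IntervalIntegrable a volume 0 1)
    (hb : IntervalIntegrable b volume 0 1) (hc : IntervalIntegrable c volume 0 1)
    (hK : ContinuousOn K (Icc 0 1)) (s t r : ℝ) :
    ∫ x in (0 : ℝ)..1, (s * a x + t * b x + r * c x) * K x =
      s * (∫ x in (0 : ℝ)..1, a x * K x) + t * (∫ x in (0 : ℝ)..1, b x * K x) +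
        r * ∫ x in (0 : ℝ)..1, c x * K x := by
  have ia := (intervalIntegrable_mul ha hK).const_mul s
  have ib := (intervalIntegrable_mul hb hK).const_mul t
  have ic := (intervalIntegrable_mul hc hK).const_mul r
  rw [← intervalIntegral.integral_const_mul, ← intervalIntegral.integral_const_mul,
    ← intervalIntegral.integral_const_mul, ← intervalIntegral.integral_add ia ib,
    ← intervalIntegral.integral_add (ia.add ib) ic]
  exact intervalIntegral.integral_congr fun x _ => by ring

theorem isMajorized_comb {h a b c : ℝ → ℝ} (hh : ContinuousOn h (Icc 0 1))
    (ha : IntervalIntegrable a volume 0 1) (hb : IntervalIntegrable b volume 0 1)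
    (hc : IntervalIntegrable c volume 0 1) (ma : IsMajorized h a) (mb : IsMajorized h b)
    (mc : IsMajorized h c) {s t r : ℝ} (hs : 0 ≤ s) (ht : 0 ≤ t) (hr : 0 ≤ r)
    (hsum : s + t + r = 1) : IsMajorized h (fun x => s * a x + t * b x + r * c x) := by
  have key : ∀ x ∈ Icc (0 : ℝ) 1, ∫ u in (0 : ℝ)..x, (s * a u + t * b u + r * c u - u) * h u =
      s * (∫ u in (0 : ℝ)..x, (a u - u) * h u) + t * (∫ u in (0 : ℝ)..x, (b u - u) * h u) +
        r * ∫ u in (0 : ℝ)..x, (c u - u) * h u := by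
    intro x hx
    have z0 : (0 : ℝ) ∈ Icc (0 : ℝ) 1 := left_mem_Icc.2 zero_le_one
    have ia := (intervalIntegrable_sub (intervalIntegrable_sub_id_mul ha hh) z0 hx).const_mul s
    have ib := (intervalIntegrable_sub (intervalIntegrable_sub_id_mul hb hh) z0 hx).const_mul t
    have ic := (intervalIntegrable_sub (intervalIntegrable_sub_id_mul hc hh) z0 hx).const_mul r
    rw [← intervalIntegral.integral_const_mul, ← intervalIntegral.integral_const_mul,
      ← intervalIntegral.integral_const_mul, ← intervalIntegral.integral_add ia ib,
      ← intervalIntegral.integral_add (ia.add ib) ic]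
    refine intervalIntegral.integral_congr fun u _ => ?_
    linear_combination u * h u * hsum
  refine ⟨fun x hx => ?_, ?_⟩
  · rw [key x hx]
    exact add_nonneg (add_nonneg (mul_nonneg hs (ma.1 x hx)) (mul_nonneg ht (mb.1 x hx)))
      (mul_nonneg hr (mc.1 x hx))
  · rw [key 1 (right_mem_Icc.2 zero_le_one), ma.2, mb.2, mc.2]
    ring

theorem monotoneOn_comb {a b c : ℝ → ℝ} {S : Set ℝ} (ha : MonotoneOn a S) (hb : MonotoneOn b S)
    (hc : MonotoneOn c S) {s t r : ℝ} (hs : 0 ≤ s) (ht : 0 ≤ t) (hr : 0 ≤ r) :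
    MonotoneOn (fun x => s * a x + t * b x + r * c x) S := fun _ hx _ hy hxy =>
  add_le_add (add_le_add (mul_le_mul_of_nonneg_left (ha hx hy hxy) hs)
    (mul_le_mul_of_nonneg_left (hb hx hy hxy) ht)) (mul_le_mul_of_nonneg_left (hc hx hy hxy) hr)

/-- A point `(a₁,a₂)` to the right of `(b₁,b₂)`, below it, and to the left of `(a₁',a₂)` is a convex
combination of these two points and the origin, with a positive weight on the origin. -/
theorem exists_weights {a₁ a₂ b₁ b₂ a₁' : ℝ} (hb₁ : 0 ≤ b₁) (ha₂ : 0 ≤ a₂) (h1 : b₁ ≤ a₁)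
    (h2 : a₂ < b₂) (h3 : a₁ < a₁') :
    ∃ s t r : ℝ, 0 ≤ s ∧ 0 ≤ t ∧ 0 < r ∧ s + t + r = 1 ∧ s * a₁' + t * b₁ = a₁ ∧
      s * a₂ + t * b₂ = a₂ := by
  have hb : b₁ < a₁' := h1.trans_lt h3
  have hdet : 0 < a₁' * b₂ - a₂ * b₁ := by
    have e1 : 0 < a₁' * (b₂ - a₂) := mul_pos (hb₁.trans_lt hb) (sub_pos.2 h2)
    have e2 : 0 ≤ a₂ * (a₁' - b₁) := mul_nonneg ha₂ (sub_pos.2 hb).le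
    linarith
  -- Cramer's rule for the first two weights; the third is what is left of 1.
  refine ⟨(a₁ * b₂ - a₂ * b₁) / (a₁' * b₂ - a₂ * b₁), a₂ * (a₁' - a₁) / (a₁' * b₂ - a₂ * b₁),
    (a₁' - a₁) * (b₂ - a₂) / (a₁' * b₂ - a₂ * b₁), ?_, ?_, ?_, ?_, ?_, ?_⟩
  · refine div_nonneg ?_ hdet.le
    have e1 : 0 ≤ a₁ * (b₂ - a₂) := mul_nonneg (hb₁.trans h1) (sub_pos.2 h2).le
    have e2 : 0 ≤ a₂ * (a₁ - b₁) := mul_nonneg ha₂ (sub_nonneg.2 h1)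
    linarith
  · exact div_nonneg (mul_nonneg ha₂ (sub_pos.2 h3).le) hdet.le
  · exact div_pos (mul_pos (sub_pos.2 h3) (sub_pos.2 h2)) hdet
  · rw [← add_div, ← add_div, div_eq_one_iff_eq hdet.ne']; ring
  · rw [div_mul_eq_mul_div, div_mul_eq_mul_div, ← add_div, div_eq_iff hdet.ne']; ring
  · rw [div_mul_eq_mul_div, div_mul_eq_mul_div, ← add_div, div_eq_iff hdet.ne']; ring

theorem integral_none_mul {h K : ℝ → ℝ} (hc : ContinuousOn h (Icc 0 1))
    (hp : ∀ x ∈ Ioo (0 : ℝ) 1, 0 < h x) (hK : ContinuousOn K (Icc 0 1))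
    (hK0 : ∫ x in (0 : ℝ)..1, K x = 0) :
    ∫ x in (0 : ℝ)..1, thresholdQuality h 0 1 x * K x = 0 := by
  rw [integral_thresholdQuality_mul hc hp le_rfl zero_le_one le_rfl hK, hK0]
  simp

namespace IsRatioPair

variable {f₁ f₂ : ℝ} {g₁ g₂ K₁ K₂ : ℝ → ℝ} {φ ψ : ℝ → ℝ}

theorem integral_mul_sub_mix (H : IsRatioPair f₁ f₂ g₁ g₂) {y : ℝ → ℝ}
    (hy : IntervalIntegrable y volume 0 1) (A : ℝ) :
    ∫ x in (0 : ℝ)..1, y x * (g₁ x - A * mix f₁ f₂ g₁ g₂ x) =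
      (∫ x in (0 : ℝ)..1, y x * g₁ x) - A * ∫ x in (0 : ℝ)..1, y x * mix f₁ f₂ g₁ g₂ x := by
  rw [← intervalIntegral.integral_const_mul, ← intervalIntegral.integral_sub
    (intervalIntegrable_mul hy H.cont₁) ((intervalIntegrable_mul hy H.cont).const_mul A)]
  exact intervalIntegral.integral_congr fun x _ => by ring

theorem integral_mul_mix_eq (H : IsRatioPair f₁ f₂ g₁ g₂) {y y' : ℝ → ℝ}
    (hy : IntervalIntegrable y volume 0 1) (hm : IsMajorized (mix f₁ f₂ g₁ g₂) y)
    (hy' : IntervalIntegrable y' volume 0 1) (hm' : IsMajorized (mix f₁ f₂ g₁ g₂) y') :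
    ∫ x in (0 : ℝ)..1, y x * mix f₁ f₂ g₁ g₂ x = ∫ x in (0 : ℝ)..1, y' x * mix f₁ f₂ g₁ g₂ x := by
  have e := hm.2
  have e' := hm'.2
  rw [integral_sub_id_mul hy H.cont] at e
  rw [integral_sub_id_mul hy' H.cont] at e'
  linarith

theorem value_le_none (H : IsRatioPair f₁ f₂ g₁ g₂) {y : ℝ → ℝ} (hy : MonotoneOn y (Icc 0 1))
    (hm : IsMajorized (mix f₁ f₂ g₁ g₂) y) :
    (∫ x in (0 : ℝ)..1, y x * g₁ x ≤
      ∫ x in (0 : ℝ)..1, thresholdQuality (mix f₁ f₂ g₁ g₂) 0 1 x * g₁ x) ∧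
    (∫ x in (0 : ℝ)..1, thresholdQuality (mix f₁ f₂ g₁ g₂) 0 1 x * g₁ x ≤
      ∫ x in (0 : ℝ)..1, y x * g₁ x → ∀ x ∈ Ioo (0 : ℝ) 1, x ≠ 0 → x ≠ 1 →
        y x = thresholdQuality (mix f₁ f₂ g₁ g₂) 0 1 x) := by
  obtain ⟨A, x₃, α, hcert⟩ := H.exists_strictCertificate_none
  have hyi := intervalIntegrable_of_monotoneOn hy
  have hT := intervalIntegrable_thresholdQuality H.cont H.pos le_rfl le_rfl
  have hmT := isMajorized_thresholdQuality H.cont H.pos le_rfl zero_le_one le_rfl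
  have e := H.integral_mul_mix_eq hyi hm hT hmT
  have e1 := H.integral_mul_sub_mix hyi A
  have e2 := H.integral_mul_sub_mix hT A
  rw [e] at e1
  refine ⟨?_, fun hle => hcert.eq_thresholdQuality H.cont H.pos hy hm ?_⟩
  · have := hcert.toCertificate.integral_le H.cont H.pos hy hm
    linarith
  · linarith

theorem full_le_value (H : IsRatioPair f₁ f₂ g₁ g₂) {y : ℝ → ℝ} (hy : MonotoneOn y (Icc 0 1))
    (hm : IsMajorized (mix f₁ f₂ g₁ g₂) y) :
    (∫ x in (0 : ℝ)..1, thresholdQuality (mix f₁ f₂ g₁ g₂) (1 / 2) (1 / 2) x * g₁ x ≤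
      ∫ x in (0 : ℝ)..1, y x * g₁ x) ∧
    (∫ x in (0 : ℝ)..1, y x * g₁ x ≤
      ∫ x in (0 : ℝ)..1, thresholdQuality (mix f₁ f₂ g₁ g₂) (1 / 2) (1 / 2) x * g₁ x →
      ∀ x ∈ Ioo (0 : ℝ) 1, x ≠ 1 / 2 → x ≠ 1 / 2 →
        y x = thresholdQuality (mix f₁ f₂ g₁ g₂) (1 / 2) (1 / 2) x) := by
  obtain ⟨A, α, hcert⟩ := H.exists_strictCertificate_full
  have hyi := intervalIntegrable_of_monotoneOn hy
  have hT := intervalIntegrable_thresholdQuality (x₁ := 1 / 2) (x₂ := 1 / 2) H.cont H.pos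
    (by norm_num) (by norm_num)
  have hmT := isMajorized_thresholdQuality (x₁ := 1 / 2) (x₂ := 1 / 2) H.cont H.pos
    (by norm_num) le_rfl (by norm_num)
  have e := H.integral_mul_mix_eq hyi hm hT hmT
  have neg : ∀ {u : ℝ → ℝ}, IntervalIntegrable u volume 0 1 →
      ∫ x in (0 : ℝ)..1, u x * (A * mix f₁ f₂ g₁ g₂ x - g₁ x) =
        A * (∫ x in (0 : ℝ)..1, u x * mix f₁ f₂ g₁ g₂ x) - ∫ x in (0 : ℝ)..1, u x * g₁ x := by
    intro u hu
    have := H.integral_mul_sub_mix hu A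
    rw [← neg_sub (∫ x in (0 : ℝ)..1, u x * g₁ x), ← this, ← intervalIntegral.integral_neg]
    exact intervalIntegral.integral_congr fun x _ => by ring
  have e1 := neg hyi
  have e2 := neg hT
  rw [e] at e1
  refine ⟨?_, fun hle => hcert.eq_thresholdQuality H.cont H.pos hy hm ?_⟩
  · have := hcert.toCertificate.integral_le H.cont H.pos hy hm
    linarith
  · linarith

/-- A signaled quality that maximizes the mean under `g₁`, given its integrals against `K₁` and
`K₂`, can be replaced by a threshold signaled quality. -/
theorem exists_threshold (H : IsRatioPair f₁ f₂ g₁ g₂)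
    (hK₁ : ContinuousOn K₁ (Icc 0 1)) (hK₂ : ContinuousOn K₂ (Icc 0 1))
    (hφ : ∀ x ∈ Ioo (0 : ℝ) 1, K₁ x = φ (g₂ x / g₁ x) * g₁ x)
    (hψ : ∀ x ∈ Ioo (0 : ℝ) 1, K₂ x = ψ (g₂ x / g₁ x) * g₁ x)
    (C : IsCurved φ ψ ((fun x => g₂ x / g₁ x) '' Ioo 0 1))
    (h10 : ∫ x in (0 : ℝ)..1, K₁ x = 0) (h20 : ∫ x in (0 : ℝ)..1, K₂ x = 0)
    (hm1 : MonotoneOn (fun x => K₁ x / g₁ x) (Ioo 0 1))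
    (hm2 : MonotoneOn (fun x => K₂ x / g₂ x) (Ioo 0 1)) {y : ℝ → ℝ}
    (hy : MonotoneOn y (Icc 0 1)) (hm : IsMajorized (mix f₁ f₂ g₁ g₂) y)
    (hmax : ∀ y' : ℝ → ℝ, MonotoneOn y' (Icc 0 1) → IsMajorized (mix f₁ f₂ g₁ g₂) y' →
      ∫ x in (0 : ℝ)..1, y' x * K₁ x = ∫ x in (0 : ℝ)..1, y x * K₁ x →
      ∫ x in (0 : ℝ)..1, y' x * K₂ x = ∫ x in (0 : ℝ)..1, y x * K₂ x →
      ∫ x in (0 : ℝ)..1, y' x * g₁ x ≤ ∫ x in (0 : ℝ)..1, y x * g₁ x) :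
    ∃ x₁ x₂ : ℝ, 0 ≤ x₁ ∧ x₁ ≤ x₂ ∧ x₂ ≤ 1 ∧
      (∫ x in (0 : ℝ)..1, thresholdQuality (mix f₁ f₂ g₁ g₂) x₁ x₂ x * g₁ x =
        ∫ x in (0 : ℝ)..1, y x * g₁ x) ∧
      (∫ x in (0 : ℝ)..1, thresholdQuality (mix f₁ f₂ g₁ g₂) x₁ x₂ x * K₁ x =
        ∫ x in (0 : ℝ)..1, y x * K₁ x) ∧
      (∫ x in (0 : ℝ)..1, thresholdQuality (mix f₁ f₂ g₁ g₂) x₁ x₂ x * K₂ x =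
        ∫ x in (0 : ℝ)..1, y x * K₂ x) ∧
      (StrictMonoOn (fun z => deriv (deriv φ) z / deriv (deriv ψ) z)
          ((fun x => g₂ x / g₁ x) '' Ioo 0 1) →
        ∀ x ∈ Ioo (0 : ℝ) 1, x ≠ x₁ → x ≠ x₂ →
          y x = thresholdQuality (mix f₁ f₂ g₁ g₂) x₁ x₂ x) := by
  set h := mix f₁ f₂ g₁ g₂ with hh
  set T : ℝ → ℝ → ℝ → ℝ := thresholdQuality h with hT
  have finish : ∀ x₁ x₂ : ℝ, 0 ≤ x₁ → x₁ ≤ x₂ → x₂ ≤ 1 →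
      (∀ x ∈ Ioo (0 : ℝ) 1, x ≠ x₁ → x ≠ x₂ → y x = T x₁ x₂ x) →
      ∃ x₁ x₂ : ℝ, 0 ≤ x₁ ∧ x₁ ≤ x₂ ∧ x₂ ≤ 1 ∧
      (∫ x in (0 : ℝ)..1, T x₁ x₂ x * g₁ x = ∫ x in (0 : ℝ)..1, y x * g₁ x) ∧
      (∫ x in (0 : ℝ)..1, T x₁ x₂ x * K₁ x = ∫ x in (0 : ℝ)..1, y x * K₁ x) ∧
      (∫ x in (0 : ℝ)..1, T x₁ x₂ x * K₂ x = ∫ x in (0 : ℝ)..1, y x * K₂ x) ∧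
      (StrictMonoOn (fun z => deriv (deriv φ) z / deriv (deriv ψ) z)
          ((fun x => g₂ x / g₁ x) '' Ioo 0 1) →
        ∀ x ∈ Ioo (0 : ℝ) 1, x ≠ x₁ → x ≠ x₂ → y x = T x₁ x₂ x) :=
    fun x₁ x₂ h0 h12 h1 heq => ⟨x₁, x₂, h0, h12, h1, integral_eq_of_eq_off heq g₁,
      integral_eq_of_eq_off heq K₁, integral_eq_of_eq_off heq K₂, fun _ => heq⟩
  obtain ⟨hnone, hnone_eq⟩ := H.value_le_none hy hm
  obtain ⟨hfull, hfull_eq⟩ := H.full_le_value hy hm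
  -- At the extreme values of `∫ y g₁`, uniqueness of the maximizer or minimizer already gives `y`
  -- the threshold form.
  by_cases hw0 : ∫ x in (0 : ℝ)..1, T 0 1 x * g₁ x ≤ ∫ x in (0 : ℝ)..1, y x * g₁ x
  · exact finish 0 1 le_rfl zero_le_one le_rfl (hnone_eq hw0)
  by_cases hw1 : ∫ x in (0 : ℝ)..1, y x * g₁ x ≤ ∫ x in (0 : ℝ)..1, T (1 / 2) (1 / 2) x * g₁ x
  · exact finish (1 / 2) (1 / 2) (by norm_num) le_rfl (by norm_num) (hfull_eq hw1)
  -- Given the mean under `g₁`, a pool at the bottom maximizes the incentive `K₂`, since `ψ` is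
  -- convex, and minimizes `K₁`, since `-φ` is convex.
  have hlower : ∀ x₂ ∈ Ioo (0 : ℝ) 1,
      (∫ x in (0 : ℝ)..1, T 0 x₂ x * g₁ x) = ∫ x in (0 : ℝ)..1, y x * g₁ x →
      (∫ x in (0 : ℝ)..1, y x * K₂ x ≤ ∫ x in (0 : ℝ)..1, T 0 x₂ x * K₂ x) ∧
      (∫ x in (0 : ℝ)..1, T 0 x₂ x * K₁ x ≤ ∫ x in (0 : ℝ)..1, y x * K₁ x) ∧
      (∫ x in (0 : ℝ)..1, T 0 x₂ x * K₂ x ≤ ∫ x in (0 : ℝ)..1, y x * K₂ x →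
        ∀ x ∈ Ioo (0 : ℝ) 1, x ≠ 0 → x ≠ x₂ → y x = T 0 x₂ x) := by
    intro x₂ hx₂ hw
    obtain ⟨A, B, x₃, α, hc, hcs⟩ :=
      H.exists_certificate_lower hK₂ hψ C.strictConvexOn.convexOn hx₂
    obtain ⟨A', B', x₃', α', hc', -⟩ := H.exists_certificate_lower (K := fun x => -K₁ x) hK₁.neg
      (fun x hx => by rw [hφ x hx, neg_mul]) C.convexOn_neg hx₂
    refine ⟨H.le_of_certificate hK₂ hc hy hm hw.symm, ?_,
      H.eq_of_strictCertificate hK₂ (hcs C.strictConvexOn) hy hm hw.symm⟩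
    have := H.le_of_certificate hK₁.neg hc' hy hm hw.symm
    simp only [Pi.neg_apply, mul_neg, intervalIntegral.integral_neg] at this
    exact neg_le_neg_iff.1 this
  -- A pool at the top minimizes the incentive `K₂`, by strict concavity of `-ψ`.
  have hupper : ∀ x₁ ∈ Ioo (0 : ℝ) 1,
      (∫ x in (0 : ℝ)..1, T x₁ 1 x * g₁ x) = ∫ x in (0 : ℝ)..1, y x * g₁ x →
      (∫ x in (0 : ℝ)..1, T x₁ 1 x * K₂ x ≤ ∫ x in (0 : ℝ)..1, y x * K₂ x) ∧
      (∫ x in (0 : ℝ)..1, y x * K₂ x ≤ ∫ x in (0 : ℝ)..1, T x₁ 1 x * K₂ x →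
        ∀ x ∈ Ioo (0 : ℝ) 1, x ≠ x₁ → x ≠ 1 → y x = T x₁ 1 x) := by
    intro x₁ hx₁ hw
    obtain ⟨A, B, x₃, α, hc⟩ := H.exists_strictCertificate_upper (K := fun x => -K₂ x)
      (χ := fun z => -ψ z) hK₂.neg
      (fun x hx => by rw [hψ x hx, neg_mul]) C.strictConvexOn.neg hx₁
    have h1 := H.le_of_certificate hK₂.neg hc.toCertificate hy hm hw.symm
    have h2 := H.eq_of_strictCertificate hK₂.neg hc hy hm hw.symm
    simp only [Pi.neg_apply, mul_neg, intervalIntegral.integral_neg, neg_le_neg_iff] at h1 h2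
    exact ⟨h1, h2⟩
  have hdiag : ∀ x ∈ Icc (0 : ℝ) 1,
      ∫ t in (0 : ℝ)..1, T x x t * g₁ t < ∫ x in (0 : ℝ)..1, y x * g₁ x := by
    intro x _
    have : T x x = T (1 / 2) (1 / 2) := by
      funext t
      rw [hT, thresholdQuality_of_notMem (by simp), thresholdQuality_of_notMem (by simp)]
    rw [this]
    exact not_le.1 hw1
  obtain ⟨x₁, x₂, h0, h12, h1, hW, hA⟩ := exists_level_point
    (W := fun p => ∫ t in (0 : ℝ)..1, T p.1 p.2 t * g₁ t)
    (A := fun p => ∫ t in (0 : ℝ)..1, T p.1 p.2 t * K₂ t)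
    (w := ∫ x in (0 : ℝ)..1, y x * g₁ x) (a := ∫ x in (0 : ℝ)..1, y x * K₂ x)
    (continuousOn_thresholdValue H.cont H.pos H.cont₁)
    (continuousOn_thresholdValue H.cont H.pos hK₂)
    (fun x z z' hx hxz hzz hz => H.value_lt hx hxz hzz hz) hdiag (not_le.1 hw0)
    (fun z hz hwz => (hlower z hz hwz).1) (fun x hx hwx => (hupper x hx hwx).1)
  rcases h0.eq_or_lt with h0' | h0'
  · subst h0'
    rcases h1.eq_or_lt with h1' | h1'
    · subst h1'
      exact absurd hW.le hw0
    · exact finish 0 x₂ le_rfl h12.le h1 ((hlower x₂ ⟨h12, h1'⟩ hW).2.2 hA.le)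
  rcases h1.eq_or_lt with h1' | h1'
  · subst h1'
    exact finish x₁ 1 h0 h12.le le_rfl ((hupper x₁ ⟨h0', h12⟩ hW).2 hA.ge)
  have hx₁ : x₁ ∈ Ioo (0 : ℝ) 1 := ⟨h0', h12.trans h1'⟩
  have hx₂ : x₂ ∈ Ioo (0 : ℝ) 1 := ⟨h0'.trans h12, h1'⟩
  obtain ⟨γ, A, B, x₃, α, hc, hcs⟩ := H.exists_certificate_middle hK₁ hK₂ hφ hψ C hx₁ hx₂ h12
  have hK : ContinuousOn (fun x => K₁ x + γ * K₂ x) (Icc 0 1) := hK₁.add (hK₂.const_mul γ)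
  have hyi := intervalIntegrable_of_monotoneOn hy
  have hTi := intervalIntegrable_thresholdQuality H.cont H.pos h0 h1
  have expand : ∀ {u : ℝ → ℝ}, IntervalIntegrable u volume 0 1 →
      ∫ x in (0 : ℝ)..1, u x * (K₁ x + γ * K₂ x) =
        (∫ x in (0 : ℝ)..1, u x * K₁ x) + γ * ∫ x in (0 : ℝ)..1, u x * K₂ x := by
    intro u hu
    rw [← intervalIntegral.integral_const_mul, ← intervalIntegral.integral_add
      (intervalIntegrable_mul hu hK₁) ((intervalIntegrable_mul hu hK₂).const_mul γ)]
    exact intervalIntegral.integral_congr fun x _ => by ring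
  -- The certificate compares `K₁ + γ K₂`; the sign of `γ` is irrelevant since the two integrals
  -- against `K₂` agree.
  have hle : ∫ x in (0 : ℝ)..1, y x * K₁ x ≤ ∫ x in (0 : ℝ)..1, T x₁ x₂ x * K₁ x := by
    have := H.le_of_certificate hK hc hy hm hW.symm
    rw [expand hyi, expand hTi, hA] at this
    linarith
  rcases hle.eq_or_lt with heq | hlt
  · refine ⟨x₁, x₂, h0, h12.le, h1, hW, heq.symm, hA, fun hs => ?_⟩
    refine H.eq_of_strictCertificate hK (hcs hs) hy hm hW.symm ?_
    rw [expand hyi, expand hTi, hA, heq]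
  have hcont0 : ContinuousOn (fun z => ∫ t in (0 : ℝ)..1, T 0 z t * g₁ t) (Icc 0 1) :=
    (continuousOn_thresholdValue H.cont H.pos H.cont₁).comp
      (f := fun z : ℝ => ((0 : ℝ), z)) (by fun_prop) fun z hz => ⟨le_rfl, hz.1, hz.2⟩
  obtain ⟨z, hz, hzw⟩ := intermediate_value_Icc zero_le_one hcont0
    ⟨(hdiag 0 (left_mem_Icc.2 zero_le_one)).le, (not_le.1 hw0).le⟩
  beta_reduce at hzw
  have hz0 : 0 < z := by
    rcases hz.1.eq_or_lt with h' | h'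
    · rw [← h'] at hzw
      exact absurd hzw (hdiag 0 (left_mem_Icc.2 zero_le_one)).ne
    · exact h'
  have hz1 : z < 1 := by
    rcases hz.2.eq_or_lt with h' | h'
    · rw [h'] at hzw
      exact absurd hzw.le hw0
    · exact h'
  obtain ⟨l1, l2, l3⟩ := hlower z ⟨hz0, hz1⟩ hzw
  rcases l1.eq_or_lt with l1 | l1
  · exact finish 0 z le_rfl hz.1 hz.2 (l3 l1.ge)
  -- In the plane of incentives `(∫ · K₁, ∫ · K₂)`, the threshold quality lies strictly right of `y`
  -- at the same height, `T 0 z` lies weakly left and strictly above, and full pooling is the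
  -- origin. A convex combination of the three has the incentives of `y`; its mean under `g₁` is
  -- higher, because full pooling strictly beats `y` and has weight `r > 0`.
  exfalso
  have hLm : Monotone (T 0 z) := monotone_thresholdQuality H.cont H.pos le_rfl hz.2
  have hTm : Monotone (T x₁ x₂) := monotone_thresholdQuality H.cont H.pos h0 h1
  have hOm : Monotone (T 0 1) := monotone_thresholdQuality H.cont H.pos le_rfl le_rfl
  obtain ⟨s, t, r, hs, ht, hr, hsum, e1, e2⟩ := exists_weights
    (integral_nonneg_of_mlr H.pos₁ hK₁ hm1 h10 (hLm.monotoneOn _))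
    (integral_nonneg_of_mlr H.pos₂ hK₂ hm2 h20 hy) l2 l1 hlt
  have mT := isMajorized_thresholdQuality H.cont H.pos h0 h12.le h1
  have mL := isMajorized_thresholdQuality H.cont H.pos le_rfl hz.1 hz.2
  have mO := isMajorized_thresholdQuality H.cont H.pos le_rfl zero_le_one le_rfl
  have iT := hTm.intervalIntegrable (μ := volume) (a := 0) (b := 1)
  have iL := hLm.intervalIntegrable (μ := volume) (a := 0) (b := 1)
  have iO := hOm.intervalIntegrable (μ := volume) (a := 0) (b := 1)
  have hO1 : ∫ x in (0 : ℝ)..1, T 0 1 x * K₁ x = 0 := integral_none_mul H.cont H.pos hK₁ h10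
  have hO2 : ∫ x in (0 : ℝ)..1, T 0 1 x * K₂ x = 0 := integral_none_mul H.cont H.pos hK₂ h20
  have := hmax (fun x => s * T x₁ x₂ x + t * T 0 z x + r * T 0 1 x)
    (monotoneOn_comb (hTm.monotoneOn _) (hLm.monotoneOn _) (hOm.monotoneOn _) hs ht hr.le)
    (isMajorized_comb H.cont iT iL iO mT mL mO hs ht hr.le hsum)
    (by rw [integral_comb iT iL iO hK₁, hO1, mul_zero, add_zero, e1])
    (by rw [integral_comb iT iL iO hK₂, hO2, mul_zero, add_zero, hA, e2])
  rw [integral_comb iT iL iO H.cont₁, hW, hzw] at this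
  have hlt0 := mul_pos hr (sub_pos.2 (not_le.1 hw0))
  have hs' : s * (∫ x in (0 : ℝ)..1, y x * g₁ x) + t * (∫ x in (0 : ℝ)..1, y x * g₁ x) =
      (1 - r) * ∫ x in (0 : ℝ)..1, y x * g₁ x := by
    rw [← hsum]
    ring
  linarith

end IsRatioPair

end RatingDesign

/-! ### Consequences of the model's assumptions; optimal threshold qualities -/

namespace RatingDesign

namespace OutcomeAssumption

variable {g : ℝ → ℝ → ℝ} {q q₁ q₂ : ℝ}

theorem continuousOn_left (hg : OutcomeAssumption g) (hq : q ∈ Ioo (0 : ℝ) 1) :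
    ContinuousOn (fun x => g x q) (Icc 0 1) :=
  hg.contDiff.continuousOn.comp (f := fun x : ℝ => (x, q)) (by fun_prop) fun _ hx => ⟨hx, hq⟩

/-- The domain is open in `q`, so the derivative within it along `q` is an ordinary one, even at `x
= 0` and `x = 1`. This transfers the continuity of the total derivative to `gq`. -/
theorem hasDerivAt_fderivWithin (hg : OutcomeAssumption g) {x : ℝ} (hx : x ∈ Icc (0 : ℝ) 1)
    (hq : q ∈ Ioo (0 : ℝ) 1) :
    HasDerivAt (fun q' => g x q')
      (fderivWithin ℝ (fun p : ℝ × ℝ => g p.1 p.2) (Icc (0 : ℝ) 1 ×ˢ Ioo (0 : ℝ) 1) (x, q) (0, 1))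
      q := by
  have hd := (hg.contDiff.differentiableOn one_ne_zero (x, q) ⟨hx, hq⟩).hasFDerivWithinAt
  have hc : HasDerivWithinAt (fun q' : ℝ => (x, q')) ((0 : ℝ), (1 : ℝ)) (Ioo 0 1) q :=
    (hasDerivWithinAt_const q _ x).prodMk (hasDerivWithinAt_id q _)
  exact (hd.comp_hasDerivWithinAt q hc fun _ hq' => ⟨hx, hq'⟩).hasDerivAt (isOpen_Ioo.mem_nhds hq)

theorem hasDerivAt (hg : OutcomeAssumption g) {x : ℝ} (hx : x ∈ Icc (0 : ℝ) 1)
    (hq : q ∈ Ioo (0 : ℝ) 1) : HasDerivAt (fun q' => g x q') (gq g x q) q :=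
  (hg.hasDerivAt_fderivWithin hx hq).differentiableAt.hasDerivAt

theorem continuousOn_gq (hg : OutcomeAssumption g) :
    ContinuousOn (fun p : ℝ × ℝ => gq g p.1 p.2) (Icc (0 : ℝ) 1 ×ˢ Ioo (0 : ℝ) 1) := by
  have hu : UniqueDiffOn ℝ (Icc (0 : ℝ) 1 ×ˢ Ioo (0 : ℝ) 1) :=
    (uniqueDiffOn_Icc zero_lt_one).prod isOpen_Ioo.uniqueDiffOn
  have := (hg.contDiff.continuousOn_fderivWithin hu le_rfl).clm_apply
    (continuousOn_const (c := ((0 : ℝ), (1 : ℝ))))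
  exact this.congr fun p hp => (hg.hasDerivAt_fderivWithin hp.1 hp.2).deriv

theorem continuousOn_gq_left (hg : OutcomeAssumption g) (hq : q ∈ Ioo (0 : ℝ) 1) :
    ContinuousOn (fun x => gq g x q) (Icc 0 1) :=
  hg.continuousOn_gq.comp (f := fun x : ℝ => (x, q)) (by fun_prop) fun _ hx => ⟨hx, hq⟩

theorem hasDerivAt_integral (hg : OutcomeAssumption g) (hq : q ∈ Ioo (0 : ℝ) 1) {K : ℝ → ℝ}
    (hK : ContinuousOn K (Icc 0 1)) :
    HasDerivAt (fun q' => ∫ x in (0 : ℝ)..1, K x * g x q')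
      (∫ x in (0 : ℝ)..1, K x * gq g x q) q := by
  -- On the compact rectangle over `[q/2, (q+1)/2]` the continuous integrand is bounded by a
  -- constant, which justifies differentiating under the integral.
  set a := q / 2 with ha
  set b := (q + 1) / 2 with hb
  have hab : Icc a b ⊆ Ioo (0 : ℝ) 1 := fun t ht =>
    ⟨by linarith [ht.1, hq.1], by linarith [ht.2, hq.2]⟩
  have hs : Icc a b ∈ nhds q := Icc_mem_nhds (by linarith [hq.1]) (by linarith [hq.2])
  have hcont : ContinuousOn (fun p : ℝ × ℝ => K p.1 * gq g p.1 p.2) (Icc (0 : ℝ) 1 ×ˢ Icc a b) :=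
    (hK.comp continuousOn_fst fun p hp => hp.1).mul
      (hg.continuousOn_gq.mono (prod_mono_right hab))
  obtain ⟨M, hM⟩ := (isCompact_Icc.prod isCompact_Icc).exists_bound_of_continuousOn hcont
  have hcg : ∀ q' ∈ Ioo (0 : ℝ) 1, ContinuousOn (fun x => K x * g x q') (uIcc 0 1) := by
    intro q' hq'
    rw [uIcc_of_le zero_le_one]
    exact hK.mul (hg.continuousOn_left hq')
  have hcq : ContinuousOn (fun x => K x * gq g x q) (uIcc 0 1) := by
    rw [uIcc_of_le zero_le_one]
    exact hK.mul (hg.continuousOn_gq_left hq)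
  have hsub : ∀ t ∈ uIoc (0 : ℝ) 1, t ∈ Icc (0 : ℝ) 1 := fun t ht => by
    rw [uIoc_of_le zero_le_one] at ht
    exact Ioc_subset_Icc_self ht
  refine (intervalIntegral.hasDerivAt_integral_of_dominated_loc_of_deriv_le
    (F := fun q' x => K x * g x q') (F' := fun q' x => K x * gq g x q') (bound := fun _ => M)
    hs ?_ (hcg q hq).intervalIntegrable ?_ ?_ (by simp) ?_).2
  · filter_upwards [isOpen_Ioo.mem_nhds hq] with q' hq'
    exact (intervalIntegrable_iff.1 (hcg q' hq').intervalIntegrable).aestronglyMeasurable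
  · exact (intervalIntegrable_iff.1 hcq.intervalIntegrable).aestronglyMeasurable
  · filter_upwards with t ht q' hq'
    exact hM (t, q') ⟨hsub t ht, hq'⟩
  · filter_upwards with t ht q' hq'
    exact (hg.hasDerivAt (hsub t ht) (hab hq')).const_mul (K t)

theorem integral_gq (hg : OutcomeAssumption g) (hq : q ∈ Ioo (0 : ℝ) 1) :
    ∫ x in (0 : ℝ)..1, gq g x q = 0 := by
  have h := hg.hasDerivAt_integral hq (K := fun _ => 1) continuousOn_const
  simp only [one_mul] at h
  refine h.unique ((hasDerivAt_const q (1 : ℝ)).congr_of_eventuallyEq ?_)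
  filter_upwards [isOpen_Ioo.mem_nhds hq] with q' hq' using hg.mass q' hq'

theorem integral_id_mul_gq (hg : OutcomeAssumption g) (hq : q ∈ Ioo (0 : ℝ) 1) :
    ∫ x in (0 : ℝ)..1, x * gq g x q = 1 := by
  have h := hg.hasDerivAt_integral hq (K := fun x => x) continuousOn_id
  refine h.unique ((hasDerivAt_id q).congr_of_eventuallyEq ?_)
  filter_upwards [isOpen_Ioo.mem_nhds hq] with q' hq' using hg.mean q' hq'

/-- For `x < x'`, the derivative in `t` of `g(x'|t)/g(x|t)` has the sign of the difference of
`g_q/g` at `x'` and `x`, positive by assumption. Comparing `t = q₁` with `t = q₂` and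
cross-multiplying gives the claim. -/
theorem strictMonoOn_likelihoodRatio (hg : OutcomeAssumption g) (hq₁ : q₁ ∈ Ioo (0 : ℝ) 1)
    (hq₂ : q₂ ∈ Ioo (0 : ℝ) 1) (h12 : q₁ < q₂) :
    StrictMonoOn (likelihoodRatio g q₁ q₂) (Ioo 0 1) := by
  intro x hx x' hx' hxx
  have hsub : Icc q₁ q₂ ⊆ Ioo (0 : ℝ) 1 := fun t ht =>
    ⟨hq₁.1.trans_le ht.1, ht.2.trans_lt hq₂.2⟩
  have hd : ∀ t ∈ Icc q₁ q₂, HasDerivAt (fun t => g x' t / g x t)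
      ((gq g x' t * g x t - g x' t * gq g x t) / g x t ^ 2) t := fun t ht =>
    (hg.hasDerivAt (Ioo_subset_Icc_self hx') (hsub ht)).div
      (hg.hasDerivAt (Ioo_subset_Icc_self hx) (hsub ht)) (hg.pos t (hsub ht) x hx).ne'
  have hmono : StrictMonoOn (fun t => g x' t / g x t) (Icc q₁ q₂) := by
    refine strictMonoOn_of_deriv_pos (convex_Icc q₁ q₂)
      (fun t ht => (hd t ht).continuousAt.continuousWithinAt) fun t ht => ?_
    rw [interior_Icc] at ht
    have ht' := Ioo_subset_Icc_self ht
    rw [(hd t ht').deriv]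
    have p := hg.pos t (hsub ht') x hx
    have p' := hg.pos t (hsub ht') x' hx'
    have := hg.mlrp t (hsub ht') hx hx' hxx
    simp only at this
    rw [div_lt_div_iff₀ p p'] at this
    exact div_pos (by linarith) (pow_pos p 2)
  have := hmono (left_mem_Icc.2 h12.le) (right_mem_Icc.2 h12.le) h12
  simp only at this
  rw [div_lt_div_iff₀ (hg.pos q₁ hq₁ x hx) (hg.pos q₂ hq₂ x hx)] at this
  rw [likelihoodRatio, likelihoodRatio, div_lt_div_iff₀ (hg.pos q₁ hq₁ x hx)
    (hg.pos q₁ hq₁ x' hx')]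
  linarith

theorem xhat_likelihoodRatio (hg : OutcomeAssumption g) (hq₁ : q₁ ∈ Ioo (0 : ℝ) 1)
    (hq₂ : q₂ ∈ Ioo (0 : ℝ) 1) (h12 : q₁ < q₂) {x : ℝ} (hx : x ∈ Ioo (0 : ℝ) 1) :
    xhat g q₁ q₂ (g x q₂ / g x q₁) = x :=
  (hg.strictMonoOn_likelihoodRatio hq₁ hq₂ h12).injOn.leftInvOn_invFunOn hx

theorem gq_eq_phi (hg : OutcomeAssumption g) (hq₁ : q₁ ∈ Ioo (0 : ℝ) 1)
    (hq₂ : q₂ ∈ Ioo (0 : ℝ) 1) (h12 : q₁ < q₂) {x : ℝ} (hx : x ∈ Ioo (0 : ℝ) 1) :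
    gq g x q₁ = phi g q₁ q₂ (g x q₂ / g x q₁) * g x q₁ := by
  rw [phi, hg.xhat_likelihoodRatio hq₁ hq₂ h12 hx, div_mul_cancel₀ _ (hg.pos q₁ hq₁ x hx).ne']

theorem gq_eq_psi (hg : OutcomeAssumption g) (hq₁ : q₁ ∈ Ioo (0 : ℝ) 1)
    (hq₂ : q₂ ∈ Ioo (0 : ℝ) 1) (h12 : q₁ < q₂) {x : ℝ} (hx : x ∈ Ioo (0 : ℝ) 1) :
    gq g x q₂ = psi g q₁ q₂ (g x q₂ / g x q₁) * g x q₁ := by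
  have h1 := (hg.pos q₁ hq₁ x hx).ne'
  have h2 := (hg.pos q₂ hq₂ x hx).ne'
  rw [psi, hg.xhat_likelihoodRatio hq₁ hq₂ h12 hx]
  field_simp

theorem isRatioPair (hg : OutcomeAssumption g) (hq₁ : q₁ ∈ Ioo (0 : ℝ) 1)
    (hq₂ : q₂ ∈ Ioo (0 : ℝ) 1) (h12 : q₁ < q₂) {f₁ f₂ : ℝ} (hf₁ : 0 < f₁) (hf₂ : 0 < f₂) :
    IsRatioPair f₁ f₂ (fun x => g x q₁) (fun x => g x q₂) where
  f₁_pos := hf₁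
  f₂_pos := hf₂
  cont₁ := hg.continuousOn_left hq₁
  cont₂ := hg.continuousOn_left hq₂
  pos₁ := hg.pos q₁ hq₁
  pos₂ := hg.pos q₂ hq₂
  strictMono := hg.strictMonoOn_likelihoodRatio hq₁ hq₂ h12

end OutcomeAssumption

theorem CurvatureAssumption.isCurved {g : ℝ → ℝ → ℝ} (hcurv : CurvatureAssumption g)
    (hg : OutcomeAssumption g) {q₁ q₂ : ℝ} (hq₁ : q₁ ∈ Ioo (0 : ℝ) 1)
    (hq₂ : q₂ ∈ Ioo (0 : ℝ) 1) (h12 : q₁ < q₂) :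
    IsCurved (phi g q₁ q₂) (psi g q₁ q₂) (ratioRange g q₁ q₂) where
  isOpen := (hg.isRatioPair hq₁ hq₂ h12 zero_lt_one zero_lt_one).isOpen_range
  convex := (hg.isRatioPair hq₁ hq₂ h12 zero_lt_one zero_lt_one).convex_range
  diffφ := (hcurv.diff_phi q₁ hq₁ q₂ hq₂ h12).1
  diffφ' := (hcurv.diff_phi q₁ hq₁ q₂ hq₂ h12).2
  diffψ := (hcurv.diff_psi q₁ hq₁ q₂ hq₂ h12).1
  diffψ' := (hcurv.diff_psi q₁ hq₁ q₂ hq₂ h12).2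
  nonpos := hcurv.phi_concave q₁ hq₁ q₂ hq₂ h12
  pos := fun z hz => (hcurv.psi_convex q₁ hq₁ q₂ hq₂ h12 z hz).lt_of_ne
    (hcurv.psi_ne q₁ hq₁ q₂ hq₂ h12 z hz).symm
  mono := hcurv.ratio_mono q₁ hq₁ q₂ hq₂ h12

section Model

variable {g C : ℝ → ℝ → ℝ} {θ f q : Fin 2 → ℝ} {xbar y : ℝ → ℝ}

theorem outcomeDensity_eq_mix (g : ℝ → ℝ → ℝ) (f q : Fin 2 → ℝ) :
    outcomeDensity g f q = mix (f 0) (f 1) (fun x => g x (q 0)) (fun x => g x (q 1)) := by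
  funext x
  simp only [outcomeDensity, mix, Fin.sum_univ_two]

theorem continuousOn_outcomeDensity (hg : OutcomeAssumption g)
    (hq : ∀ i, q i ∈ Ioo (0 : ℝ) 1) : ContinuousOn (outcomeDensity g f q) (Icc 0 1) := by
  rw [outcomeDensity_eq_mix]
  exact ((hg.continuousOn_left (hq 0)).const_mul _).add ((hg.continuousOn_left (hq 1)).const_mul _)

theorem outcomeDensity_pos (hg : OutcomeAssumption g) (hf : ∀ i, 0 < f i)
    (hq : ∀ i, q i ∈ Ioo (0 : ℝ) 1) : ∀ x ∈ Ioo (0 : ℝ) 1, 0 < outcomeDensity g f q x := by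
  intro x hx
  rw [outcomeDensity_eq_mix]
  exact add_pos (mul_pos (hf 0) (hg.pos _ (hq 0) x hx)) (mul_pos (hf 1) (hg.pos _ (hq 1) x hx))

theorem welfare_low (g C : ℝ → ℝ → ℝ) (θ f q : Fin 2 → ℝ) (xbar : ℝ → ℝ) :
    welfare g C θ f ![1, 0] q xbar = sellerPayoff g C xbar (q 0) (θ 0) * f 0 := by
  simp [welfare, Fin.sum_univ_two]

/-- A feasible signaled quality that gives the low type the same mean as an optimal one is
optimal. -/
theorem IsOptimal.congr (hopt : IsOptimal g C θ f ![1, 0] q xbar)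
    (hy : MonotoneOn y (Icc 0 1)) (hm : IsMajorized (outcomeDensity g f q) y)
    (h0 : ∫ x in (0 : ℝ)..1, y x * g x (q 0) = ∫ x in (0 : ℝ)..1, xbar x * g x (q 0))
    (hi : ∀ i, ∫ x in (0 : ℝ)..1, y x * gq g x (q i) = ∫ x in (0 : ℝ)..1, xbar x * gq g x (q i)) :
    IsOptimal g C θ f ![1, 0] q y := by
  refine ⟨⟨hopt.1.quality, fun i => by rw [hi, hopt.1.incentive i], hy, hm⟩, fun q' y' hf' => ?_⟩
  refine (hopt.2 q' y' hf').trans (le_of_eq ?_)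
  rw [welfare_low, welfare_low, sellerPayoff, sellerPayoff, h0]

/-- With the qualities and incentives kept, costs cancel and optimality becomes a linear
maximization in the signaled quality. -/
theorem IsOptimal.integral_le (hopt : IsOptimal g C θ f ![1, 0] q xbar) (hf : 0 < f 0)
    (hy : MonotoneOn y (Icc 0 1)) (hm : IsMajorized (outcomeDensity g f q) y)
    (hi : ∀ i, ∫ x in (0 : ℝ)..1, y x * gq g x (q i) = ∫ x in (0 : ℝ)..1, xbar x * gq g x (q i)) :
    ∫ x in (0 : ℝ)..1, y x * g x (q 0) ≤ ∫ x in (0 : ℝ)..1, xbar x * g x (q 0) := by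
  have := hopt.2 q y ⟨hopt.1.quality, fun i => by rw [hi, hopt.1.incentive i], hy, hm⟩
  rw [welfare_low, welfare_low, sellerPayoff, sellerPayoff, mul_le_mul_iff_left₀ hf] at this
  linarith

theorem exists_optimal_threshold_of_lt (hf : ∀ i, 0 < f i) (hg : OutcomeAssumption g)
    (hcurv : CurvatureAssumption g) (hopt : IsOptimal g C θ f ![1, 0] q xbar) (hq : q 0 < q 1) :
    ∃ x₁ x₂ : ℝ, 0 ≤ x₁ ∧ x₁ ≤ x₂ ∧ x₂ ≤ 1 ∧
      IsOptimal g C θ f ![1, 0] q (thresholdQuality (outcomeDensity g f q) x₁ x₂) ∧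
      (StrictMonoOn (curvatureRatio g (q 0) (q 1)) (ratioRange g (q 0) (q 1)) →
        ∀ x ∈ Ioo (0 : ℝ) 1, x ≠ x₁ → x ≠ x₂ →
          xbar x = thresholdQuality (outcomeDensity g f q) x₁ x₂ x) := by
  have h0 := hopt.1.quality 0
  have h1 := hopt.1.quality 1
  have H := hg.isRatioPair h0 h1 hq (hf 0) (hf 1)
  have hmaj := hopt.1.majorized
  have hmax : ∀ y : ℝ → ℝ, MonotoneOn y (Icc 0 1) → IsMajorized (outcomeDensity g f q) y →
      ∫ x in (0 : ℝ)..1, y x * gq g x (q 0) = ∫ x in (0 : ℝ)..1, xbar x * gq g x (q 0) →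
      ∫ x in (0 : ℝ)..1, y x * gq g x (q 1) = ∫ x in (0 : ℝ)..1, xbar x * gq g x (q 1) →
      ∫ x in (0 : ℝ)..1, y x * g x (q 0) ≤ ∫ x in (0 : ℝ)..1, xbar x * g x (q 0) :=
    fun y hy hm e0 e1 => hopt.integral_le (hf 0) hy hm (Fin.forall_fin_two.2 ⟨e0, e1⟩)
  rw [outcomeDensity_eq_mix] at hmaj hmax
  obtain ⟨x₁, x₂, hx0, hx12, hx1, e, e0, e1, hs⟩ := H.exists_threshold
    (hg.continuousOn_gq_left h0) (hg.continuousOn_gq_left h1)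
    (fun x hx => hg.gq_eq_phi h0 h1 hq hx) (fun x hx => hg.gq_eq_psi h0 h1 hq hx)
    (hcurv.isCurved hg h0 h1 hq) (hg.integral_gq h0) (hg.integral_gq h1)
    (hg.mlrp _ h0).monotoneOn (hg.mlrp _ h1).monotoneOn hopt.1.mono hmaj hmax
  rw [← outcomeDensity_eq_mix] at e e0 e1 hs
  have hc := continuousOn_outcomeDensity (f := f) hg hopt.1.quality
  have hp := outcomeDensity_pos hg hf hopt.1.quality
  exact ⟨x₁, x₂, hx0, hx12, hx1, hopt.congr
    ((monotone_thresholdQuality hc hp hx0 hx1).monotoneOn _)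
    (isMajorized_thresholdQuality hc hp hx0 hx12 hx1) e (Fin.forall_fin_two.2 ⟨e0, e1⟩), hs⟩

theorem thresholdQuality_self (h : ℝ → ℝ) (x : ℝ) : thresholdQuality h x x = fun t => t := by
  funext t
  exact thresholdQuality_of_notMem (by simp)

theorem integral_id_threshold_gq (hg : OutcomeAssumption g) {p : ℝ} (hp : p ∈ Ioo (0 : ℝ) 1)
    (h : ℝ → ℝ) (x : ℝ) : ∫ t in (0 : ℝ)..1, thresholdQuality h x x t * gq g t p = 1 := by
  rw [thresholdQuality_self]
  exact hg.integral_id_mul_gq hp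

/-- Here `h` is the common density, so majorization fixes the low type's mean and only one incentive
is to be matched. It lies in `[0,1]`, and pools `(0,z)` sweep out that range from full revelation to
full pooling. -/
theorem exists_optimal_threshold_of_eq (hf : ∀ i, 0 < f i) (hf1 : ∑ i, f i = 1)
    (hg : OutcomeAssumption g) (hopt : IsOptimal g C θ f ![1, 0] q xbar) (hq : q 0 = q 1) :
    ∃ x₁ x₂ : ℝ, 0 ≤ x₁ ∧ x₁ ≤ x₂ ∧ x₂ ≤ 1 ∧
      IsOptimal g C θ f ![1, 0] q (thresholdQuality (outcomeDensity g f q) x₁ x₂) := by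
  have h0 := hopt.1.quality 0
  have hc := continuousOn_outcomeDensity (f := f) hg hopt.1.quality
  have hp := outcomeDensity_pos hg hf hopt.1.quality
  have hmaj := hopt.1.majorized
  have hy := hopt.1.mono
  have hh : outcomeDensity g f q = fun x => g x (q 0) := by
    funext x
    rw [Fin.sum_univ_two] at hf1
    rw [outcomeDensity_eq_mix, mix, ← hq, ← add_mul, hf1, one_mul]
  have hK := hg.continuousOn_gq_left h0
  have hyi := intervalIntegrable_of_monotoneOn hy
  have hlow : 0 ≤ ∫ x in (0 : ℝ)..1, xbar x * gq g x (q 0) :=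
    integral_nonneg_of_mlr (hg.pos _ h0) hK (hg.mlrp _ h0).monotoneOn (hg.integral_gq h0) hy
  have hup : ∫ x in (0 : ℝ)..1, xbar x * gq g x (q 0) ≤ 1 := by
    -- The increasing score `gq / g` integrates the distortion `(xbar - x) h` to a nonpositive
    -- number, so `xbar` gives no more incentive than full revelation, whose incentive is 1.
    have hprod := intervalIntegrable_sub_id_mul hyi hK
    have e : ∀ x ∈ Ioo (0 : ℝ) 1, (xbar x - x) * gq g x (q 0) =
        gq g x (q 0) / g x (q 0) * ((xbar x - x) * outcomeDensity g f q x) := by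
      intro x hx
      have := (hg.pos _ h0 x hx).ne'
      rw [hh]
      field_simp
    have m : (1 / 2 : ℝ) ∈ Ioo (0 : ℝ) 1 := by norm_num
    have := integral_mul_le (c := 0) (intervalIntegrable_sub_id_mul hyi hc) hmaj.1 hmaj.2
      (hg.mlrp _ h0).monotoneOn (intervalIntegrable_congr_Ioo e hprod) m m le_rfl
      fun x hx => hmaj.1 x ⟨m.1.le.trans hx.1, hx.2.trans m.2.le⟩
    rw [← integral_congr_Ioo e, integral_sub_id_mul hyi hK, hg.integral_id_mul_gq h0] at this
    simpa using this
  have hcont : ContinuousOn (fun z => ∫ t in (0 : ℝ)..1,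
      thresholdQuality (outcomeDensity g f q) 0 z t * gq g t (q 0)) (Icc 0 1) :=
    (continuousOn_thresholdValue hc hp hK).comp
      (f := fun z : ℝ => ((0 : ℝ), z)) (by fun_prop) fun z hz => ⟨le_rfl, hz.1, hz.2⟩
  obtain ⟨z, hz, hzw⟩ := intermediate_value_Icc' zero_le_one hcont
    (show ∫ x in (0 : ℝ)..1, xbar x * gq g x (q 0) ∈ _ by
      rw [integral_none_mul hc hp hK (hg.integral_gq h0), integral_id_threshold_gq hg h0]
      exact ⟨hlow, hup⟩)
  have hT := (monotone_thresholdQuality hc hp le_rfl hz.2).monotoneOn (Icc 0 1)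
  have hmT := isMajorized_thresholdQuality hc hp le_rfl hz.1 hz.2
  refine ⟨0, z, le_rfl, hz.1, hz.2, hopt.congr hT hmT ?_
    (Fin.forall_fin_two.2 ⟨hzw, by rw [← hq]; exact hzw⟩)⟩
  have e1 := hmT.2
  have e2 := hmaj.2
  rw [integral_sub_id_mul (intervalIntegrable_of_monotoneOn hT) hc] at e1
  rw [integral_sub_id_mul hyi hc] at e2
  rw [hh] at e1 e2 ⊢
  linarith

end Model

end RatingDesign

/-! ### Full revelation is not optimal -/

namespace RatingDesign

namespace CostAssumption

variable {C : ℝ → ℝ → ℝ} {Θ : Set ℝ} {t p : ℝ}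

theorem monotoneOn_Cq (hC : CostAssumption C Θ) (ht : t ∈ Θ) :
    MonotoneOn (fun q => Cq C q t) (Icc 0 1) := by
  have hd := hC.diff_Cq t ht
  refine monotoneOn_of_deriv_nonneg (convex_Icc 0 1) hd.continuousOn
    (hd.mono interior_subset) fun x hx => ?_
  rw [interior_Icc] at hx
  rw [← derivWithin_of_mem_nhds (Icc_mem_nhds hx.1 hx.2)]
  exact hC.Cqq_nonneg t ht x (Ioo_subset_Icc_self hx)

/-- If the increasing `Cq` took equal values at `r` and `p`, it would be constant on `[r,p]` and its
left derivative at `p` would be 0. -/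
theorem Cq_lt_of_Cqq_pos (hC : CostAssumption C Θ) (ht : t ∈ Θ) {r : ℝ} (hr : 0 ≤ r) (hrp : r < p)
    (hp : p ≤ 1) (hpos : 0 < Cqq C p t) : Cq C r t < Cq C p t := by
  have hm := hC.monotoneOn_Cq ht
  have mr : r ∈ Icc (0 : ℝ) 1 := ⟨hr, hrp.le.trans hp⟩
  have mp : p ∈ Icc (0 : ℝ) 1 := ⟨hr.trans hrp.le, hp⟩
  refine (hm mr mp hrp.le).lt_of_ne fun e => hpos.ne' ?_
  have hsub : Icc r p ⊆ Icc (0 : ℝ) 1 := Icc_subset_Icc hr hp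
  have h1 : HasDerivWithinAt (fun q => Cq C q t) (Cqq C p t) (Icc r p) p :=
    (hC.diff_Cq t ht p mp).hasDerivWithinAt.mono hsub
  have h2 : HasDerivWithinAt (fun q => Cq C q t) 0 (Icc r p) p :=
    (hasDerivWithinAt_const p _ (Cq C p t)).congr
      (fun s hs => le_antisymm (hm (hsub hs) mp hs.2) (e.ge.trans (hm mr (hsub hs) hs.1))) rfl
  exact (uniqueDiffOn_Icc hrp p (right_mem_Icc.2 hrp.le)).eq_deriv _ h1 h2

theorem mul_sub_le_cost_sub (hC : CostAssumption C Θ) (ht : t ∈ Θ) {r c : ℝ} (hr : 0 ≤ r)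
    (hrp : r ≤ p) (hp : p ≤ 1) (hc : c ≤ Cq C r t) : c * (p - r) ≤ C p t - C r t := by
  have hsub : Icc r p ⊆ Icc (0 : ℝ) 1 := Icc_subset_Icc hr hp
  have hd := (hC.diff t ht).mono hsub
  refine (convex_Icc r p).mul_sub_le_image_sub_of_le_deriv hd.continuousOn
    (hd.mono interior_subset) (fun x hx => ?_) r (left_mem_Icc.2 hrp) p (right_mem_Icc.2 hrp) hrp
  rw [interior_Icc] at hx
  rw [← derivWithin_of_mem_nhds (Icc_mem_nhds (hr.trans_lt hx.1) (hx.2.trans_le hp))]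
  exact hc.trans (hC.monotoneOn_Cq ht ⟨hr, hrp.trans hp⟩ (hsub (Ioo_subset_Icc_self hx)) hx.1.le)

/-- Marginal costs just below `Cq C p t` are attained close to `p`. -/
theorem exists_Cq_eq (hC : CostAssumption C Θ) (ht : t ∈ Θ) {r c : ℝ} (hr : 0 ≤ r) (hrp : r ≤ p)
    (hp : p ≤ 1) (hc : c ∈ Icc (Cq C r t) (Cq C p t)) : ∃ s ∈ Icc r p, Cq C s t = c :=
  intermediate_value_Icc hrp ((hC.diff_Cq t ht).continuousOn.mono (Icc_subset_Icc hr hp)) hc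

end CostAssumption

section Model

variable {g C : ℝ → ℝ → ℝ} {θ f q : Fin 2 → ℝ}

theorem poolMean_outcomeDensity (hg : OutcomeAssumption g) (hf1 : ∑ i, f i = 1)
    (hq : ∀ i, q i ∈ Ioo (0 : ℝ) 1) :
    poolMean (outcomeDensity g f q) 0 1 = f 0 * q 0 + f 1 * q 1 := by
  have i0 := hg.continuousOn_left (hq 0)
  have i1 := hg.continuousOn_left (hq 1)
  have e1 : ∫ x in (0 : ℝ)..1, outcomeDensity g f q x = 1 := by
    simp only [outcomeDensity, Fin.sum_univ_two]
    rw [intervalIntegral.integral_add ((intervalIntegrable_of_continuousOn i0).const_mul _)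
      ((intervalIntegrable_of_continuousOn i1).const_mul _), intervalIntegral.integral_const_mul,
      intervalIntegral.integral_const_mul, hg.mass _ (hq 0), hg.mass _ (hq 1)]
    simpa using hf1
  have e2 : ∫ x in (0 : ℝ)..1, x * outcomeDensity g f q x = f 0 * q 0 + f 1 * q 1 := by
    have : ∀ x, x * outcomeDensity g f q x =
        f 0 * (x * g x (q 0)) + f 1 * (x * g x (q 1)) := fun x => by
      simp only [outcomeDensity, Fin.sum_univ_two]; ring
    simp only [this]
    rw [intervalIntegral.integral_add
      ((intervalIntegrable_of_continuousOn (continuousOn_id_mul i0)).const_mul _)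
      ((intervalIntegrable_of_continuousOn (continuousOn_id_mul i1)).const_mul _),
      intervalIntegral.integral_const_mul,
      intervalIntegral.integral_const_mul, hg.mean _ (hq 0), hg.mean _ (hq 1)]
  rw [poolMean, e1, e2, div_one]

/-- With full revelation of the outcome with probability `1 - ε` and no information otherwise,
marginal incentives are `1 - ε`. -/
theorem exists_feasible_mixture (hf : ∀ i, 0 < f i) (hf1 : ∑ i, f i = 1)
    (hg : OutcomeAssumption g) (hq : ∀ i, q i ∈ Ioo (0 : ℝ) 1) {ε : ℝ} (hε0 : 0 ≤ ε) (hε1 : ε ≤ 1)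
    (hcost : ∀ i, Cq C (q i) (θ i) = 1 - ε) :
    ∃ y : ℝ → ℝ, IsFeasible g C θ f q y ∧
      ∫ x in (0 : ℝ)..1, y x * g x (q 0) = (1 - ε) * q 0 + ε * (f 0 * q 0 + f 1 * q 1) := by
  have hc := continuousOn_outcomeDensity (f := f) hg hq
  have hp := outcomeDensity_pos hg hf hq
  have mono := fun {a b : ℝ} (ha : 0 ≤ a) (hb : b ≤ 1) => monotone_thresholdQuality hc hp ha hb
  have mF := (mono le_rfl zero_le_one).monotoneOn (Icc 0 1)
  have mN := (mono le_rfl le_rfl).monotoneOn (Icc 0 1)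
  have iF := intervalIntegrable_of_monotoneOn mF
  have iN := intervalIntegrable_of_monotoneOn mN
  have jF := isMajorized_thresholdQuality hc hp le_rfl le_rfl zero_le_one
  have jN := isMajorized_thresholdQuality hc hp le_rfl zero_le_one le_rfl
  have hs : 0 ≤ 1 - ε := by linarith
  refine ⟨_, ⟨hq, fun i => ?_, monotoneOn_comb mF mN mN hs hε0 le_rfl,
    isMajorized_comb hc iF iN iN jF jN jN hs hε0 le_rfl (by ring)⟩, ?_⟩
  · have hK := hg.continuousOn_gq_left (hq i)
    rw [integral_comb iF iN iN hK, integral_id_threshold_gq hg (hq i),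
      integral_none_mul hc hp hK (hg.integral_gq (hq i)), hcost]
    ring
  · have hK := hg.continuousOn_left (hq 0)
    rw [integral_comb iF iN iN hK, integral_thresholdQuality_mul hc hp le_rfl zero_le_one le_rfl hK,
      poolMean_outcomeDensity hg hf1 hq, hg.mass _ (hq 0), thresholdQuality_self, hg.mean _ (hq 0)]
    simp

/-- Under full revelation every marginal cost is 1. Lowering incentives to `1 - ε` moves the
qualities to some `q'` near `q` and changes the low type's payoff by at least `ε (f 1 (q' 1 - q' 0)
- (q 0 - q' 0))`: a transfer from the high type minus a loss of size `ε` times the fall in quality.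
-/
theorem not_isOptimal_full (hf : ∀ i, 0 < f i) (hf1 : ∑ i, f i = 1)
    (hC : CostAssumption C (range θ)) (hg : OutcomeAssumption g) (hq : q 0 < q 1)
    (hpos : ∀ i, 0 < Cqq C (q i) (θ i)) : ¬ IsOptimal g C θ f ![1, 0] q fun x => x := by
  intro hopt
  have hQ := hopt.1.quality
  have hone : ∀ i, Cq C (q i) (θ i) = 1 := fun i => by
    rw [hopt.1.incentive i, hg.integral_id_mul_gq (hQ i)]
  have hf1' : f 0 + f 1 = 1 := by simpa using hf1
  have hf0 := hf 0
  -- `δ` bounds the fall in both qualities. Being below `f 1 (q 1 - q 0) / 2`, it keeps the transfer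
  -- larger than the loss, as `f 1 < 1`.
  obtain ⟨δ, hδ0, hδ⟩ := exists_between (lt_min (hQ 0).1
    (div_pos (mul_pos (hf 1) (sub_pos.2 hq)) two_pos))
  obtain ⟨hδ1, hδ2⟩ := lt_min_iff.1 hδ
  have hlow : ∀ i, 0 < q i - δ := Fin.forall_fin_two.2 ⟨by linarith, by linarith⟩
  have hlt : ∀ i, Cq C (q i - δ) (θ i) < 1 := fun i => by
    rw [← hone i]
    exact hC.Cq_lt_of_Cqq_pos (mem_range_self i) (hlow i).le (by linarith) (hQ i).2.le (hpos i)
  have hge : ∀ i, 0 ≤ Cq C (q i - δ) (θ i) := fun i =>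
    hC.Cq_nonneg _ (mem_range_self i) _ ⟨(hlow i).le, by linarith [(hQ i).2]⟩
  obtain ⟨ε, hε0, hε1, hε⟩ : ∃ ε : ℝ, 0 < ε ∧ ε ≤ 1 ∧ ∀ i, Cq C (q i - δ) (θ i) ≤ 1 - ε := by
    refine ⟨min (1 - Cq C (q 0 - δ) (θ 0)) (1 - Cq C (q 1 - δ) (θ 1)),
      lt_min (sub_pos.2 (hlt 0)) (sub_pos.2 (hlt 1)),
      (min_le_left _ _).trans (by linarith [hge 0]), Fin.forall_fin_two.2 ⟨?_, ?_⟩⟩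
    · linarith [min_le_left (1 - Cq C (q 0 - δ) (θ 0)) (1 - Cq C (q 1 - δ) (θ 1))]
    · linarith [min_le_right (1 - Cq C (q 0 - δ) (θ 0)) (1 - Cq C (q 1 - δ) (θ 1))]
  -- Positive `Cqq` puts the marginal costs at `q i - δ` below 1, so for this `ε` the value `1 - ε`
  -- is attained within `δ` of each quality.
  choose q' hq' hcost using fun i => hC.exists_Cq_eq (mem_range_self i) (hlow i).le
    (show q i - δ ≤ q i by linarith) (hQ i).2.le
    (show 1 - ε ∈ _ from ⟨hε i, by rw [hone i]; linarith⟩)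
  have hQ' : ∀ i, q' i ∈ Ioo (0 : ℝ) 1 := fun i =>
    ⟨(hlow i).trans_le (hq' i).1, (hq' i).2.trans_lt (hQ i).2⟩
  obtain ⟨y, hy, hval⟩ := exists_feasible_mixture hf hf1 hg hQ' hε0.le hε1 hcost
  have hle := hopt.2 q' y hy
  rw [welfare_low, welfare_low, mul_le_mul_iff_left₀ hf0, sellerPayoff, sellerPayoff, hval,
    hg.mean _ (hQ 0)] at hle
  have hconv := hC.mul_sub_le_cost_sub (mem_range_self 0) (hQ' 0).1.le (hq' 0).2 (hQ 0).2.le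
    (hcost 0).ge
  have hgain : 0 < f 1 * (q' 1 - q' 0) - (q 0 - q' 0) := by
    have : f 1 * (q 1 - δ - q 0) ≤ f 1 * (q' 1 - q' 0) :=
      mul_le_mul_of_nonneg_left (by linarith [(hq' 1).1, (hq' 0).2]) (hf 1).le
    nlinarith [(hq' 0).1]
  have := mul_pos hε0 hgain
  have e : f 0 = 1 - f 1 := by linarith
  rw [e] at hle
  nlinarith

end Model

end RatingDesign

/-! ### The threshold quality as signaled quality of the threshold rating -/

namespace RatingDesign

section Signal

variable {h : ℝ → ℝ} {x₁ x₂ : ℝ}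

/-- The pooled signal is the midpoint, itself a point of the pool, so the threshold quality can
serve as the price function of the signal. -/
theorem thresholdQuality_thresholdSignal (x : ℝ) :
    thresholdQuality h x₁ x₂ (thresholdSignal x₁ x₂ x) = thresholdQuality h x₁ x₂ x := by
  by_cases hx : x ∈ Ioo x₁ x₂
  · have hm : (x₁ + x₂) / 2 ∈ Ioo x₁ x₂ := by
      constructor <;> linarith [hx.1, hx.2]
    rw [thresholdSignal, if_pos hx, thresholdQuality_of_mem hm, thresholdQuality_of_mem hx]
  · rw [thresholdSignal, if_neg hx]

theorem preimage_thresholdSignal_inter (x₁ x₂ : ℝ) (B : Set ℝ) :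
    Ioo x₁ x₂ ∩ thresholdSignal x₁ x₂ ⁻¹' B = Ioo x₁ x₂ ∨
      Ioo x₁ x₂ ∩ thresholdSignal x₁ x₂ ⁻¹' B = ∅ := by
  by_cases hB : (x₁ + x₂) / 2 ∈ B
  · refine .inl (inter_eq_left.2 fun x hx => ?_)
    rwa [mem_preimage, thresholdSignal, if_pos hx]
  · refine .inr (eq_empty_of_forall_notMem fun x hx => hB ?_)
    have := hx.2
    rwa [mem_preimage, thresholdSignal, if_pos hx.1] at this

/-- On every event generated by the threshold rating, the threshold signaled quality and the
outcome have the same integral. -/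
theorem integral_indicator_thresholdQuality (hc : ContinuousOn h (Icc 0 1))
    (hp : ∀ x ∈ Ioo (0 : ℝ) 1, 0 < h x) (h0 : 0 ≤ x₁) (h12 : x₁ ≤ x₂) (h1 : x₂ ≤ 1) (B : Set ℝ) :
    ∫ x in (0 : ℝ)..1, (thresholdSignal x₁ x₂ ⁻¹' B).indicator
      (fun x => (thresholdQuality h x₁ x₂ x - x) * h x) x = 0 := by
  have e : (thresholdSignal x₁ x₂ ⁻¹' B).indicator
      (fun x => (thresholdQuality h x₁ x₂ x - x) * h x) =
      (Ioo x₁ x₂ ∩ thresholdSignal x₁ x₂ ⁻¹' B).indicator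
        (fun x => (thresholdQuality h x₁ x₂ x - x) * h x) := by
    rw [inter_comm, ← indicator_indicator]
    congr 1
    funext x
    by_cases hx : x ∈ Ioo x₁ x₂
    · rw [indicator_of_mem hx]
    · rw [indicator_of_notMem hx, thresholdQuality_of_notMem hx, sub_self, zero_mul]
  rw [e]
  -- The signal is constant on the pool, so an event contains all of it or none; outside it there is
  -- no distortion.
  rcases preimage_thresholdSignal_inter x₁ x₂ B with hB | hB
  · rw [hB]
    convert (isMajorized_thresholdQuality hc hp h0 h12 h1).2 using 2
    funext x
    by_cases hx : x ∈ Ioo x₁ x₂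
    · rw [indicator_of_mem hx]
    · rw [indicator_of_notMem hx, thresholdQuality_of_notMem hx, sub_self, zero_mul]
  · simp [hB]

end Signal

section Law

variable {g : ℝ → ℝ → ℝ} {f q : Fin 2 → ℝ}

theorem integral_outcomeLaw (hg : OutcomeAssumption g) (hf : ∀ i, 0 < f i)
    (hq : ∀ i, q i ∈ Ioo (0 : ℝ) 1) (u : ℝ → ℝ) :
    ∫ x, u x ∂(outcomeLaw g f q) = ∫ x in (0 : ℝ)..1, u x * outcomeDensity g f q x := by
  have hm : AEMeasurable (outcomeDensity g f q) (volume.restrict (Icc 0 1)) :=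
    (continuousOn_outcomeDensity hg hq).aemeasurable measurableSet_Icc
  rw [outcomeLaw, integral_withDensity_eq_integral_toReal_smul₀ hm.ennreal_ofReal (by simp),
    integral_zero_one_eq_Ioo, integral_Icc_eq_integral_Ioo]
  refine setIntegral_congr_fun measurableSet_Ioo fun x hx => ?_
  simp only [smul_eq_mul]
  rw [ENNReal.toReal_ofReal (outcomeDensity_pos hg hf hq x hx).le, mul_comm]

theorem isFiniteMeasure_outcomeLaw (hg : OutcomeAssumption g)
    (hq : ∀ i, q i ∈ Ioo (0 : ℝ) 1) : IsFiniteMeasure (outcomeLaw g f q) :=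
  isFiniteMeasure_withDensity_ofReal
    ((continuousOn_outcomeDensity hg hq).integrableOn_Icc.2)

theorem ae_outcomeLaw_mem (g : ℝ → ℝ → ℝ) (f q : Fin 2 → ℝ) :
    ∀ᵐ x ∂(outcomeLaw g f q), x ∈ Icc (0 : ℝ) 1 :=
  (withDensity_absolutelyContinuous _ _).ae_le (ae_restrict_mem measurableSet_Icc)

theorem integrable_outcomeLaw_of_monotone (hg : OutcomeAssumption g)
    (hq : ∀ i, q i ∈ Ioo (0 : ℝ) 1) {u : ℝ → ℝ} (hu : Monotone u) :
    Integrable u (outcomeLaw g f q) := by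
  have := isFiniteMeasure_outcomeLaw (f := f) hg hq
  refine Integrable.of_mem_Icc (u 0) (u 1) hu.measurable.aemeasurable ?_
  filter_upwards [ae_outcomeLaw_mem g f q] with x hx using ⟨hu hx.1, hu hx.2⟩

theorem isSignaledQuality_thresholdQuality (hg : OutcomeAssumption g) (hf : ∀ i, 0 < f i)
    (hq : ∀ i, q i ∈ Ioo (0 : ℝ) 1) {x₁ x₂ : ℝ} (h0 : 0 ≤ x₁) (h12 : x₁ ≤ x₂) (h1 : x₂ ≤ 1) :
    IsSignaledQuality (outcomeLaw g f q) (thresholdRating x₁ x₂)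
      (thresholdQuality (outcomeDensity g f q) x₁ x₂) := by
  have hc := continuousOn_outcomeDensity (f := f) hg hq
  have hp := outcomeDensity_pos hg hf hq
  have hmono := monotone_thresholdQuality hc hp h0 h1
  have hT := hmono.measurable
  have hs := measurable_thresholdSignal x₁ x₂
  have hpair : Measurable fun x => (x, thresholdSignal x₁ x₂ x) := measurable_id.prodMk hs
  have := isFiniteMeasure_outcomeLaw (f := f) hg hq
  refine ⟨thresholdQuality (outcomeDensity g f q) x₁ x₂, hT, ?_, .of_forall fun x => ?_⟩
  · have hle : MeasurableSpace.comap (Prod.snd : ℝ × ℝ → ℝ) inferInstance ≤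
        (inferInstance : MeasurableSpace (ℝ × ℝ)) :=
      measurable_snd.comap_le
    have hiT := integrable_outcomeLaw_of_monotone (f := f) hg hq hmono
    have hiI : Integrable (fun x : ℝ => x) (outcomeLaw g f q) :=
      integrable_outcomeLaw_of_monotone hg hq monotone_id
    have hm : Measurable fun w : ℝ × ℝ => thresholdQuality (outcomeDensity g f q) x₁ x₂ w.2 :=
      hT.comp measurable_snd
    have hi : Integrable (fun w : ℝ × ℝ => thresholdQuality (outcomeDensity g f q) x₁ x₂ w.2)
        ((outcomeLaw g f q).map fun x => (x, thresholdSignal x₁ x₂ x)) := by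
      rw [integrable_map_measure hm.aestronglyMeasurable hpair.aemeasurable]
      exact hiT.congr (.of_forall fun x => (thresholdQuality_thresholdSignal x).symm)
    -- For a deterministic rating the joint law is the push-forward of the outcome law. The
    -- conditional expectation is then identified through integrals over the events `B` of the
    -- signal, which reduce to integrals over `[0,1]`.
    rw [thresholdRating, Measure.compProd_deterministic]
    refine ae_eq_condExp_of_forall_setIntegral_eq hle ?_ (fun _ _ _ => hi.integrableOn) ?_ ?_
    · rw [integrable_map_measure measurable_fst.aestronglyMeasurable hpair.aemeasurable]
      exact hiI
    · rintro _ ⟨B, hB, rfl⟩ -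
      have hB' : MeasurableSet ((Prod.snd : ℝ × ℝ → ℝ) ⁻¹' B) := measurable_snd hB
      have hsB : MeasurableSet (thresholdSignal x₁ x₂ ⁻¹' B) := hs hB
      rw [setIntegral_map hB' hm.aestronglyMeasurable hpair.aemeasurable,
        setIntegral_map hB' measurable_fst.aestronglyMeasurable hpair.aemeasurable]
      simp only [thresholdQuality_thresholdSignal]
      rw [← sub_eq_zero, ← integral_sub hiT.integrableOn hiI.integrableOn]
      change ∫ x in thresholdSignal x₁ x₂ ⁻¹' B, _ ∂_ = 0
      rw [← integral_indicator hsB, integral_outcomeLaw hg hf hq]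
      refine (intervalIntegral.integral_congr fun x _ => ?_).trans
        (integral_indicator_thresholdQuality hc hp h0 h12 h1 B)
      by_cases hx : x ∈ thresholdSignal x₁ x₂ ⁻¹' B
      · simp only [indicator_of_mem hx]
      · simp only [indicator_of_notMem hx, zero_mul]
    · exact (hT.comp (comap_measurable Prod.snd)).stronglyMeasurable.aestronglyMeasurable
  · rw [thresholdRating, Kernel.deterministic_apply, integral_dirac,
      thresholdQuality_thresholdSignal]

end Law

end RatingDesign

/-! ### The proposition -/

open RatingDesign in
theorem mainTheorem11
    (g C : ℝ → ℝ → ℝ) (θ f : Fin 2 → ℝ)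
    (hθ : θ 0 < θ 1) (hf : ∀ i, 0 < f i) (hf1 : ∑ i, f i = 1)
    (hC : CostAssumption C (Set.range θ))
    (hg : OutcomeAssumption g) (hcurv : CurvatureAssumption g)
    (q : Fin 2 → ℝ) (xbar : ℝ → ℝ)
    (hopt : IsOptimal g C θ f ![1, 0] q xbar) (hq : q 0 ≤ q 1) :
    ∃ x₁ x₂ : ℝ, 0 ≤ x₁ ∧ x₁ ≤ x₂ ∧ x₂ ≤ 1 ∧
      -- the threshold rating is optimal, with the same qualities
      IsSignaledQuality (outcomeLaw g f q) (thresholdRating x₁ x₂)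
        (thresholdQuality (outcomeDensity g f q) x₁ x₂) ∧
      IsOptimal g C θ f ![1, 0] q (thresholdQuality (outcomeDensity g f q) x₁ x₂) ∧
      -- the pooling interval is nondegenerate
      (q 0 < q 1 → (∀ i, 0 < Cqq C (q i) (θ i)) → x₁ < x₂) ∧
      -- uniqueness: the given optimal signaled quality has the threshold form
      (q 0 < q 1 →
        StrictMonoOn (curvatureRatio g (q 0) (q 1)) (ratioRange g (q 0) (q 1)) →
        ∀ x ∈ Set.Ioo (0 : ℝ) 1, x ≠ x₁ → x ≠ x₂ →
          xbar x = thresholdQuality (outcomeDensity g f q) x₁ x₂ x) := by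
  rcases hq.eq_or_lt with hq | hq
  · obtain ⟨x₁, x₂, h0, h12, h1, hT⟩ := exists_optimal_threshold_of_eq hf hf1 hg hopt hq
    exact ⟨x₁, x₂, h0, h12, h1,
      isSignaledQuality_thresholdQuality hg hf hopt.1.quality h0 h12 h1, hT,
      fun hlt => absurd hq hlt.ne, fun hlt => absurd hq hlt.ne⟩
  · obtain ⟨x₁, x₂, h0, h12, h1, hT, hu⟩ := exists_optimal_threshold_of_lt hf hg hcurv hopt hq
    refine ⟨x₁, x₂, h0, h12, h1,
      isSignaledQuality_thresholdQuality hg hf hopt.1.quality h0 h12 h1, hT,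
      fun _ hpos => h12.lt_of_ne ?_, fun _ => hu⟩
    -- A degenerate interval means full revelation, which is not optimal here.
    rintro rfl
    rw [thresholdQuality_self] at hT
    exact not_isOptimal_full hf hf1 hC hg hq hpos hT
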